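/- Conventions. Let $G=(V,E)$ be a finite simple graph with $n$ vertices, $m$ edges and minimum degree $\delta\ge 1$. Its edge connectivity $\lambda$ is the smallest number of edges whose removal disconnects $G$ (so $\lambda=0$ if $G$ is disconnected). For $S\subseteq V$ let $C(S)$ be the set of edges with exactly one endpoint in $S$. The cut $C(S)$ is non-trivial if $|S|\ge 2$ and $|V\setminus S|\ge 2$, and it is a $(2-\varepsilon)$-minimum cut if $|C(S)|\le(2-\varepsilon)\lambda$. For $D\subseteq E$, let $G/D$ be the multigraph obtained from $G$ by contracting the edges of $D$ and removing self-loops; surviving edges keep their identities. It preserves the cut $C(S)$ if $C(S)\cap D=\emptyset$. Algorithms run on a word RAM with words of $w$ bits, where $w\ge c\log n$ for a sufficiently large constant $c$; arithmetic operations, memory accesses and the drawing of a uniformly random integer from $\{0,\dots,k-1\}$ (where $k$ is a word) take constant time. The input is $n$, $m$ and a list of the edges in arbitrary order. Theorem. Let $\varepsilon\in(0,1]$ and $\gamma>0$ be constants. There is a randomized algorithm that, given any such $G$, always runs in $O(m\log n)$ time and outputs a multigraph $\widehat G=G/D$, for some (random) set $D\subseteq E$, that always has $O(n/\delta)$ vertices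 and $O(n)$ edges, and such that, with probability at least $1-n^{-\gamma}$, $\widehat G$ preserves all non-trivial $(2-\varepsilon)$-minimum cuts of $G$ simultaneously. The constants hidden in the $O$-notation, and $c$, depend only on $\varepsilon$ and $\gamma$. -/

import Mathlib

/-! ## A randomized word RAM

Memory cells and registers hold words, that is, natural numbers below `2 ^ w`.
Programs are finite pieces of structured code. -/

namespace WordRAM

/-- Arithmetic on `w`-bit words. -/
inductive BinOp
  | add | sub | mul | div | mod | lt | eq

/-- The result of an operation, reduced modulo `2 ^ w`.
Subtraction is truncated at `0`; comparisons return `1` (true) or `0` (false). -/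
def BinOp.eval (w : ℕ) : BinOp → ℕ → ℕ → ℕ
  | .add, a, b => (a + b) % 2 ^ w
  | .sub, a, b => (a - b) % 2 ^ w
  | .mul, a, b => (a * b) % 2 ^ w
  | .div, a, b => (a / b) % 2 ^ w
  | .mod, a, b => (a % b) % 2 ^ w
  | .lt, a, b => (if a < b then 1 else 0) % 2 ^ w
  | .eq, a, b => (if a = b then 1 else 0) % 2 ^ w

/-- Expressions: numerals, registers, memory reads (indirect addressing) and arithmetic. -/
inductive Expr
  | const (k : ℕ)
  | reg (i : ℕ)
  | load (addr : Expr)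
  | op (o : BinOp) (a b : Expr)

/-- Statements. `rand i e` draws a fresh uniformly random number below the value of `e`
and puts it into register `i`. -/
inductive Stmt
  | skip
  | assign (i : ℕ) (e : Expr)
  | store (addr val : Expr)
  | rand (i : ℕ) (bound : Expr)
  | seq (p q : Stmt)
  | ite (e : Expr) (p q : Stmt)
  | loop (e : Expr) (p : Stmt)

/-- Contents of the registers and of the memory. -/
@[ext]
structure State where
  reg : ℕ → ℕ
  mem : ℕ → ℕ

def State.setReg (s : State) (i x : ℕ) : State := { s with reg := Function.update s.reg i x }

def State.setMem (s : State) (a x : ℕ) : State := { s with mem := Function.update s.mem a x }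

def Expr.eval (w : ℕ) (s : State) : Expr → ℕ
  | .const k => k % 2 ^ w
  | .reg i => s.reg i
  | .load a => s.mem (a.eval w s)
  | .op o a b => o.eval w (a.eval w s) (b.eval w s)

/-- A configuration: the stack of statements that remain to be executed, and the state.
The machine has halted when the stack is empty. -/
abbrev Config := List Stmt × State

/-- The uniform distribution on `{0, …, k - 1}`; by convention the constant `0` if `k = 0`. -/
noncomputable def uniformBelow : ℕ → PMF ℕ
  | 0 => PMF.pure 0
  | k + 1 => (PMF.uniformOfFintype (Fin (k + 1))).map Fin.val

/-- One step of the machine with word length `w`, as a transition kernel of a Markov chain.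
The nonzero words count as true. Each step evaluates at most two expressions of the program;
these have a fixed size, so a step stands for boundedly many elementary RAM operations. -/
noncomputable def step (w : ℕ) : Config → PMF Config
  | ([], s) => PMF.pure ([], s)
  | (.skip :: k, s) => PMF.pure (k, s)
  | (.assign i e :: k, s) => PMF.pure (k, s.setReg i (e.eval w s))
  | (.store a v :: k, s) => PMF.pure (k, s.setMem (a.eval w s) (v.eval w s))
  | (.rand i e :: k, s) => (uniformBelow (e.eval w s)).map fun x => (k, s.setReg i x)
  | (.seq p q :: k, s) => PMF.pure (p :: q :: k, s)
  | (.ite e p q :: k, s) => PMF.pure ((if e.eval w s ≠ 0 then p else q) :: k, s)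
  | (.loop e p :: k, s) =>
      PMF.pure (if e.eval w s ≠ 0 then p :: .loop e p :: k else k, s)

/-- The distribution of the configuration after `T` steps. -/
noncomputable def run (w : ℕ) : ℕ → Config → PMF Config
  | 0, c => PMF.pure c
  | T + 1, c => (step w c).bind (run w T)

end WordRAM

/-! ## Cuts, edge connectivity, contraction -/

namespace MinCut

/-- The edges of `G` with exactly one endpoint in `S`. -/
def cutEdges {V : Type*} (G : SimpleGraph V) (S : Set V) : Set (Sym2 V) :=
  {e | e ∈ G.edgeSet ∧ ∃ u ∈ S, ∃ v ∉ S, e = s(u, v)}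

/-- The smallest number of edges whose removal disconnects the graph. -/
noncomputable def edgeConnectivity {V : Type*} (G : SimpleGraph V) : ℕ :=
  sInf {k | ∃ D : Finset (Sym2 V), ↑D ⊆ G.edgeSet ∧ D.card = k ∧
    ¬ (G.deleteEdges (D : Set (Sym2 V))).Connected}

/-- `S` defines a non-trivial cut (at least two vertices on either side)
whose size is at most `α` times the edge connectivity. -/
def IsNontrivialSmallCut {V : Type*} (G : SimpleGraph V) (α : ℝ) (S : Set V) : Prop :=
  S.Nontrivial ∧ Sᶜ.Nontrivial ∧ ((cutEdges G S).ncard : ℝ) ≤ α * edgeConnectivity G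

/-- The vertices of the contraction of the edge set `D`:
the connected components of the graph with edge set `D`. -/
abbrev Node {V : Type*} (D : Set (Sym2 V)) : Type _ :=
  (SimpleGraph.fromEdgeSet D).ConnectedComponent

/-- The node into which a vertex is contracted. -/
abbrev node {V : Type*} (D : Set (Sym2 V)) (v : V) : Node D :=
  (SimpleGraph.fromEdgeSet D).connectedComponentMk v

/-- The multigraph `G / D`: the edges in `D` are contracted and self-loops are removed.
The surviving edges keep their identity, so parallel edges remain distinct. -/
def contract {V : Type*} (G : SimpleGraph V) (D : Set (Sym2 V)) : Graph (Node D) (Sym2 V) where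
  vertexSet := Set.univ
  IsLink e x y := e ∈ G.edgeSet ∧ x ≠ y ∧ ∃ u v, e = s(u, v) ∧ node D u = x ∧ node D v = y
  isLink_symm := by
    rintro e -
    refine ⟨?_⟩
    rintro x y ⟨he, hne, u, v, rfl, hu, hv⟩
    exact ⟨he, hne.symm, v, u, Sym2.eq_swap, hv, hu⟩
  eq_or_eq_of_isLink_of_isLink := by
    rintro e x y v w ⟨-, -, a, b, rfl, rfl, rfl⟩ ⟨-, -, c, d, h, rfl, rfl⟩
    rcases Sym2.eq_iff.1 h with ⟨rfl, rfl⟩ | ⟨rfl, rfl⟩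
    · exact Or.inl rfl
    · exact Or.inr rfl
  left_mem_of_isLink := fun _ _ _ _ => Set.mem_univ _

/-! ## Input and output of the algorithm -/

/-- `ends` lists every edge of `G` exactly once, in any order and with any orientation.
The index of an edge in this list is its identifier. -/
def IsEdgeList {n m : ℕ} (G : SimpleGraph (Fin n)) (ends : Fin m → Fin n × Fin n) : Prop :=
  Function.Injective (fun j => s((ends j).1, (ends j).2)) ∧
    Set.range (fun j => s((ends j).1, (ends j).2)) = G.edgeSet

/-- The memory initially holds `n`, `m`, and then the two endpoints of each edge in turn.
All other cells, and all registers, are `0`. -/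
def inputState {n m : ℕ} (ends : Fin m → Fin n × Fin n) : WordRAM.State where
  reg := fun _ => 0
  mem := fun a =>
    if a = 0 then n
    else if a = 1 then m
    else if h : (a - 2) / 2 < m then
      if a % 2 = 0 then (ends ⟨(a - 2) / 2, h⟩).1 else (ends ⟨(a - 2) / 2, h⟩).2
    else 0

/-- The state `s` holds the multigraph `G / D`. Registers `0` and `1` hold its numbers of nodes
and of edges. The nodes are numbered by `num`. From the address in register `2` on there is a
record of three words for each surviving edge: its identifier, followed by the numbers of the two
nodes that it joins. From the address in register `3` on there is, for each vertex of `G`,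
the number of the node into which it is contracted. -/
def HoldsContraction {n m : ℕ} (G : SimpleGraph (Fin n)) (ends : Fin m → Fin n × Fin n)
    (D : Set (Sym2 (Fin n))) (s : WordRAM.State) : Prop :=
  ∃ (num : Node D ≃ Fin (s.reg 0)) (ids : Fin (s.reg 1) → Fin m),
    Function.Injective ids ∧
    Set.range ids = {j | s((ends j).1, (ends j).2) ∈ (contract G D).edgeSet} ∧
    (∀ k : Fin (s.reg 1),
      s.mem (s.reg 2 + 3 * k) = ids k ∧
      s.mem (s.reg 2 + 3 * k + 1) = num (node D (ends (ids k)).1) ∧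
      s.mem (s.reg 2 + 3 * k + 2) = num (node D (ends (ids k)).2)) ∧
    ∀ v : Fin n, s.mem (s.reg 3 + v) = num (node D v)

end MinCut

/-! The algorithm is a vote among `q = A * Nat.size n` independent random contractions. In a round
every vertex picks two random incident edges (with repetition), and every edge is moreover sampled
with probability `1 / (2 * δ)`; these edges are contracted. If at most `K * n` edges survive, that
is, join different components, each survivor gets a vote. In the end the edges with fewer than `q /
B` votes are contracted.

Size. The threshold `K * n` limits the votes per round with certainty, so at most `B * K * n` edges
are left uncontracted, whatever the random choices. A vertex whose final component has fewer than `δ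
/ 2` vertices has more than `δ / 2` uncontracted edges, so O(n) such edges leave only O(n/δ)
components (`card_node_le_of_ncard_le`).

Few survivors on average. Exploring the component of a vertex along the picks shows that it has
fewer than `δ / 48` vertices with probability at most `4 / δ` (`explore`), so the picks leave at
most `52 * n / δ` components on average. Sampling every edge with probability `1 / c` then leaves on
average at most `c` crossing edges per component: an edge found crossing destroys a component with
probability `1 / c` (`avgs_crossing_coins_le`). With `c = 2 * δ` this gives `104 * n` survivors.

Cuts are avoided. Let C be a non-trivial (2-ε)-minimum cut with c(u) edges at the vertex u. Moving u
to the other side leaves a cut, which has at least λ edges, whence c(u) ≤ (1-ε/2) deg(u)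
(`two_mul_ncard_inter_le`). So each pick avoids C with probability at least ε/2, and as at most 9
draws hit C on average, the whole round avoids C with probability at least r = exp(-18/ε)
(`exp_le_avgs_avoid`). By Markov's inequality for the survivors, a fixed edge of C gets a vote with
probability at least r/2, so a round multiplies the expectation of (1/2)^votes by at most 1 - r/4
(`avgs_half_pow_le`). Over all rounds, Markov's inequality and a union bound over the at most n²
edges on such cuts, rather than over the cuts themselves, show that none of these edges is
contracted (`wp_rounds`, `failure_le`).

Machine. Runs are analysed by a calculus of expectations with values in [0,∞] (`WP`). The value ∞
stands for a run that has not halted or a broken invariant, so a single finite bound yields sure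
termination, the sure size bounds and the failure probability. A round takes linear time thanks to a
graph search on half-edges (`det_findComponents`). -/

open scoped ENNReal

namespace WordRAM

/-! ### Expected value of a running program -/

/-- The expected value of `g` at the state in which the machine has halted after `T` steps;
configurations that have not halted count as `∞`. -/
noncomputable def haltExp (w T : ℕ) (c : Config) (g : State → ℝ≥0∞) : ℝ≥0∞ :=
  ∑' C, run w T c C * (if C.1 = [] then g C.2 else ∞)

theorem haltExp_zero (w : ℕ) (c : Config) (g : State → ℝ≥0∞) :
    haltExp w 0 c g = if c.1 = [] then g c.2 else ∞ := by
  unfold haltExp run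
  rw [tsum_eq_single c]
  · simp
  · intro C hC
    simp [PMF.pure_apply, hC]

theorem haltExp_succ (w T : ℕ) (c : Config) (g : State → ℝ≥0∞) :
    haltExp w (T + 1) c g = ∑' c', step w c c' * haltExp w T c' g := by
  unfold haltExp
  simp only [run, PMF.bind_apply, ← ENNReal.tsum_mul_right, ← ENNReal.tsum_mul_left]
  rw [ENNReal.tsum_comm]
  simp only [mul_assoc]

theorem haltExp_succ_pure {w T : ℕ} {c c' : Config} {g : State → ℝ≥0∞}
    (h : step w c = PMF.pure c') : haltExp w (T + 1) c g = haltExp w T c' g := by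
  rw [haltExp_succ, h, tsum_eq_single c']
  · simp
  · intro C hC
    simp [PMF.pure_apply, hC]

/-- A halted configuration steps to itself and any other counts as `∞`, so running longer can only
lower the value. Hence every time bound may be weakened freely. -/
theorem haltExp_succ_le (w T : ℕ) (c : Config) (g : State → ℝ≥0∞) :
    haltExp w (T + 1) c g ≤ haltExp w T c g := by
  induction T generalizing c with
  | zero =>
    by_cases hc : c.1 = []
    · obtain ⟨k, s⟩ := c
      obtain rfl : k = [] := hc
      rw [haltExp_succ_pure (c' := ([], s)) (by simp [step])]
    · simp [haltExp_zero w c, hc]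
  | succ T ih =>
    rw [haltExp_succ w (T + 1), haltExp_succ w T]
    gcongr
    exact ih _

theorem haltExp_antitone (w : ℕ) (c : Config) (g : State → ℝ≥0∞) :
    Antitone fun T => haltExp w T c g :=
  antitone_nat_of_succ_le fun T => haltExp_succ_le w T c g

/-- From the state `s`, the program `p` terminates within `T` steps, and the expected value
of `f` at its final state is at most `b`. -/
def WP (w : ℕ) (p : Stmt) (s : State) (T : ℕ) (f : State → ℝ≥0∞) (b : ℝ≥0∞) : Prop :=
  ∀ k T' g, (∀ s', haltExp w T' (k, s') g ≤ f s') → haltExp w (T + T') (p :: k, s) g ≤ b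

/-- From the state `s`, the program `p` surely ends in the state `s'`, within `T` steps. -/
def Det (w : ℕ) (p : Stmt) (s : State) (T : ℕ) (s' : State) : Prop :=
  ∀ f, WP w p s T f (f s')

variable {w : ℕ}

theorem WP.haltExp_le {p : Stmt} {s : State} {T : ℕ} {f : State → ℝ≥0∞} {b : ℝ≥0∞}
    (h : WP w p s T f b) : haltExp w T ([p], s) f ≤ b :=
  h [] 0 f fun s' => by simp [haltExp_zero]

theorem WP.mono {p : Stmt} {s : State} {T T₁ : ℕ} {f f₁ : State → ℝ≥0∞} {b b₁ : ℝ≥0∞}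
    (h : WP w p s T f b) (hT : T ≤ T₁) (hf : ∀ s', f₁ s' ≤ f s') (hb : b ≤ b₁) :
    WP w p s T₁ f₁ b₁ := fun k T' g hg =>
  (haltExp_antitone w _ g (by omega : T + T' ≤ T₁ + T')).trans
    ((h k T' g fun s' => (hg s').trans (hf s')).trans hb)

theorem WP.top (p : Stmt) (s : State) (T : ℕ) (f : State → ℝ≥0∞) : WP w p s T f ∞ :=
  fun _ _ _ _ => le_top

/-- The definition of `WP` quantifies over the rest of the stack, so the second program can be taken
as part of the continuation of the first. Intermediate states with value `∞` need no treatment; in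
this way `∞` serves to discard the states that violate an invariant. -/
theorem WP.seq {p q : Stmt} {s : State} {T₁ T₂ : ℕ} {f g : State → ℝ≥0∞} {b : ℝ≥0∞}
    (hp : WP w p s T₁ f b) (hq : ∀ s', f s' ≠ ∞ → WP w q s' T₂ g (f s')) :
    WP w (.seq p q) s (T₁ + T₂ + 1) g b := by
  intro k T' φ hφ
  rw [show T₁ + T₂ + 1 + T' = (T₁ + (T₂ + T')) + 1 by ring,
    haltExp_succ_pure (c' := (p :: q :: k, s)) (by simp [step])]
  refine hp _ _ _ fun s' => ?_
  by_cases h : f s' = ∞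
  · simp [h]
  · exact hq s' h _ _ _ hφ

theorem WP.rand {i : ℕ} {e : Expr} {s : State} {f : State → ℝ≥0∞} :
    WP w (.rand i e) s 1 f (∑' x, uniformBelow (e.eval w s) x * f (s.setReg i x)) := by
  intro k T' φ hφ
  rw [add_comm, haltExp_succ]
  simp only [step, PMF.map, PMF.bind_apply]
  simp only [← ENNReal.tsum_mul_right]
  rw [ENNReal.tsum_comm]
  gcongr with x
  simp only [mul_assoc, ENNReal.tsum_mul_left]
  gcongr
  rw [tsum_eq_single (k, s.setReg i x)]
  · simpa using hφ _
  · intro C hC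
    simp [PMF.pure_apply, hC]

theorem tsum_uniformBelow {k : ℕ} (hk : 0 < k) (f : ℕ → ℝ≥0∞) :
    ∑' x, uniformBelow k x * f x = (∑ x ∈ Finset.range k, f x) / k := by
  obtain ⟨k, rfl⟩ := Nat.exists_eq_succ_of_ne_zero hk.ne'
  have : ∀ x, uniformBelow (k + 1) x = if x ∈ Finset.range (k + 1) then ((k + 1 : ℕ) : ℝ≥0∞)⁻¹ else 0 := by
    intro x
    simp only [uniformBelow, PMF.map_apply, tsum_fintype, PMF.uniformOfFintype_apply,
      Fintype.card_fin]
    split_ifs with hx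
    · rw [Finset.sum_eq_single (⟨x, Finset.mem_range.1 hx⟩ : Fin (k + 1))]
      · simp
      · intro b _ hb
        rw [if_neg]
        rintro rfl
        exact hb rfl
      · simp
    · refine Finset.sum_eq_zero fun b _ => if_neg ?_
      rintro rfl
      exact hx (Finset.mem_range.2 b.2)
  simp only [this]
  rw [tsum_eq_sum (s := Finset.range (k + 1)) (fun x hx => by rw [if_neg hx, zero_mul]),
    Finset.sum_congr rfl fun x hx => by rw [if_pos hx], ← Finset.mul_sum, mul_comm,
    ENNReal.div_eq_inv_mul, mul_comm]

theorem Det.wp {p : Stmt} {s s' : State} {T : ℕ} {f : State → ℝ≥0∞} {b : ℝ≥0∞}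
    (h : Det w p s T s') (hb : f s' ≤ b) : WP w p s T f b :=
  (h f).mono le_rfl (fun _ => le_rfl) hb

theorem Det.mono {p : Stmt} {s s' : State} {T T₁ : ℕ} (h : Det w p s T s') (hT : T ≤ T₁) :
    Det w p s T₁ s' := fun f => (h f).mono hT (fun _ => le_rfl) le_rfl

theorem Det.seq_wp {p q : Stmt} {s s' : State} {T₁ T₂ : ℕ} {f : State → ℝ≥0∞} {b : ℝ≥0∞}
    (hp : Det w p s T₁ s') (hq : WP w q s' T₂ f b) : WP w (.seq p q) s (T₁ + T₂ + 1) f b := by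
  classical
  -- A postcondition that is `∞` away from `s'` forces the intermediate state to be `s'`.
  refine WP.seq (f := fun t => if t = s' then b else ∞) (hp.wp (by simp)) fun t ht => ?_
  have : t = s' := by by_contra h; simp [h] at ht
  subst this
  simpa using hq

theorem Det.seq {p q : Stmt} {s s' s'' : State} {T₁ T₂ : ℕ}
    (hp : Det w p s T₁ s') (hq : Det w q s' T₂ s'') : Det w (.seq p q) s (T₁ + T₂ + 1) s'' :=
  fun f => hp.seq_wp (hq f)

theorem Det.of_step {p : Stmt} {s s' : State}
    (h : ∀ k, step w (p :: k, s) = PMF.pure (k, s')) : Det w p s 1 s' := by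
  intro f k T' g hg
  rw [add_comm, haltExp_succ_pure (h k)]
  exact hg s'

theorem WP.ite {e : Expr} {p q : Stmt} {s : State} {T : ℕ} {f : State → ℝ≥0∞} {b : ℝ≥0∞}
    (h : WP w (if e.eval w s ≠ 0 then p else q) s T f b) : WP w (.ite e p q) s (T + 1) f b := by
  intro k T' g hg
  rw [show T + 1 + T' = (T + T') + 1 by ring,
    haltExp_succ_pure (c' := ((if e.eval w s ≠ 0 then p else q) :: k, s)) (by simp [step])]
  exact h _ _ _ hg

theorem WP.loop_true {e : Expr} {p : Stmt} {s : State} {T₁ T₂ : ℕ} {f g : State → ℝ≥0∞}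
    {b : ℝ≥0∞} (he : e.eval w s ≠ 0) (hp : WP w p s T₁ f b)
    (hq : ∀ s', f s' ≠ ∞ → WP w (.loop e p) s' T₂ g (f s')) :
    WP w (.loop e p) s (T₁ + T₂ + 1) g b := by
  intro k T' φ hφ
  rw [show T₁ + T₂ + 1 + T' = (T₁ + (T₂ + T')) + 1 by ring,
    haltExp_succ_pure (c' := (p :: .loop e p :: k, s)) (by simp [step, he])]
  refine hp _ _ _ fun s' => ?_
  by_cases h : f s' = ∞
  · simp [h]
  · exact hq s' h _ _ _ hφ

theorem Det.loop_false {e : Expr} {p : Stmt} {s : State} (he : e.eval w s = 0) :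
    Det w (.loop e p) s 1 s := by
  intro f k T' g hg
  rw [add_comm, haltExp_succ_pure (c' := (k, s)) (by simp [step, he])]
  exact hg s

theorem Det.loop_true {e : Expr} {p : Stmt} {s s' s'' : State} {T₁ T₂ : ℕ}
    (he : e.eval w s ≠ 0) (hp : Det w p s T₁ s') (hq : Det w (.loop e p) s' T₂ s'') :
    Det w (.loop e p) s (T₁ + T₂ + 1) s'' := by
  classical
  intro f
  refine WP.loop_true he (f := fun t => if t = s' then f s'' else ∞) (hp.wp (by simp))
    fun t ht => ?_
  have : t = s' := by by_contra h; simp [h] at ht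
  subst this
  simpa using hq f

/-! ### Code without loops and random draws -/

/-- Whether a statement has neither loops nor random draws. -/
def Stmt.IsSimple : Stmt → Bool
  | .skip => true
  | .assign _ _ => true
  | .store _ _ => true
  | .rand _ _ => false
  | .seq p q => p.IsSimple && q.IsSimple
  | .ite _ p q => p.IsSimple && q.IsSimple
  | .loop _ _ => false

/-- A bound for the running time of a statement without loops. -/
def Stmt.cost : Stmt → ℕ
  | .skip => 1
  | .assign _ _ => 1
  | .store _ _ => 1
  | .rand _ _ => 1
  | .seq p q => p.cost + q.cost + 1
  | .ite _ p q => p.cost + q.cost + 1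
  | .loop _ _ => 1

/-- The result of an operation on unbounded numbers. -/
def BinOp.exact : BinOp → ℕ → ℕ → ℕ
  | .add, a, b => a + b
  | .sub, a, b => a - b
  | .mul, a, b => a * b
  | .div, a, b => a / b
  | .mod, a, b => a % b
  | .lt, a, b => if a < b then 1 else 0
  | .eq, a, b => if a = b then 1 else 0

/-- A condition under which an operation on numbers below `W` does not overflow. -/
def BinOp.Fits (W : ℕ) : BinOp → ℕ → ℕ → Prop
  | .add, a, b => a + b < W
  | .sub, a, _ => a < W
  | .mul, a, b => a * b < W
  | .div, a, _ => a < W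
  | .mod, a, _ => a < W
  | .lt, _, _ => True
  | .eq, _, _ => True

theorem BinOp.eval_eq {w : ℕ} (hw : 1 < 2 ^ w) {o : BinOp} {a b : ℕ} (h : o.Fits (2 ^ w) a b) :
    o.eval w a b = o.exact a b := by
  cases o <;> simp only [BinOp.eval, BinOp.exact, BinOp.Fits] at h ⊢ <;>
    refine Nat.mod_eq_of_lt ?_
  · exact h
  · exact (Nat.sub_le _ _).trans_lt h
  · exact h
  · exact (Nat.div_le_self _ _).trans_lt h
  · exact (Nat.mod_le _ _).trans_lt h
  all_goals split_ifs <;> omega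

/-- The value of an expression in unbounded arithmetic. -/
def Expr.exact (s : State) : Expr → ℕ
  | .const k => k
  | .reg i => s.reg i
  | .load a => s.mem (a.exact s)
  | .op o a b => o.exact (a.exact s) (b.exact s)

/-- No operation in the evaluation of the expression overflows. -/
def Expr.Fits (W : ℕ) (s : State) : Expr → Prop
  | .const k => k < W
  | .reg _ => True
  | .load a => a.Fits W s
  | .op o a b => a.Fits W s ∧ b.Fits W s ∧ o.Fits W (a.exact s) (b.exact s)

theorem Expr.eval_eq {w : ℕ} (hw : 1 < 2 ^ w) {s : State} {e : Expr} (h : e.Fits (2 ^ w) s) :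
    e.eval w s = e.exact s := by
  induction e with
  | const k => exact Nat.mod_eq_of_lt h
  | reg i => rfl
  | load a ih => exact congrArg s.mem (ih h)
  | op o a b iha ihb =>
    simp only [Expr.eval, Expr.exact, iha h.1, ihb h.2.1]
    exact BinOp.eval_eq hw h.2.2

/-- The effect, in unbounded arithmetic, of a statement that has neither loops nor random draws. -/
def Stmt.exec : Stmt → State → State
  | .skip, s => s
  | .assign i e, s => s.setReg i (e.exact s)
  | .store a v, s => s.setMem (a.exact s) (v.exact s)
  | .rand _ _, s => s
  | .seq p q, s => q.exec (p.exec s)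
  | .ite e p q, s => if e.exact s ≠ 0 then p.exec s else q.exec s
  | .loop _ _, s => s

/-- No operation in the execution of the statement overflows. -/
def Stmt.Fits (W : ℕ) : Stmt → State → Prop
  | .skip, _ => True
  | .assign _ e, s => e.Fits W s
  | .store a v, s => a.Fits W s ∧ v.Fits W s
  | .rand _ _, _ => True
  | .seq p q, s => p.Fits W s ∧ q.Fits W (p.exec s)
  | .ite e p q, s => e.Fits W s ∧ if e.exact s ≠ 0 then p.Fits W s else q.Fits W s
  | .loop _ _, _ => True

/-- Straight-line code becomes a function on states over unbounded arithmetic: running it amounts to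
computing `exec` and checking that nothing overflows. -/
theorem det_exec (hw : 1 < 2 ^ w) (p : Stmt) (hp : p.IsSimple) (s : State)
    (h : p.Fits (2 ^ w) s) : Det w p s p.cost (p.exec s) := by
  induction p generalizing s with
  | skip => exact Det.of_step fun k => by simp [step, Stmt.exec]
  | assign i e =>
    exact Det.of_step fun k => by
      simp [step, Stmt.exec, Expr.eval_eq hw (show e.Fits _ s from h)]
  | store a v =>
    exact Det.of_step fun k => by
      simp [step, Stmt.exec, Expr.eval_eq hw (show a.Fits _ s from h.1),
        Expr.eval_eq hw (show v.Fits _ s from h.2)]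
  | rand i e => simp [Stmt.IsSimple] at hp
  | seq p q ihp ihq =>
    simp only [Stmt.IsSimple, Bool.and_eq_true] at hp
    exact (ihp hp.1 s h.1).seq (ihq hp.2 _ h.2)
  | ite e p q ihp ihq =>
    simp only [Stmt.IsSimple, Bool.and_eq_true] at hp
    intro f
    refine WP.ite ?_
    obtain ⟨h1, h2⟩ := h
    simp only [Stmt.exec, Expr.eval_eq hw h1]
    split_ifs at h2 ⊢ with h
    · exact ((ihp hp.1 s h2).mono (by omega)) f
    · exact ((ihq hp.2 s h2).mono (by omega)) f
  | loop e p => simp [Stmt.IsSimple] at hp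

/-- A loop whose body strictly decreases the measure `M`. -/
theorem det_loop {e : Expr} {p : Stmt} {c : ℕ} (I : State → Prop) (M : State → ℕ)
    (h : ∀ s, I s → e.eval w s ≠ 0 → ∃ s', Det w p s c s' ∧ I s' ∧ M s' < M s)
    (s : State) (hs : I s) :
    ∃ s', Det w (.loop e p) s ((c + 1) * M s + 1) s' ∧ I s' ∧ e.eval w s' = 0 := by
  induction hM : M s using Nat.strong_induction_on generalizing s with
  | _ N ih =>
    by_cases he : e.eval w s = 0
    · exact ⟨s, (Det.loop_false he).mono (by omega), hs, he⟩
    · obtain ⟨s₁, h₁, hI, hlt⟩ := h s hs he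
      obtain ⟨s₂, h₂, hI₂, he₂⟩ := ih (M s₁) (hM ▸ hlt) s₁ hI rfl
      refine ⟨s₂, (Det.loop_true he h₁ h₂).mono ?_, hI₂, he₂⟩
      have : (c + 1) * (M s₁ + 1) ≤ (c + 1) * N := Nat.mul_le_mul_left _ (by omega)
      linarith

/-- A loop that is executed `N - j` times, with the expectations `f j, …, f N`. -/
theorem wp_loop {e : Expr} {p : Stmt} {c N : ℕ} (f : ℕ → State → ℝ≥0∞)
    (hlt : ∀ j s, j < N → f j s ≠ ∞ → e.eval w s ≠ 0)
    (hend : ∀ s, f N s ≠ ∞ → e.eval w s = 0)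
    (hp : ∀ j s, j < N → f j s ≠ ∞ → WP w p s c (f (j + 1)) (f j s))
    (j : ℕ) (hj : j ≤ N) (s : State) :
    WP w (.loop e p) s ((c + 1) * (N - j) + 1) (f N) (f j s) := by
  induction hk : N - j generalizing j s with
  | zero =>
    obtain rfl : j = N := by omega
    by_cases h : f j s = ∞
    · rw [h]; exact WP.top _ _ _ _
    · exact ((Det.loop_false (hend s h)).mono (by omega)) _
  | succ k ih =>
    by_cases h : f j s = ∞
    · rw [h]; exact WP.top _ _ _ _
    · refine (WP.loop_true (hlt j s (by omega) h) (hp j s (by omega) h)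
        fun s' _ => ih (j + 1) (by omega) s' (by omega)).mono ?_ (fun _ => le_rfl) le_rfl
      linarith [mul_add (c + 1) k 1]

/-! ### Notation for programs -/

instance : Add Expr := ⟨.op .add⟩
instance : Sub Expr := ⟨.op .sub⟩
instance : Mul Expr := ⟨.op .mul⟩
instance : Div Expr := ⟨.op .div⟩
instance : Mod Expr := ⟨.op .mod⟩
notation "reg[" i "]" => Expr.reg i
notation "num[" k "]" => Expr.const k

section exact
variable (s : State) (a b : Expr)
theorem exact_add : (a + b).exact s = a.exact s + b.exact s := rfl
theorem exact_sub : (a - b).exact s = a.exact s - b.exact s := rfl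
theorem exact_mul : (a * b).exact s = a.exact s * b.exact s := rfl
theorem exact_div : (a / b).exact s = a.exact s / b.exact s := rfl
theorem exact_mod : (a % b).exact s = a.exact s % b.exact s := rfl
theorem exact_lt : (Expr.op .lt a b).exact s = if a.exact s < b.exact s then 1 else 0 := rfl
theorem exact_eq : (Expr.op .eq a b).exact s = if a.exact s = b.exact s then 1 else 0 := rfl
theorem exact_const (k : ℕ) : (Expr.const k).exact s = k := rfl
theorem exact_reg (i : ℕ) : (Expr.reg i).exact s = s.reg i := rfl
theorem exact_load : (Expr.load a).exact s = s.mem (a.exact s) := rfl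
variable (W : ℕ)
theorem fits_add : (a + b).Fits W s ↔ a.Fits W s ∧ b.Fits W s ∧ a.exact s + b.exact s < W := Iff.rfl
theorem fits_sub : (a - b).Fits W s ↔ a.Fits W s ∧ b.Fits W s ∧ a.exact s < W := Iff.rfl
theorem fits_mul : (a * b).Fits W s ↔ a.Fits W s ∧ b.Fits W s ∧ a.exact s * b.exact s < W := Iff.rfl
theorem fits_div : (a / b).Fits W s ↔ a.Fits W s ∧ b.Fits W s ∧ a.exact s < W := Iff.rfl
theorem fits_mod : (a % b).Fits W s ↔ a.Fits W s ∧ b.Fits W s ∧ a.exact s < W := Iff.rfl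
theorem fits_lt : (Expr.op .lt a b).Fits W s ↔ a.Fits W s ∧ b.Fits W s := by
  simp [Expr.Fits, BinOp.Fits]
theorem fits_eq : (Expr.op .eq a b).Fits W s ↔ a.Fits W s ∧ b.Fits W s := by
  simp [Expr.Fits, BinOp.Fits]
theorem fits_const (k : ℕ) : (Expr.const k).Fits W s ↔ k < W := Iff.rfl
theorem fits_reg (i : ℕ) : (Expr.reg i).Fits W s ↔ True := Iff.rfl
theorem fits_load : (Expr.load a).Fits W s ↔ a.Fits W s := Iff.rfl
end exact

@[simp] theorem setReg_mem (s : State) (i x : ℕ) : (s.setReg i x).mem = s.mem := rfl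
@[simp] theorem setMem_reg (s : State) (a x : ℕ) : (s.setMem a x).reg = s.reg := rfl
theorem setReg_reg (s : State) (i x j : ℕ) :
    (s.setReg i x).reg j = if j = i then x else s.reg j := by
  simp [State.setReg, Function.update_apply]
theorem setMem_mem (s : State) (a x b : ℕ) :
    (s.setMem a x).mem b = if b = a then x else s.mem b := by
  simp [State.setMem, Function.update_apply]

/-- `forUpTo i e p` executes `p` with register `i` running through `0, …, e - 1`. -/
def forUpTo (i : ℕ) (e : Expr) (p : Stmt) : Stmt :=
  .seq (.assign i num[0]) (.loop (.op .lt reg[i] e) (.seq p (.assign i (reg[i] + num[1]))))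

/-- The body must leave the counter unchanged, and the invariant is required after the increment.
The cost `p.cost + 3` per iteration covers the body, the increment, the sequencing of the two, and
the loop test. -/
theorem det_forUpTo (hw : 1 < 2 ^ w) {i N : ℕ} {e : Expr} {p : Stmt} (hp : p.IsSimple)
    (hN : N < 2 ^ w) (I : ℕ → State → Prop) (s : State) (h0 : I 0 (s.setReg i 0))
    (he : ∀ j s, I j s → e.Fits (2 ^ w) s ∧ e.exact s = N)
    (hI : ∀ j s, j < N → s.reg i = j → I j s → p.Fits (2 ^ w) s ∧ (p.exec s).reg i = j ∧
      I (j + 1) ((p.exec s).setReg i (j + 1))) :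
    ∃ s', Det w (forUpTo i e p) s ((p.cost + 3) * N + 3) s' ∧ s'.reg i = N ∧ I N s' := by
  have hcond : ∀ j s, I j s → (Expr.op .lt reg[i] e).eval w s = if s.reg i < N then 1 else 0 := by
    intro j s hs
    obtain ⟨h1, h2⟩ := he j s hs
    rw [Expr.eval_eq hw ((fits_lt _ _ _ _).2 ⟨(fits_reg _ _ _).2 trivial, h1⟩), exact_lt, h2,
      exact_reg]
  obtain ⟨s', hd, ⟨hle, hI'⟩, hend⟩ := det_loop (w := w) (e := .op .lt reg[i] e)
    (p := .seq p (.assign i (reg[i] + num[1]))) (c := p.cost + 2)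
    (fun s => s.reg i ≤ N ∧ I (s.reg i) s) (fun s => N - s.reg i) (by
      rintro s ⟨hle, hs⟩ hlt
      rw [hcond _ s hs] at hlt
      have hlt' : s.reg i < N := by by_contra h; simp [h] at hlt
      obtain ⟨hf, hr, hI₁⟩ := hI _ s hlt' rfl hs
      have hfits : (Stmt.assign i (reg[i] + num[1])).Fits (2 ^ w) (p.exec s) :=
        ⟨trivial, hw, by change (p.exec s).reg i + 1 < _; omega⟩
      have hex : (Stmt.assign i (reg[i] + num[1])).exec (p.exec s) =
          (p.exec s).setReg i (s.reg i + 1) := by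
        change (p.exec s).setReg i ((p.exec s).reg i + 1) = _
        rw [hr]
      refine ⟨_, ((det_exec hw (.seq p (.assign i (reg[i] + num[1])))
        (by simpa [Stmt.IsSimple] using hp) s ⟨hf, hfits⟩).mono ?_), ?_, ?_⟩
      · simp only [Stmt.cost]; omega
      · change ((Stmt.assign i _).exec (p.exec s)).reg i ≤ N ∧
          I (((Stmt.assign i _).exec (p.exec s)).reg i) ((Stmt.assign i _).exec (p.exec s))
        rw [hex]
        simp only [setReg_reg, if_true]
        exact ⟨hlt', hI₁⟩
      · change N - ((Stmt.assign i _).exec (p.exec s)).reg i < _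
        rw [hex]
        simp only [setReg_reg, if_true]
        omega) (s.setReg i 0) (by simp only [setReg_reg, if_true]; exact ⟨Nat.zero_le _, h0⟩)
  have hN' : s'.reg i = N := by
    rw [hcond _ s' hI'] at hend
    by_contra hne
    rw [if_pos (by omega)] at hend
    exact one_ne_zero hend
  refine ⟨s', ?_, hN', hN' ▸ hI'⟩
  refine (Det.seq (det_exec hw (.assign i num[0]) rfl s (by change 0 < 2 ^ w; omega)) hd).mono ?_
  change 1 + ((p.cost + 2 + 1) * (N - ((s.setReg i 0).reg i)) + 1) + 1 ≤ _
  simp only [setReg_reg, if_true]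
  rw [show p.cost + 2 + 1 = p.cost + 3 by omega]
  simp only [Nat.sub_zero]
  omega

/-! ### Frames -/

/-- The address of the field `j` of the record `i`; the records begin at the address `X`. -/
def slot (X : ℕ) (j : Fin 16) (i : ℕ) : ℕ := X + 16 * i + j

/-- The field index is below the record length 16, so distinct fields never share a cell. All frame
arguments rest on this. -/
theorem slot_inj {X i i' : ℕ} {j j' : Fin 16} :
    slot X j i = slot X j' i' ↔ j = j' ∧ i = i' := by
  constructor
  · intro h
    unfold slot at h
    have := j.2
    have := j'.2
    exact ⟨Fin.ext (by omega), by omega⟩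
  · rintro ⟨rfl, rfl⟩; rfl

/-- The address of a field, as an expression; register `6` holds the base address. -/
def addr (j : Fin 16) (e : Expr) : Expr := reg[6] + num[16] * e + num[(j : ℕ)]

theorem exact_addr (s : State) (j : Fin 16) (e : Expr) :
    (addr j e).exact s = slot (s.reg 6) j (e.exact s) := rfl

theorem fits_addr (W : ℕ) (s : State) (j : Fin 16) (e : Expr) :
    (addr j e).Fits W s ↔ e.Fits W s ∧ 16 < W ∧ slot (s.reg 6) j (e.exact s) < W := by
  have h : (addr j e).Fits W s ↔ ((True ∧ (16 < W ∧ e.Fits W s ∧ 16 * e.exact s < W) ∧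
    s.reg 6 + 16 * e.exact s < W) ∧ (j : ℕ) < W ∧ s.reg 6 + 16 * e.exact s + j < W) := Iff.rfl
  rw [h]
  unfold slot
  constructor
  · rintro ⟨⟨-, ⟨h1, h2, -⟩, -⟩, -, h3⟩
    exact ⟨h2, h1, h3⟩
  · rintro ⟨h1, h2, h3⟩
    exact ⟨⟨trivial, ⟨h2, h1, by omega⟩, by omega⟩, by omega, h3⟩

/-- The contents of the field `j` of the record given by the expression `e`. -/
def fld (j : Fin 16) (e : Expr) : Expr := .load (addr j e)

theorem exact_fld (s : State) (j : Fin 16) (e : Expr) :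
    (fld j e).exact s = s.mem (slot (s.reg 6) j (e.exact s)) := rfl

theorem fits_fld (W : ℕ) (s : State) (j : Fin 16) (e : Expr) :
    (fld j e).Fits W s ↔ e.Fits W s ∧ 16 < W ∧ slot (s.reg 6) j (e.exact s) < W :=
  fits_addr W s j e

/-- The states differ only in the fields `J` of the records and in the registers `R`. -/
def Agree (X : ℕ) (J : List (Fin 16)) (R : List ℕ) (s s' : State) : Prop :=
  (∀ a, (∀ j ∈ J, ∀ i, a ≠ slot X j i) → s'.mem a = s.mem a) ∧ ∀ r ∉ R, s'.reg r = s.reg r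

theorem Agree.refl (X : ℕ) (J : List (Fin 16)) (R : List ℕ) (s : State) : Agree X J R s s :=
  ⟨fun _ _ => rfl, fun _ _ => rfl⟩

theorem Agree.trans {X : ℕ} {J J' J'' : List (Fin 16)} {R R' R'' : List ℕ} {s s' s'' : State}
    (h : Agree X J R s s') (h' : Agree X J' R' s' s'') (hJ : J ⊆ J'') (hJ' : J' ⊆ J'')
    (hR : R ⊆ R'') (hR' : R' ⊆ R'') : Agree X J'' R'' s s'' :=
  ⟨fun a ha => (h'.1 a fun j hj => ha j (hJ' hj)).trans (h.1 a fun j hj => ha j (hJ hj)),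
    fun r hr => (h'.2 r fun hj => hr (hR' hj)).trans (h.2 r fun hj => hr (hR hj))⟩

theorem Agree.setReg {X : ℕ} {J : List (Fin 16)} {R : List ℕ} {s s' : State}
    (h : Agree X J R s s') {i : ℕ} (hi : i ∈ R) (x : ℕ) : Agree X J R s (s'.setReg i x) := by
  refine ⟨fun a ha => h.1 a ha, fun r hr => ?_⟩
  rw [setReg_reg, if_neg (by rintro rfl; exact hr hi), h.2 r hr]

theorem Agree.setMem {X : ℕ} {J : List (Fin 16)} {R : List ℕ} {s s' : State}
    (h : Agree X J R s s') {j : Fin 16} (hj : j ∈ J) (i x : ℕ) :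
    Agree X J R s (s'.setMem (slot X j i) x) := by
  refine ⟨fun a ha => ?_, fun r hr => h.2 r hr⟩
  rw [setMem_mem, if_neg (ha j hj i), h.1 a ha]

theorem Agree.slot {X : ℕ} {J : List (Fin 16)} {R : List ℕ} {s s' : State}
    (h : Agree X J R s s') {j : Fin 16} (hj : j ∉ J) (i : ℕ) :
    s'.mem (slot X j i) = s.mem (slot X j i) :=
  h.1 _ fun _ hj' _ heq => hj ((slot_inj.1 heq).1 ▸ hj')

theorem Agree.low {X : ℕ} {J : List (Fin 16)} {R : List ℕ} {s s' : State}
    (h : Agree X J R s s') {a : ℕ} (ha : a < X) : s'.mem a = s.mem a :=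
  h.1 _ fun j _ i heq => by unfold WordRAM.slot at heq; omega

end WordRAM

/-! ### Averages over independent uniform variables -/

namespace MinCut

/-- The average of `f` over the coordinate `i`, uniform below `b i`. -/
noncomputable def avg (b : ℕ → ℕ) (i : ℕ) (f : (ℕ → ℕ) → ℝ) (ω : ℕ → ℕ) : ℝ :=
  (∑ x ∈ Finset.range (b i), f (Function.update ω i x)) / b i

/-- The average of `f` over the coordinates in the list `L`. -/
noncomputable def avgs (b : ℕ → ℕ) (L : List ℕ) (f : (ℕ → ℕ) → ℝ) : (ℕ → ℕ) → ℝ :=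
  L.foldr (avg b) f

variable {b : ℕ → ℕ} {L : List ℕ} {f g : (ℕ → ℕ) → ℝ} {ω : ℕ → ℕ}

@[simp] theorem avgs_nil : avgs b [] f = f := rfl

theorem avgs_cons (i : ℕ) : avgs b (i :: L) f = avg b i (avgs b L f) := rfl

theorem avgs_append (L' : List ℕ) : avgs b (L ++ L') f = avgs b L (avgs b L' f) := by
  simp [avgs]

theorem avg_comm (i j : ℕ) (f : (ℕ → ℕ) → ℝ) : avg b i (avg b j f) = avg b j (avg b i f) := by
  rcases eq_or_ne i j with rfl | h
  · rfl
  · ext ω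
    simp only [avg, ← Finset.sum_div]
    rw [Finset.sum_comm, div_right_comm]
    simp only [Function.update_comm h]

theorem avgs_perm {L' : List ℕ} (h : L.Perm L') : avgs b L f = avgs b L' f :=
  have : LeftCommutative (avg b) := ⟨avg_comm⟩
  h.foldr_eq f

theorem avg_mono {i : ℕ} (h : ∀ x < b i, f (Function.update ω i x) ≤ g (Function.update ω i x)) :
    avg b i f ω ≤ avg b i g ω := by
  unfold avg
  gcongr with x hx
  exact h x (Finset.mem_range.1 hx)

/-- Only assignments that the averaging can reach are compared, so the bounds `ω' i < b i` on the
drawn values are available in the comparison. -/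
theorem avgs_mono (h : ∀ ω', (∀ i ∉ L, ω' i = ω i) → (∀ i ∈ L, ω' i < b i) → f ω' ≤ g ω') :
    avgs b L f ω ≤ avgs b L g ω := by
  induction L generalizing ω with
  | nil => exact h ω (fun _ _ => rfl) (by simp)
  | cons i L ih =>
    refine avg_mono fun x hx => ih fun ω' h1 h2 => h ω' ?_ ?_
    · intro j hj
      rw [List.mem_cons, not_or] at hj
      rw [h1 j hj.2, Function.update_of_ne hj.1]
    · intro j hj
      by_cases hjL : j ∈ L
      · exact h2 j hjL
      · obtain rfl : j = i := by simpa [hjL] using hj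
        rw [h1 j hjL]
        simpa using hx

theorem avgs_const (hb : ∀ i ∈ L, 0 < b i) (c : ℝ) : avgs b L (fun _ => c) ω = c := by
  induction L generalizing ω with
  | nil => rfl
  | cons i L ih =>
    have : (b i : ℝ) ≠ 0 := by exact_mod_cast (hb i (by simp)).ne'
    simp only [avgs_cons, avg, ih fun j hj => hb j (List.mem_cons_of_mem _ hj)]
    simp [mul_div_cancel_left₀ _ this]

theorem avgs_add : avgs b L (fun ω => f ω + g ω) ω = avgs b L f ω + avgs b L g ω := by
  induction L generalizing ω with
  | nil => rfl
  | cons i L ih =>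
    simp only [avgs_cons, avg, ih, Finset.sum_add_distrib, add_div]

theorem avgs_const_mul (c : ℝ) : avgs b L (fun ω => c * f ω) ω = c * avgs b L f ω := by
  induction L generalizing ω with
  | nil => rfl
  | cons i L ih =>
    simp only [avgs_cons, avg, ih, ← Finset.mul_sum, mul_div_assoc]

theorem avgs_sum {ι : Type*} (s : Finset ι) (f : ι → (ℕ → ℕ) → ℝ) :
    avgs b L (fun ω => ∑ e ∈ s, f e ω) ω = ∑ e ∈ s, avgs b L (f e) ω := by
  induction L generalizing ω with
  | nil => rfl
  | cons i L ih =>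
    simp only [avgs_cons, avg, ih]
    rw [Finset.sum_comm, Finset.sum_div]

theorem avgs_le_const (hb : ∀ i ∈ L, 0 < b i) {c : ℝ}
    (h : ∀ ω', (∀ i ∉ L, ω' i = ω i) → (∀ i ∈ L, ω' i < b i) → f ω' ≤ c) :
    avgs b L f ω ≤ c :=
  (avgs_mono h).trans (avgs_const hb c).le

theorem avgs_nonneg (h : ∀ ω, 0 ≤ f ω) : 0 ≤ avgs b L f ω := by
  induction L generalizing ω with
  | nil => exact h ω
  | cons i L ih => exact div_nonneg (Finset.sum_nonneg fun x _ => ih) (Nat.cast_nonneg _)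

/-- If `f ≥ 1` as soon as every coordinate avoids its forbidden set, then the average of `f` is
at least the probability of this event. -/
theorem prod_le_avgs (B : ℕ → Finset ℕ) (hB : ∀ i ∈ L, B i ⊆ Finset.range (b i))
    (hb : ∀ i ∈ L, 0 < b i) (hL : L.Nodup) (hf : ∀ ω, 0 ≤ f ω)
    (h : ∀ ω', (∀ i ∉ L, ω' i = ω i) → (∀ i ∈ L, ω' i < b i) → (∀ i ∈ L, ω' i ∉ B i) → 1 ≤ f ω') :
    (L.map fun i => 1 - ((B i).card : ℝ) / b i).prod ≤ avgs b L f ω := by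
  induction L generalizing ω with
  | nil => simpa using h ω
  | cons i L ih =>
    rw [List.nodup_cons] at hL
    have hbi : (0 : ℝ) < b i := by exact_mod_cast hb i (by simp)
    set P := (L.map fun i => 1 - ((B i).card : ℝ) / b i).prod with hP
    -- Only the allowed values of the coordinate `i` are kept; their share among all values is the
    -- factor `1 - (B i).card / b i` of the product.
    have key : ∀ x ∈ Finset.range (b i) \ B i, P ≤ avgs b L f (Function.update ω i x) := by
      intro x hx
      rw [Finset.mem_sdiff, Finset.mem_range] at hx
      refine ih (fun j hj => hB j (List.mem_cons_of_mem _ hj))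
        (fun j hj => hb j (List.mem_cons_of_mem _ hj)) hL.2 fun ω' h1 h2 h3 => h ω' ?_ ?_ ?_
      · intro j hj
        rw [List.mem_cons, not_or] at hj
        rw [h1 j hj.2, Function.update_of_ne hj.1]
      · intro j hj
        rcases List.mem_cons.1 hj with rfl | hj
        · rw [h1 j hL.1]; simpa using hx.1
        · exact h2 j hj
      · intro j hj
        rcases List.mem_cons.1 hj with rfl | hj
        · rw [h1 j hL.1]; simpa using hx.2
        · exact h3 j hj
    rw [List.map_cons, List.prod_cons, avgs_cons, avg, le_div_iff₀ hbi, ← hP]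
    calc (1 - ((B i).card : ℝ) / b i) * P * b i = ((b i : ℝ) - (B i).card) * P := by
          field_simp
      _ = ∑ x ∈ Finset.range (b i) \ B i, P := by
          rw [Finset.sum_const, Finset.card_sdiff_of_subset (hB i (by simp)), Finset.card_range, nsmul_eq_mul,
            Nat.cast_sub]
          simpa using Finset.card_le_card (hB i (by simp))
      _ ≤ ∑ x ∈ Finset.range (b i) \ B i, avgs b L f (Function.update ω i x) :=
          Finset.sum_le_sum key
      _ ≤ _ := Finset.sum_le_sum_of_subset_of_nonneg Finset.sdiff_subset
          fun x _ _ => avgs_nonneg hf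

end MinCut

/-! ### Components of an edge set and how many there are -/

namespace MinCut

open Classical in
/-- The component of `v` in the graph with edge set `D`. -/
noncomputable def comp {n : ℕ} (D : Set (Sym2 (Fin n))) (v : Fin n) : Finset (Fin n) :=
  {u | (SimpleGraph.fromEdgeSet D).Reachable v u}

section components

variable {n : ℕ} (D : Set (Sym2 (Fin n)))

theorem mem_comp {v u : Fin n} : u ∈ comp D v ↔ (SimpleGraph.fromEdgeSet D).Reachable v u := by
  simp [comp]

theorem node_eq_iff {u v : Fin n} :
    node D u = node D v ↔ (SimpleGraph.fromEdgeSet D).Reachable u v :=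
  SimpleGraph.ConnectedComponent.eq

theorem card_comp_pos (v : Fin n) : 0 < (comp D v).card :=
  Finset.card_pos.2 ⟨v, (mem_comp D).2 (SimpleGraph.Reachable.refl _)⟩

theorem reachable_of_mem {u v : Fin n} (h : s(u, v) ∈ D) :
    (SimpleGraph.fromEdgeSet D).Reachable u v := by
  rcases eq_or_ne u v with rfl | hne
  · exact SimpleGraph.Reachable.refl _
  · exact (show (SimpleGraph.fromEdgeSet D).Adj u v by simp [h, hne]).reachable

theorem reachable_mono {D D' : Set (Sym2 (Fin n))} (h : D ⊆ D') {u v : Fin n}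
    (huv : (SimpleGraph.fromEdgeSet D).Reachable u v) :
    (SimpleGraph.fromEdgeSet D').Reachable u v :=
  huv.mono (SimpleGraph.fromEdgeSet_mono h)

/-- The number of components is the sum of the reciprocal sizes of the components. -/
theorem card_node_eq_sum : (Nat.card (Node D) : ℝ) = ∑ v, 1 / ((comp D v).card : ℝ) := by
  classical
  have : Fintype (Node D) := Fintype.ofFinite _
  rw [← Finset.sum_fiberwise_of_maps_to (s := Finset.univ) (t := Finset.univ)
    (g := fun v => node D v) (fun _ _ => Finset.mem_univ _), Nat.card_eq_fintype_card,
    ← Finset.card_univ, Finset.cast_card]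
  refine Finset.sum_congr rfl fun c _ => ?_
  obtain ⟨v, rfl⟩ := c.exists_rep
  have h1 : (Finset.univ.filter fun u => node D u = node D v) = comp D v := by
    ext u
    simp only [Finset.mem_filter, Finset.mem_univ, true_and, mem_comp, node_eq_iff]
    exact ⟨fun h => h.symm, fun h => h.symm⟩
  have h2 : ∀ u ∈ comp D v, comp D u = comp D v := by
    intro u hu
    rw [mem_comp] at hu
    ext x
    simp only [mem_comp]
    exact ⟨fun h => hu.trans h, fun h => hu.symm.trans h⟩
  change 1 = ∑ u ∈ Finset.univ.filter (fun u => node D u = node D v), _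
  rw [h1, Finset.sum_congr rfl fun u hu => by rw [h2 u hu]]
  have := card_comp_pos D v
  simp only [Finset.sum_const, nsmul_eq_mul]
  field_simp

open Classical in
-- In the sum of reciprocal component sizes, a vertex in a component of size at least `M`
-- contributes at most `1 / M`, and any other vertex at most `1`.
theorem card_node_le {M : ℝ} (hM : 0 < M) :
    (Nat.card (Node D) : ℝ) ≤ n / M + ∑ v, if ((comp D v).card : ℝ) < M then 1 else 0 := by
  rw [card_node_eq_sum, show (n : ℝ) / M = ∑ v : Fin n, 1 / M by simp [div_eq_mul_inv],
    ← Finset.sum_add_distrib]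
  refine Finset.sum_le_sum fun v _ => ?_
  have hc : (1 : ℝ) ≤ (comp D v).card := by exact_mod_cast card_comp_pos D v
  split_ifs with h
  · have : 1 / ((comp D v).card : ℝ) ≤ 1 := by rw [div_le_one (by linarith)]; exact hc
    have : 0 < 1 / M := by positivity
    linarith
  · rw [add_zero]
    exact one_div_le_one_div_of_le hM (not_lt.1 h)

theorem card_node_insert_lt {u v : Fin n} (h : ¬ (SimpleGraph.fromEdgeSet D).Reachable u v) :
    Nat.card (Node (insert s(u, v) D)) + 1 ≤ Nat.card (Node D) := by
  classical
  have : Fintype (Node D) := Fintype.ofFinite _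
  have : Fintype (Node (insert s(u, v) D)) := Fintype.ofFinite _
  rw [Nat.card_eq_fintype_card, Nat.card_eq_fintype_card]
  have hle : SimpleGraph.fromEdgeSet D ≤ SimpleGraph.fromEdgeSet (insert s(u, v) D) :=
    SimpleGraph.fromEdgeSet_mono (Set.subset_insert _ _)
  refine Fintype.card_lt_of_surjective_not_injective
    (SimpleGraph.ConnectedComponent.map (SimpleGraph.Hom.ofLE hle)) ?_ ?_
  · intro c
    obtain ⟨x, rfl⟩ := c.exists_rep
    exact ⟨node D x, rfl⟩
  · intro hinj
    refine h ((node_eq_iff D).1 (hinj ?_))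
    exact (node_eq_iff _).2 (reachable_of_mem _ (by simp))

end components

/-! ### Random 2-out contractions have few components -/

/-- `nbr u` enumerates the neighbors of `u`. -/
structure NbrEnum {n : ℕ} (G : SimpleGraph (Fin n)) [DecidableRel G.Adj]
    (nbr : Fin n → ℕ → Fin n) : Prop where
  adj : ∀ u, ∀ x < G.degree u, G.Adj u (nbr u x)
  inj : ∀ u, ∀ x < G.degree u, ∀ y < G.degree u, nbr u x = nbr u y → x = y

/-- The edges picked by the vertices: the vertex `u` picks its neighbors with the
numbers `ω (2 * u)` and `ω (2 * u + 1)`. -/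
def pickSet {n : ℕ} (nbr : Fin n → ℕ → Fin n) (ω : ℕ → ℕ) : Set (Sym2 (Fin n)) :=
  {e | ∃ u : Fin n, ∃ i, i / 2 = (u : ℕ) ∧ e = s(u, nbr u (ω i))}

/-- The recursion of the exploration: a pick falls into the explored set of `x` vertices with
probability at most `x / d`, and otherwise adds a vertex with two new picks. It holds since `(1 +
1/x)^a ≤ e ≤ 3` and `3 * (2 * (x + 1))^2 ≤ 48 * x^2 ≤ x * d`; this is the origin of the constant 48.
-/
theorem explore_ineq {x a : ℕ} {d : ℝ} (hx : 1 ≤ x) (hd : (x : ℝ) * 48 < d) (ha : a ≤ x) :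
    (x / d) * (2 * x / d) ^ a + (2 * (x + 1) / d) ^ (a + 2) ≤ (2 * x / d) ^ (a + 1) := by
  have hx' : (1 : ℝ) ≤ x := by exact_mod_cast hx
  have hd0 : 0 < d := by linarith
  have h1 : (2 * ((x : ℝ) + 1) / d) ^ a ≤ 3 * (2 * x / d) ^ a := by
    have : 2 * ((x : ℝ) + 1) / d = (1 + 1 / x) * (2 * x / d) := by field_simp
    rw [this, mul_pow]
    gcongr
    calc (1 + 1 / (x : ℝ)) ^ a ≤ (Real.exp (1 / x)) ^ a := by
          gcongr
          rw [add_comm]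
          exact Real.add_one_le_exp _
      _ = Real.exp (a * (1 / x)) := by rw [← Real.exp_nat_mul]
      _ ≤ Real.exp 1 := by
          gcongr
          rw [mul_one_div, div_le_one (by linarith)]
          exact_mod_cast ha
      _ ≤ 3 := Real.exp_one_lt_d9.le.trans (by norm_num)
  have h2 : (2 * ((x : ℝ) + 1) / d) ^ 2 * 3 ≤ x / d := by
    rw [div_pow, div_mul_eq_mul_div, div_le_div_iff₀ (by positivity) hd0]
    have : (2 * ((x : ℝ) + 1)) ^ 2 * 3 ≤ x * (x * 48) := by nlinarith
    calc (2 * ((x : ℝ) + 1)) ^ 2 * 3 * d ≤ x * (x * 48) * d := by gcongr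
      _ ≤ x * d * d := by gcongr
      _ = x * d ^ 2 := by ring
  have h3 : 0 ≤ (2 * (x : ℝ) / d) ^ a := by positivity
  calc (x / d) * (2 * x / d) ^ a + (2 * (x + 1) / d) ^ (a + 2)
      ≤ (x / d) * (2 * x / d) ^ a + 3 * (2 * x / d) ^ a * (2 * (x + 1) / d) ^ 2 := by
        rw [pow_add (2 * ((x : ℝ) + 1) / d) a 2]; gcongr
    _ = (x / d) * (2 * x / d) ^ a + (2 * x / d) ^ a * ((2 * (x + 1) / d) ^ 2 * 3) := by ring
    _ ≤ (x / d) * (2 * x / d) ^ a + (2 * x / d) ^ a * (x / d) := by gcongr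
    _ = (2 * x / d) ^ (a + 1) := by ring

section explore

variable {n : ℕ} {G : SimpleGraph (Fin n)} [DecidableRel G.Adj] {nbr : Fin n → ℕ → Fin n}
  {b : ℕ → ℕ}

open Classical in
-- The draws are revealed one at a time. `X` is the set of vertices already reached from `v`, `S`
-- the set of draws not yet revealed, and `a` a lower bound for the number of unrevealed draws that
-- belong to `X`. The exploration can get stuck only if draws keep falling into `X`, which explains
-- the shape of the bound; the induction is on the number of unrevealed draws.
theorem explore (hG : 0 < G.minDegree) (hnbr : NbrEnum G nbr)
    (hb : ∀ u : Fin n, ∀ i, i / 2 = (u : ℕ) → b i = G.degree u) (v : Fin n)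
    (S : Finset ℕ) (hS : ∀ i ∈ S, i < 2 * n) (X : Finset (Fin n)) (ω : ℕ → ℕ) (a : ℕ)
    (hv : v ∈ X) (hXS : ∀ u ∉ X, ∀ i, i / 2 = (u : ℕ) → i ∈ S)
    (hX : ∀ ω', (∀ i ∉ S, ω' i = ω i) → X ⊆ comp (pickSet nbr ω') v)
    (ha : a ≤ (S.filter fun i => ∃ u ∈ X, i / 2 = (u : ℕ)).card) (haX : a ≤ X.card + 1) :
    avgs b S.toList (fun ω' => if ((comp (pickSet nbr ω') v).card : ℝ) < G.minDegree / 48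
      then 1 else 0) ω ≤ (2 * X.card / G.minDegree) ^ a := by
  have hd : (0 : ℝ) < G.minDegree := by exact_mod_cast hG
  have hbpos : ∀ i < 2 * n, 0 < b i := fun i hi => by
    rw [hb ⟨i / 2, by omega⟩ i rfl]
    exact hG.trans_le (G.minDegree_le_degree _)
  induction hk : S.card generalizing S X ω a with
  | zero =>
    have h0 : a = 0 := by
      rw [Finset.card_eq_zero] at hk
      subst hk
      simpa using ha
    subst h0
    rw [pow_zero]
    refine avgs_le_const (fun i hi => hbpos i (hS i (Finset.mem_toList.1 hi))) fun ω' _ _ => ?_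
    split_ifs <;> norm_num
  | succ k ih =>
    rcases a with _ | a
    · rw [pow_zero]
      refine avgs_le_const (fun i hi => hbpos i (hS i (Finset.mem_toList.1 hi))) fun ω' _ _ => ?_
      split_ifs <;> norm_num
    by_cases hM : (G.minDegree : ℝ) / 48 ≤ X.card
    · refine (avgs_le_const (c := 0) (fun i hi => hbpos i (hS i (Finset.mem_toList.1 hi)))
        fun ω' h1 _ => ?_).trans (by positivity)
      rw [if_neg]
      rw [not_lt]
      refine hM.trans ?_
      exact_mod_cast Finset.card_le_card (hX ω' fun i hi => h1 i (by simpa using hi))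
    rw [not_le] at hM
    obtain ⟨i, hi⟩ := Finset.card_pos.1 (lt_of_lt_of_le (Nat.succ_pos a) ha)
    obtain ⟨hiS, u, huX, hiu⟩ := Finset.mem_filter.1 hi
    have hperm : S.toList.Perm (i :: (S.erase i).toList) := by
      have := Finset.toList_insert (Finset.notMem_erase i S)
      rwa [Finset.insert_erase hiS] at this
    rw [avgs_perm hperm, avgs_cons, avg, hb u i hiu]
    set d := G.degree u with hd_def
    have hdu : (G.minDegree : ℝ) ≤ d := by exact_mod_cast G.minDegree_le_degree u
    have hX1 : 1 ≤ X.card := Finset.card_pos.2 ⟨v, hv⟩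
    have hcard : (S.erase i).card = k := by rw [Finset.card_erase_of_mem hiS]; omega
    have hfil : a ≤ ((S.erase i).filter fun i => ∃ u ∈ X, i / 2 = (u : ℕ)).card := by
      rw [Finset.filter_erase, Finset.card_erase_of_mem hi]; omega
    have hS' : ∀ j ∈ S.erase i, j < 2 * n := fun j hj => hS j (Finset.mem_of_mem_erase hj)
    have hXS' : ∀ w ∉ X, ∀ j, j / 2 = (w : ℕ) → j ∈ S.erase i := by
      intro w hw j hj
      refine Finset.mem_erase.2 ⟨?_, hXS w hw j hj⟩
      rintro rfl
      exact hw (by rwa [show w = u from Fin.ext (by omega)])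
    have hX' : ∀ x, ∀ ω', (∀ j ∉ S.erase i, ω' j = Function.update ω i x j) →
        X ⊆ comp (pickSet nbr ω') v ∧ nbr u x ∈ comp (pickSet nbr ω') v := by
      intro x ω' h'
      have h1 : X ⊆ comp (pickSet nbr ω') v := hX ω' fun j hj => by
        rw [h' j fun h => hj (Finset.mem_of_mem_erase h), Function.update_of_ne]
        rintro rfl
        exact hj hiS
      refine ⟨h1, (mem_comp _).2 (((mem_comp _).1 (h1 huX)).trans (reachable_of_mem _ ?_))⟩
      refine ⟨u, i, hiu, ?_⟩
      rw [h' i (Finset.notMem_erase i S), Function.update_self]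
    -- A pick inside `X` uses up a draw, so `a + 1` becomes `a`. A pick outside adds a vertex, whose
    -- two draws are still unrevealed, so `a + 1` becomes `a + 2`.
    have hval : ∀ x ∈ Finset.range d, avgs b (S.erase i).toList (fun ω' =>
        if ((comp (pickSet nbr ω') v).card : ℝ) < G.minDegree / 48 then 1 else 0)
          (Function.update ω i x) ≤
        (if nbr u x ∈ X then (2 * X.card / G.minDegree : ℝ) ^ a else 0) +
          (2 * (X.card + 1) / G.minDegree) ^ (a + 2) := by
      intro x hx
      by_cases hxX : nbr u x ∈ X
      · rw [if_pos hxX]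
        refine (ih (S.erase i) hS' X _ a hv hXS' (fun ω' h' => (hX' x ω' h').1) hfil
          (by omega) hcard).trans (le_add_of_nonneg_right (by positivity))
      · rw [if_neg hxX, zero_add]
        have hc : (insert (nbr u x) X).card = X.card + 1 := Finset.card_insert_of_notMem hxX
        have := ih (S.erase i) hS' (insert (nbr u x) X) (Function.update ω i x) (a + 2)
          (Finset.mem_insert_of_mem hv)
          (fun w hw j hj => hXS' w (fun h => hw (Finset.mem_insert_of_mem h)) j hj)
          (fun ω' h' => Finset.insert_subset (hX' x ω' h').2 (hX' x ω' h').1) ?_ ?_ hcard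
        · rw [hc] at this
          push_cast at this
          exact this
        · set y := nbr u x
          have hdisj : Disjoint ((S.erase i).filter fun i => ∃ u ∈ X, i / 2 = (u : ℕ))
              {2 * (y : ℕ), 2 * (y : ℕ) + 1} := by
            rw [Finset.disjoint_left]
            intro j hj hj'
            obtain ⟨-, w, hw, hjw⟩ := Finset.mem_filter.1 hj
            refine hxX ?_
            rw [show y = w from Fin.ext ?_]
            · exact hw
            · simp only [Finset.mem_insert, Finset.mem_singleton] at hj'
              omega
          calc a + 2 ≤ ((S.erase i).filter fun i => ∃ u ∈ X, i / 2 = (u : ℕ)).card +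
                ({2 * (y : ℕ), 2 * (y : ℕ) + 1} : Finset ℕ).card := by
                rw [Finset.card_pair (by omega)]; omega
            _ = _ := (Finset.card_union_of_disjoint hdisj).symm
            _ ≤ _ := by
                refine Finset.card_le_card fun j hj => ?_
                rcases Finset.mem_union.1 hj with hj | hj
                · obtain ⟨h1, w, hw, hjw⟩ := Finset.mem_filter.1 hj
                  exact Finset.mem_filter.2 ⟨h1, w, Finset.mem_insert_of_mem hw, hjw⟩
                · have hjy : j / 2 = (y : ℕ) := by
                    simp only [Finset.mem_insert, Finset.mem_singleton] at hj
                    omega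
                  exact Finset.mem_filter.2 ⟨hXS' y hxX j hjy, y, Finset.mem_insert_self _ _, hjy⟩
        · omega
    have hcount : ((Finset.range d).filter fun x => nbr u x ∈ X).card ≤ X.card := by
      refine Finset.card_le_card_of_injOn (nbr u) (fun x hx => (Finset.mem_filter.1 hx).2) ?_
      intro x hx y hy hxy
      simp only [Finset.coe_filter, Finset.mem_range, Set.mem_ofPred_eq] at hx hy
      exact hnbr.inj u x hx.1 y hy.1 hxy
    have hd0 : (0 : ℝ) < d := hd.trans_le hdu
    calc _ ≤ (∑ x ∈ Finset.range d, ((if nbr u x ∈ X then (2 * X.card / G.minDegree : ℝ) ^ a else 0)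
          + (2 * (X.card + 1) / G.minDegree) ^ (a + 2))) / d := by
          gcongr with x hx
          exact hval x hx
      _ = ((Finset.range d).filter fun x => nbr u x ∈ X).card / d *
            (2 * X.card / G.minDegree : ℝ) ^ a + (2 * (X.card + 1) / G.minDegree) ^ (a + 2) := by
          rw [Finset.sum_add_distrib, ← Finset.sum_filter, Finset.sum_const, Finset.sum_const,
            Finset.card_range, nsmul_eq_mul, nsmul_eq_mul]
          field_simp
      _ ≤ X.card / G.minDegree * (2 * X.card / G.minDegree : ℝ) ^ a +
            (2 * (X.card + 1) / G.minDegree) ^ (a + 2) := by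
          gcongr
      _ ≤ _ := explore_ineq hX1 (by linarith) (by omega)

open Classical in
-- There are at most `48 * n / δ` components with at least `δ / 48` vertices. A vertex lies in a
-- smaller one with probability at most `(2 / δ)^2 ≤ 4 / δ`, by exploring from this vertex with its
-- two draws. The sum of the constants is 52.
theorem avgs_card_node_pickSet_le (hG : 0 < G.minDegree) (hnbr : NbrEnum G nbr)
    (hb : ∀ u : Fin n, ∀ i, i / 2 = (u : ℕ) → b i = G.degree u) (ω : ℕ → ℕ) :
    avgs b (List.range (2 * n)) (fun ω' => (Nat.card (Node (pickSet nbr ω')) : ℝ)) ω ≤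
      52 * n / G.minDegree := by
  have hd : (1 : ℝ) ≤ G.minDegree := by exact_mod_cast hG
  have hbpos : ∀ i ∈ List.range (2 * n), 0 < b i := fun i hi => by
    rw [List.mem_range] at hi
    rw [hb ⟨i / 2, by omega⟩ i rfl]
    exact hG.trans_le (G.minDegree_le_degree _)
  have hperm : (List.range (2 * n)).Perm (Finset.range (2 * n)).toList := by
    rw [List.perm_ext_iff_of_nodup List.nodup_range (Finset.nodup_toList _)]
    simp
  refine (avgs_mono fun ω' _ _ => card_node_le (pickSet nbr ω')
    (show (0 : ℝ) < G.minDegree / 48 by positivity)).trans ?_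
  rw [avgs_add, avgs_const hbpos, avgs_sum]
  have : ∀ v, avgs b (List.range (2 * n)) (fun ω' =>
      if ((comp (pickSet nbr ω') v).card : ℝ) < G.minDegree / 48 then 1 else 0) ω ≤
        4 / G.minDegree := by
    intro v
    rw [avgs_perm hperm]
    refine (explore hG hnbr hb v (Finset.range (2 * n)) (by simp) {v} ω 2 (by simp) ?_ ?_ ?_
      (by simp)).trans ?_
    · intro u _ i hi
      rw [Finset.mem_range]
      omega
    · intro ω' _
      rw [Finset.singleton_subset_iff, mem_comp]
    · refine (Finset.card_pair (show 2 * (v : ℕ) ≠ 2 * v + 1 by omega)).ge.trans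
        (Finset.card_le_card fun i hi => ?_)
      simp only [Finset.mem_insert, Finset.mem_singleton] at hi
      simp only [Finset.mem_filter, Finset.mem_range, Finset.mem_singleton, exists_eq_left]
      omega
    · rw [Finset.card_singleton, div_pow, div_le_div_iff₀ (by positivity) (by positivity)]
      norm_num
      nlinarith
  refine (add_le_add_right (Finset.sum_le_sum fun v _ => this v) _).trans ?_
  rw [Finset.sum_const, Finset.card_univ, Fintype.card_fin, nsmul_eq_mul]
  apply le_of_eq
  field_simp
  norm_num

end explore

end MinCut

namespace MinCut

/-! ### Cuts -/

section cuts

variable {n : ℕ} (G : SimpleGraph (Fin n))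

theorem mem_of_reachable {V : Type*} {H : SimpleGraph V} {S : Set V}
    (hS : ∀ a b, H.Adj a b → a ∈ S → b ∈ S) {a b : V} (h : H.Reachable a b) (ha : a ∈ S) :
    b ∈ S := by
  rw [SimpleGraph.reachable_iff_reflTransGen] at h
  induction h with
  | refl => exact ha
  | tail _ h ih => exact hS _ _ h ih

/-- An edge of the cut `S` joins different components of every edge set that avoids the cut. -/
theorem not_reachable_of_disjoint {S : Set (Fin n)} {D : Set (Sym2 (Fin n))} (hD : D ⊆ G.edgeSet)
    (h : Disjoint (cutEdges G S) D) {a b : Fin n} (hab : s(a, b) ∈ cutEdges G S) :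
    ¬ (SimpleGraph.fromEdgeSet D).Reachable a b := by
  have hS : ∀ a b, (SimpleGraph.fromEdgeSet D).Adj a b → a ∈ S → b ∈ S := by
    intro a b hab ha
    rw [SimpleGraph.fromEdgeSet_adj] at hab
    by_contra hb
    exact Set.disjoint_left.1 h ⟨hD hab.1, a, ha, b, hb, rfl⟩ hab.1
  obtain ⟨-, u, hu, v, hv, huv⟩ := hab
  intro hr
  rcases Sym2.eq_iff.1 huv with ⟨rfl, rfl⟩ | ⟨rfl, rfl⟩
  · exact hv (mem_of_reachable hS hr hu)
  · exact hv (mem_of_reachable hS hr.symm hu)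

theorem edgeConnectivity_le {S : Set (Fin n)} (h1 : S.Nonempty) (h2 : Sᶜ.Nonempty) :
    edgeConnectivity G ≤ (cutEdges G S).ncard := by
  classical
  refine Nat.sInf_le ⟨(Set.toFinite (cutEdges G S)).toFinset, ?_, ?_, ?_⟩
  · rw [Set.Finite.coe_toFinset]
    exact fun e he => he.1
  · exact (Set.ncard_eq_toFinset_card _ _).symm
  · intro hc
    obtain ⟨a, ha⟩ := h1
    obtain ⟨b, hb⟩ := h2
    refine hb (mem_of_reachable (fun x y hxy hx => ?_) (hc.preconnected a b) ha)
    rw [SimpleGraph.deleteEdges_adj] at hxy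
    by_contra hy
    exact hxy.2 (by simpa using ⟨hxy.1, x, hx, y, hy, rfl⟩)

theorem cutEdges_compl (S : Set (Fin n)) : cutEdges G Sᶜ = cutEdges G S := by
  ext e
  constructor
  · rintro ⟨he, u, hu, v, hv, rfl⟩
    exact ⟨he, v, not_not.1 hv, u, hu, Sym2.eq_swap⟩
  · rintro ⟨he, u, hu, v, hv, rfl⟩
    exact ⟨he, v, hv, u, not_not.2 hu, Sym2.eq_swap⟩

variable [DecidableRel G.Adj]

theorem ncard_incidenceSet (u : Fin n) : (G.incidenceSet u).ncard = G.degree u := by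
  rw [← G.card_incidenceFinset_eq_degree, ← Set.ncard_coe_finset, SimpleGraph.coe_incidenceFinset]

theorem edgeConnectivity_le_degree (u : Fin n) (hu : 0 < G.degree u) :
    edgeConnectivity G ≤ G.degree u := by
  obtain ⟨v, hv⟩ := (G.degree_pos_iff_exists_adj u).1 hu
  refine (edgeConnectivity_le G (S := {u}) ⟨u, rfl⟩ ⟨v, hv.ne'⟩).trans ?_
  rw [← ncard_incidenceSet]
  refine Set.ncard_le_ncard ?_ (Set.toFinite _)
  rintro e ⟨he, a, rfl, b, -, rfl⟩
  exact ⟨he, Sym2.mem_mk_left _ _⟩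

theorem edgeConnectivity_le_minDegree (h : 0 < G.minDegree) :
    edgeConnectivity G ≤ G.minDegree := by
  rcases isEmpty_or_nonempty (Fin n) with hn | hn
  · simp [SimpleGraph.minDegree] at h
  · obtain ⟨u, hu⟩ := G.exists_minimal_degree_vertex
    rw [hu]
    exact edgeConnectivity_le_degree G u (hu ▸ h)

/-- Moving the vertex `u` to the other side of the cut. -/
theorem two_mul_ncard_inter_le {S : Set (Fin n)} (hS : S.Nontrivial) {u : Fin n} (hu : u ∈ S) :
    edgeConnectivity G + 2 * (cutEdges G S ∩ G.incidenceSet u).ncard ≤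
      (cutEdges G S).ncard + G.degree u := by
  obtain ⟨v, hv, hvu⟩ := hS.exists_ne u
  -- Non-triviality of the cut enters here: `S` without `u` is still nonempty. The new cut loses the
  -- cut edges at `u` and gains at most the other edges at `u`.
  have h1 := edgeConnectivity_le G (S := S \ {u}) ⟨v, hv, hvu⟩ ⟨u, fun h => h.2 rfl⟩
  set I := cutEdges G S ∩ G.incidenceSet u
  have hsub : cutEdges G (S \ {u}) ⊆ (cutEdges G S \ I) ∪ (G.incidenceSet u \ I) := by
    rintro e ⟨he, a, ⟨haS, hau⟩, b, hb, rfl⟩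
    by_cases hbu : b = u
    · subst hbu
      refine Or.inr ⟨⟨he, Sym2.mem_mk_right _ _⟩, ?_⟩
      rintro ⟨⟨-, x, hx, y, hy, hxy⟩, -⟩
      rcases Sym2.eq_iff.1 hxy with ⟨rfl, rfl⟩ | ⟨rfl, rfl⟩
      · exact hy hu
      · exact hy haS
    · refine Or.inl ⟨⟨he, a, haS, b, fun h => hb ⟨h, hbu⟩, rfl⟩, ?_⟩
      rintro ⟨-, -, h⟩
      rcases Sym2.mem_iff.1 h with h | h
      · exact hau h.symm
      · exact hbu h.symm
  have h2 := (Set.ncard_le_ncard hsub (Set.toFinite _)).trans (Set.ncard_union_le _ _)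
  have h3 := Set.ncard_sdiff_add_ncard_of_subset (show I ⊆ cutEdges G S from Set.inter_subset_left)
  have h4 := Set.ncard_sdiff_add_ncard_of_subset
    (show I ⊆ G.incidenceSet u from Set.inter_subset_right)
  rw [ncard_incidenceSet] at h4
  omega

omit [DecidableRel G.Adj] in
theorem sum_ncard_inter_le (C : Set (Sym2 (Fin n))) :
    ∑ u, (C ∩ G.incidenceSet u).ncard ≤ 2 * C.ncard := by
  classical
  have hC : ∀ u, (C ∩ G.incidenceSet u).ncard ≤
      (C.toFinite.toFinset.filter fun e => u ∈ e).card := by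
    intro u
    rw [← Set.ncard_coe_finset]
    refine Set.ncard_le_ncard ?_ (Set.toFinite _)
    rintro e ⟨h1, -, h2⟩
    simpa using ⟨h1, h2⟩
  refine (Finset.sum_le_sum fun u _ => hC u).trans ?_
  have := Finset.sum_card_bipartiteAbove_eq_sum_card_bipartiteBelow
    (s := (Finset.univ : Finset (Fin n))) (t := C.toFinite.toFinset) (fun u e => u ∈ e)
  simp only [Finset.bipartiteAbove, Finset.bipartiteBelow] at this
  rw [this, Set.ncard_eq_toFinset_card C]
  rw [mul_comm, ← smul_eq_mul]
  refine Finset.sum_le_card_nsmul _ _ _ fun e _ => ?_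
  induction e with | _ a b => ?_
  refine (Finset.card_le_card (t := {a, b}) fun u hu => ?_).trans Finset.card_le_two
  simpa using hu

end cuts

/-! ### One random contraction -/

section sample

variable {n m : ℕ} {G : SimpleGraph (Fin n)} [DecidableRel G.Adj]
  {ends : Fin m → Fin n × Fin n} {nbr : Fin n → ℕ → Fin n}

/-- The edge with identifier `e`. -/
def edge (ends : Fin m → Fin n × Fin n) (e : Fin m) : Sym2 (Fin n) := s((ends e).1, (ends e).2)

/-- The edges whose coin shows `0`. -/
def coinSet (ends : Fin m → Fin n × Fin n) (ω : ℕ → ℕ) : Set (Sym2 (Fin n)) :=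
  {x | ∃ e : Fin m, ω (2 * n + e) = 0 ∧ x = edge ends e}

/-- The edges contracted in one round: the picks of the vertices, and independent samples. -/
def sampleSet (ends : Fin m → Fin n × Fin n) (nbr : Fin n → ℕ → Fin n) (ω : ℕ → ℕ) :
    Set (Sym2 (Fin n)) :=
  pickSet nbr ω ∪ coinSet ends ω

open Classical in
/-- The edges that join different components of `D`. -/
noncomputable def crossing (ends : Fin m → Fin n × Fin n) (D : Set (Sym2 (Fin n))) :
    Finset (Fin m) :=
  {e | ¬ (SimpleGraph.fromEdgeSet D).Reachable (ends e).1 (ends e).2}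

theorem mem_crossing {D : Set (Sym2 (Fin n))} {e : Fin m} :
    e ∈ crossing ends D ↔ ¬ (SimpleGraph.fromEdgeSet D).Reachable (ends e).1 (ends e).2 := by
  simp [crossing]

theorem crossing_anti {D D' : Set (Sym2 (Fin n))} (h : D ⊆ D') :
    crossing ends D' ⊆ crossing ends D := fun e he => by
  rw [mem_crossing] at he ⊢
  exact fun h' => he (reachable_mono h h')

open Classical in
/-- If every edge is sampled with probability `1 / c`, the expected number of edges that join
different components in the end is at most `c` times the initial number of components. -/
theorem avgs_crossing_coins_le {b : ℕ → ℕ} {c : ℕ} (hc : 0 < c)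
    (hb : ∀ e : Fin m, b (2 * n + e) = c) (L : List (Fin m)) (hL : L.Nodup)
    (D : Set (Sym2 (Fin n))) (ω : ℕ → ℕ) :
    avgs b (L.map fun e : Fin m => 2 * n + (e : ℕ)) (fun ω' =>
      (((crossing ends (D ∪ {x | ∃ e ∈ L, ω' (2 * n + e) = 0 ∧ x = edge ends e})).filter
        (· ∈ L)).card : ℝ)) ω ≤ c * Nat.card (Node D) := by
  have hc0 : (0 : ℝ) < c := by exact_mod_cast hc
  induction L generalizing D ω with
  | nil => simpa using by positivity
  | cons e L ih =>
    rw [List.nodup_cons] at hL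
    have hbpos : ∀ i ∈ L.map (fun e : Fin m => 2 * n + (e : ℕ)), 0 < b i := by
      intro i hi
      obtain ⟨e, -, rfl⟩ := List.mem_map.1 hi
      rw [hb]; exact hc
    rw [List.map_cons, avgs_cons, avg, hb, div_le_iff₀ hc0]
    have hsub : ∀ ω' : ℕ → ℕ, D ∪ {x | ∃ e ∈ L, ω' (2 * n + e) = 0 ∧ x = edge ends e} ⊆
        D ∪ {x | ∃ e' ∈ e :: L, ω' (2 * n + e') = 0 ∧ x = edge ends e'} := fun ω' =>
      Set.union_subset_union_right _ fun x ⟨e', h1, h2⟩ => ⟨e', List.mem_cons_of_mem _ h1, h2⟩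
    -- An edge inside a component of `D` never crosses later, so its coin may be ignored.
    by_cases he : (SimpleGraph.fromEdgeSet D).Reachable (ends e).1 (ends e).2
    · have : ∀ x ∈ Finset.range c, avgs b (L.map fun e : Fin m => 2 * n + (e : ℕ)) (fun ω' =>
          (((crossing ends (D ∪ {x | ∃ e' ∈ e :: L, ω' (2 * n + e') = 0 ∧ x = edge ends e'})).filter
          (· ∈ e :: L)).card : ℝ)) (Function.update ω (2 * n + e) x) ≤ c * Nat.card (Node D) := by
        intro x _
        refine (avgs_mono fun ω' _ _ => ?_).trans (ih hL.2 D _)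
        norm_cast
        refine Finset.card_le_card fun e' he' => ?_
        rw [Finset.mem_filter] at he' ⊢
        refine ⟨crossing_anti (hsub ω') he'.1, ?_⟩
        rcases List.mem_cons.1 he'.2 with rfl | h
        · exact absurd (reachable_mono Set.subset_union_left he) (mem_crossing.1 he'.1)
        · exact h
      refine (Finset.sum_le_card_nsmul _ _ _ this).trans ?_
      rw [Finset.card_range, nsmul_eq_mul, mul_comm]
    · have hk : (Nat.card (Node (insert (edge ends e) D)) : ℝ) + 1 ≤ Nat.card (Node D) := by
        exact_mod_cast card_node_insert_lt D he
      -- The potential is `c` times the number of components. One of the `c` outcomes merges two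
      -- components and saves `c`, with `e` no longer crossing; each of the others lets `e` count
      -- for at most `1`. Summed over the outcomes, the saving outweighs the cost.
      have hval : ∀ x ∈ Finset.range c, avgs b (L.map fun e : Fin m => 2 * n + (e : ℕ)) (fun ω' =>
          (((crossing ends (D ∪ {x | ∃ e' ∈ e :: L, ω' (2 * n + e') = 0 ∧ x = edge ends e'})).filter
          (· ∈ e :: L)).card : ℝ)) (Function.update ω (2 * n + e) x) ≤
          (1 + c * Nat.card (Node D)) + if x = 0 then (-1 - c : ℝ) else 0 := by
        intro x _
        by_cases hx : x = 0
        · rw [if_pos hx]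
          have hle : (c * Nat.card (Node (insert (edge ends e) D)) : ℝ) ≤
              (1 + c * Nat.card (Node D)) + (-1 - c : ℝ) := by nlinarith
          refine (avgs_mono fun ω' h1 _ => ?_).trans ((ih hL.2 (insert (edge ends e) D) _).trans hle)
          norm_cast
          have hω : ω' (2 * n + e) = 0 := by
            rw [h1, Function.update_self, hx]
            rintro h
            obtain ⟨e', he', h⟩ := List.mem_map.1 h
            exact hL.1 (by rwa [show e = e' from Fin.ext (by omega)])
          have hsub' : insert (edge ends e) D ∪ {x | ∃ e ∈ L, ω' (2 * n + e) = 0 ∧ x = edge ends e} ⊆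
              D ∪ {x | ∃ e' ∈ e :: L, ω' (2 * n + e') = 0 ∧ x = edge ends e'} := by
            rw [Set.insert_union]
            exact Set.insert_subset (Or.inr ⟨e, by simp, hω, rfl⟩) (hsub ω')
          refine Finset.card_le_card fun e' he' => ?_
          rw [Finset.mem_filter] at he' ⊢
          refine ⟨crossing_anti hsub' he'.1, ?_⟩
          rcases List.mem_cons.1 he'.2 with rfl | h
          · refine absurd (reachable_of_mem _ ?_) (mem_crossing.1 he'.1)
            exact Or.inr ⟨e', by simp, hω, rfl⟩
          · exact h
        · rw [if_neg hx, add_zero]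
          have : ∀ ω' : ℕ → ℕ, (((crossing ends (D ∪ {x | ∃ e' ∈ e :: L, ω' (2 * n + e') = 0 ∧
              x = edge ends e'})).filter (· ∈ e :: L)).card : ℝ) ≤
              1 + (((crossing ends (D ∪ {x | ∃ e ∈ L, ω' (2 * n + e) = 0 ∧
              x = edge ends e})).filter (· ∈ L)).card : ℝ) := by
            intro ω'
            norm_cast
            rw [add_comm]
            refine (Finset.card_le_card fun e' he' => ?_).trans (Finset.card_insert_le e _)
            rw [Finset.mem_filter] at he'
            rw [Finset.mem_insert, Finset.mem_filter]
            rcases List.mem_cons.1 he'.2 with rfl | h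
            · exact Or.inl rfl
            · exact Or.inr ⟨crossing_anti (hsub ω') he'.1, h⟩
          refine (avgs_mono fun ω' _ _ => this ω').trans ?_
          rw [avgs_add, avgs_const hbpos]
          gcongr
          exact ih hL.2 D _
      refine (Finset.sum_le_sum hval).trans ?_
      rw [Finset.sum_add_distrib, Finset.sum_const, Finset.card_range, nsmul_eq_mul,
        Finset.sum_ite_eq' (Finset.range c) 0 fun _ => (-1 - c : ℝ),
        if_pos (Finset.mem_range.2 hc)]
      nlinarith

/-- The bounds for the random numbers drawn in a round. -/
def drawBound (G : SimpleGraph (Fin n)) [DecidableRel G.Adj] (i : ℕ) : ℕ :=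
  if h : i / 2 < n then G.degree ⟨i / 2, h⟩ else 2 * G.minDegree

theorem drawBound_pick (u : Fin n) (i : ℕ) (hi : i / 2 = (u : ℕ)) :
    drawBound G i = G.degree u := by
  have h : i / 2 < n := hi ▸ u.2
  obtain rfl : u = ⟨i / 2, h⟩ := Fin.ext hi.symm
  rw [drawBound, dif_pos h]

theorem drawBound_coin (e : ℕ) : drawBound G (2 * n + e) = 2 * G.minDegree := by
  rw [drawBound, dif_neg (by omega)]

theorem drawBound_pos (h : 0 < G.minDegree) (i : ℕ) : 0 < drawBound G i := by
  rw [drawBound]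
  split_ifs
  · exact h.trans_le (G.minDegree_le_degree _)
  · omega

theorem range_eq_append : List.range (2 * n + m) =
    List.range (2 * n) ++ (List.finRange m).map fun e : Fin m => 2 * n + (e : ℕ) := by
  rw [List.range_add]
  congr 1
  rw [← List.map_coe_finRange_eq_range, List.map_map]
  rfl

/-- For fixed picks, the coins with probability `1 / (2 * δ)` leave on average at most `2 * δ`
crossing edges per component of the picks. Averaging over the picks gives `2 * δ * (52 * n / δ)`. -/
theorem avgs_crossing_sampleSet_le (hG : 0 < G.minDegree) (hnbr : NbrEnum G nbr) (ω : ℕ → ℕ) :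
    avgs (drawBound G) (List.range (2 * n + m))
      (fun ω' => ((crossing ends (sampleSet ends nbr ω')).card : ℝ)) ω ≤ 104 * n := by
  classical
  have hd : (0 : ℝ) < G.minDegree := by exact_mod_cast hG
  rw [range_eq_append, avgs_append]
  have h1 : ∀ ω, avgs (drawBound G) ((List.finRange m).map fun e : Fin m => 2 * n + (e : ℕ))
      (fun ω' => ((crossing ends (sampleSet ends nbr ω')).card : ℝ)) ω ≤
      (2 * G.minDegree : ℕ) * (Nat.card (Node (pickSet nbr ω)) : ℝ) := by
    intro ω
    refine (avgs_mono fun ω' h _ => ?_).trans (avgs_crossing_coins_le (ends := ends) (by omega)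
      (fun e => drawBound_coin e) (List.finRange m) (List.nodup_finRange m) (pickSet nbr ω) ω)
    norm_cast
    refine Finset.card_le_card fun e he => ?_
    rw [Finset.mem_filter]
    refine ⟨crossing_anti ?_ he, List.mem_finRange e⟩
    refine Set.union_subset_union ?_ ?_
    · rintro x ⟨u, i, hi, rfl⟩
      refine ⟨u, i, hi, ?_⟩
      rw [h]
      intro hmem
      obtain ⟨e, -, he⟩ := List.mem_map.1 hmem
      omega
    · rintro x ⟨e, -, h⟩
      exact ⟨e, h⟩
  refine (avgs_mono fun ω' _ _ => h1 ω').trans ?_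
  rw [avgs_const_mul]
  have h2 := avgs_card_node_pickSet_le hG hnbr (fun u i hi => drawBound_pick u i hi) ω
  calc _ ≤ ((2 * G.minDegree : ℕ) : ℝ) * (52 * n / G.minDegree) := by gcongr
    _ = 104 * n := by push_cast; field_simp; ring

/-- Factor by factor: `x ≤ 1 - η` gives `1 / (1 - x) = 1 + x / (1 - x) ≤ 1 + x / η ≤ exp (x / η)`.
-/
theorem exp_le_prod {η : ℝ} (hη : 0 < η) (x : ℕ → ℝ) (L : List ℕ)
    (h0 : ∀ i ∈ L, 0 ≤ x i) (h1 : ∀ i ∈ L, x i ≤ 1 - η) :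
    Real.exp (-(L.map x).sum / η) ≤ (L.map fun i => 1 - x i).prod := by
  induction L with
  | nil => simp
  | cons i L ih =>
    rw [List.map_cons, List.sum_cons, List.map_cons, List.prod_cons,
      show -(x i + (L.map x).sum) / η = -(x i) / η + -(L.map x).sum / η by ring, Real.exp_add]
    have hi0 := h0 i (by simp)
    have hi1 := h1 i (by simp)
    have hpos : 0 < 1 - x i := by linarith
    refine mul_le_mul ?_ (ih (fun j hj => h0 j (List.mem_cons_of_mem _ hj))
      fun j hj => h1 j (List.mem_cons_of_mem _ hj)) (Real.exp_pos _).le hpos.le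
    rw [neg_div, Real.exp_neg]
    refine inv_le_of_inv_le₀ hpos ?_
    calc (1 - x i)⁻¹ = x i / (1 - x i) + 1 := by field_simp; ring
      _ ≤ x i / η + 1 := by gcongr; linarith
      _ ≤ _ := Real.add_one_le_exp _

theorem sum_range_two_mul (g : ℕ → ℝ) (n : ℕ) :
    ∑ i ∈ Finset.range (2 * n), g (i / 2) = 2 * ∑ u ∈ Finset.range n, g u := by
  induction n with
  | zero => simp
  | succ n ih =>
    rw [show 2 * (n + 1) = 2 * n + 1 + 1 by ring, Finset.sum_range_succ, Finset.sum_range_succ,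
      Finset.sum_range_succ, ih, show (2 * n + 1) / 2 = n by omega, show 2 * n / 2 = n by omega]
    ring

theorem list_sum_range (f : ℕ → ℝ) (n : ℕ) :
    ((List.range n).map f).sum = ∑ i ∈ Finset.range n, f i := by
  rw [← List.sum_toFinset _ List.nodup_range, List.toFinset_range]

theorem pickSet_subset (hnbr : NbrEnum G nbr) {ω : ℕ → ℕ}
    (hω : ∀ i < 2 * n, ω i < drawBound G i) : pickSet nbr ω ⊆ G.edgeSet := by
  rintro x ⟨u, i, hi, rfl⟩
  refine hnbr.adj u _ ?_
  rw [← drawBound_pick u i hi]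
  exact hω i (by omega)

omit [DecidableRel G.Adj] in
theorem coinSet_subset (hends : IsEdgeList G ends) (ω : ℕ → ℕ) : coinSet ends ω ⊆ G.edgeSet := by
  rintro x ⟨e, -, rfl⟩
  rw [← hends.2]
  exact ⟨e, rfl⟩

open Classical in
/-- A round avoids a fixed non-trivial small cut with constant probability. -/
theorem exp_le_avgs_avoid (hG : 0 < G.minDegree) (hnbr : NbrEnum G nbr) (hends : IsEdgeList G ends)
    {ε : ℝ} (hε0 : 0 < ε) (hε1 : ε ≤ 1) {S : Set (Fin n)} (hS : IsNontrivialSmallCut G (2 - ε) S)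
    (ω : ℕ → ℕ) :
    Real.exp (-(18 / ε)) ≤ avgs (drawBound G) (List.range (2 * n + m))
      (fun ω' => if Disjoint (cutEdges G S) (sampleSet ends nbr ω') then 1 else 0) ω := by
  have hd : (0 : ℝ) < G.minDegree := by exact_mod_cast hG
  have hd1 : (1 : ℝ) ≤ G.minDegree := by exact_mod_cast hG
  set C := cutEdges G S with hC
  have hlam : (edgeConnectivity G : ℝ) ≤ G.minDegree := by
    exact_mod_cast edgeConnectivity_le_minDegree G hG
  have hlam0 : (0 : ℝ) ≤ edgeConnectivity G := Nat.cast_nonneg _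
  have hCle : (C.ncard : ℝ) ≤ 2 * G.minDegree := by
    have := hS.2.2
    nlinarith
  -- the number of cut edges at a vertex
  have hcu : ∀ u, (((C ∩ G.incidenceSet u).ncard : ℕ) : ℝ) ≤ (1 - ε / 2) * G.degree u := by
    intro u
    have hl : (edgeConnectivity G : ℝ) ≤ G.degree u := by
      exact_mod_cast edgeConnectivity_le_degree G u (hG.trans_le (G.minDegree_le_degree u))
    have h2 : (edgeConnectivity G + 2 * (C ∩ G.incidenceSet u).ncard : ℝ) ≤
        C.ncard + G.degree u := by
      by_cases hu : u ∈ S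
      · exact_mod_cast two_mul_ncard_inter_le G hS.1 hu
      · have := two_mul_ncard_inter_le G hS.2.1 (u := u) hu
        rw [cutEdges_compl] at this
        exact_mod_cast this
    -- With c(u) cut edges at u, 2c(u) ≤ |C| - λ + deg(u) ≤ (1-ε)λ + deg(u) ≤ (2-ε)deg(u).
    have := hS.2.2
    nlinarith
  -- The harmful values of a draw: a pick must not lead along a cut edge, and the coin of a cut edge
  -- must not show `0`.
  set B : ℕ → Finset ℕ := fun i =>
    if h : i / 2 < n then
      (Finset.range (G.degree ⟨i / 2, h⟩)).filter fun x => s(⟨i / 2, h⟩, nbr ⟨i / 2, h⟩ x) ∈ C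
    else if h : i - 2 * n < m then (if edge ends ⟨i - 2 * n, h⟩ ∈ C then {0} else ∅) else ∅ with hB
  have hBu : ∀ u : Fin n, ∀ i, i / 2 = (u : ℕ) →
      B i = (Finset.range (G.degree u)).filter fun x => s(u, nbr u x) ∈ C := by
    intro u i hi
    have h : i / 2 < n := hi ▸ u.2
    obtain rfl : u = ⟨i / 2, h⟩ := Fin.ext hi.symm
    simp only [hB, dif_pos h]
  have hBe : ∀ e : Fin m, B (2 * n + e) = if edge ends e ∈ C then {0} else ∅ := by
    intro e
    simp only [hB]
    rw [dif_neg (by omega), dif_pos (by have := e.2; omega)]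
    simp
  have hBcard : ∀ u : Fin n, ∀ i, i / 2 = (u : ℕ) → (B i).card ≤ (C ∩ G.incidenceSet u).ncard := by
    intro u i hi
    rw [hBu u i hi, ← Set.ncard_coe_finset]
    refine Set.ncard_le_ncard_of_injOn (fun x => s(u, nbr u x)) ?_ ?_ (Set.toFinite _)
    · intro x hx
      simp only [Finset.coe_filter, Finset.mem_range, Set.mem_ofPred_eq] at hx
      exact ⟨hx.2, hx.2.1, Sym2.mem_mk_left _ _⟩
    · intro x hx y hy hxy
      simp only [Finset.coe_filter, Finset.mem_range, Set.mem_ofPred_eq] at hx hy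
      exact hnbr.inj u x hx.1 y hy.1 (Sym2.congr_right.1 hxy)
  have key := prod_le_avgs (b := drawBound G) (L := List.range (2 * n + m)) (ω := ω)
    (f := fun ω' => if Disjoint C (sampleSet ends nbr ω') then 1 else 0) B ?_
    (fun i _ => drawBound_pos hG i) List.nodup_range (fun ω' => by split_ifs <;> norm_num) ?_
  · refine le_trans ?_ key
    refine le_trans ?_ (exp_le_prod (show 0 < ε / 2 by positivity)
      (fun i => ((B i).card : ℝ) / drawBound G i) _ (fun i _ => by positivity) ?_)
    · rw [Real.exp_le_exp, neg_div, neg_le_neg_iff]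
      -- The expected number of harmful draws. The two picks per vertex contribute at most 2 ·
      -- 2|C|/δ ≤ 8, since every cut edge has two ends and |C| ≤ 2δ; the coins contribute |C|/(2δ) ≤
      -- 1. Division by the least avoidance probability `ε / 2` then turns 9 into `18 / ε`.
      have hsum : ((List.range (2 * n + m)).map
          fun i => ((B i).card : ℝ) / drawBound G i).sum ≤ 9 := by
        rw [list_sum_range, Finset.sum_range_add]
        have h1 : ∑ i ∈ Finset.range (2 * n), ((B i).card : ℝ) / drawBound G i ≤ 8 := by
          set g : ℕ → ℝ := fun j => if h : j < n then
            ((C ∩ G.incidenceSet ⟨j, h⟩).ncard : ℝ) / G.minDegree else 0 with hg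
          have : ∀ i ∈ Finset.range (2 * n), ((B i).card : ℝ) / drawBound G i ≤ g (i / 2) := by
            intro i hi
            rw [Finset.mem_range] at hi
            have hi' : i / 2 < n := by omega
            simp only [hg, dif_pos hi']
            rw [drawBound_pick ⟨i / 2, hi'⟩ i rfl]
            have h1 : ((B i).card : ℝ) ≤ (C ∩ G.incidenceSet ⟨i / 2, hi'⟩).ncard := by
              exact_mod_cast hBcard ⟨i / 2, hi'⟩ i rfl
            have h2 : (G.minDegree : ℝ) ≤ G.degree ⟨i / 2, hi'⟩ := by
              exact_mod_cast G.minDegree_le_degree _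
            gcongr
          refine (Finset.sum_le_sum this).trans ?_
          rw [sum_range_two_mul, Finset.sum_range]
          simp only [hg, Fin.is_lt, dif_pos, Fin.eta]
          rw [← Finset.sum_div, ← mul_div_assoc, div_le_iff₀ hd]
          have : (∑ u, ((C ∩ G.incidenceSet u).ncard : ℝ)) ≤ 2 * C.ncard := by
            exact_mod_cast sum_ncard_inter_le G C
          linarith
        have h2 : ∑ e ∈ Finset.range m, ((B (2 * n + e)).card : ℝ) / drawBound G (2 * n + e) ≤ 1 := by
          simp only [drawBound_coin]
          rw [Finset.sum_range, ← Finset.sum_div, div_le_one (by push_cast; positivity)]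
          push_cast
          refine le_trans ?_ hCle
          norm_cast
          simp only [hBe, apply_ite Finset.card, Finset.card_singleton, Finset.card_empty]
          rw [← Finset.card_filter, ← Set.ncard_coe_finset]
          refine Set.ncard_le_ncard_of_injOn (edge ends) ?_ ?_ (Set.toFinite _)
          · intro e he
            simpa using he
          · intro e _ e' _ h
            exact hends.1 h
        linarith
      calc _ ≤ 9 / (ε / 2) := by gcongr
        _ = 18 / ε := by field_simp; norm_num
    · intro i hi
      rw [List.mem_range] at hi
      rw [div_le_iff₀ (by exact_mod_cast drawBound_pos hG i)]
      by_cases hi' : i / 2 < n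
      · rw [drawBound_pick ⟨i / 2, hi'⟩ i rfl]
        refine le_trans ?_ (hcu ⟨i / 2, hi'⟩)
        exact_mod_cast hBcard ⟨i / 2, hi'⟩ i rfl
      · obtain ⟨e, rfl⟩ : ∃ e : Fin m, i = 2 * n + e := ⟨⟨i - 2 * n, by omega⟩, by simp; omega⟩
        rw [hBe, drawBound_coin]
        have : (((if edge ends e ∈ C then {0} else ∅ : Finset ℕ)).card : ℝ) ≤ 1 := by
          split_ifs <;> simp
        push_cast
        nlinarith
  · intro i hi x hx
    rw [List.mem_range] at hi
    rw [Finset.mem_range]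
    by_cases hi' : i / 2 < n
    · rw [drawBound_pick ⟨i / 2, hi'⟩ i rfl]
      rw [hBu ⟨i / 2, hi'⟩ i rfl] at hx
      exact Finset.mem_range.1 (Finset.mem_filter.1 hx).1
    · obtain ⟨e, rfl⟩ : ∃ e : Fin m, i = 2 * n + e := ⟨⟨i - 2 * n, by omega⟩, by simp; omega⟩
      rw [hBe] at hx
      rw [drawBound_coin]
      split_ifs at hx
      · rw [Finset.mem_singleton] at hx; omega
      · simp at hx
  · intro ω' _ hb hB'
    have : Disjoint C (sampleSet ends nbr ω') := by
      rw [Set.disjoint_left]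
      rintro x hxC (⟨u, i, hi, rfl⟩ | ⟨e, he, rfl⟩)
      · have hi2 : i ∈ List.range (2 * n + m) := List.mem_range.2 (by omega)
        have h := hB' i hi2
        have hlt := hb i hi2
        rw [drawBound_pick u i hi] at hlt
        rw [hBu u i hi] at h
        exact h (Finset.mem_filter.2 ⟨Finset.mem_range.2 hlt, hxC⟩)
      · have h := hB' (2 * n + e) (List.mem_range.2 (by have := e.2; omega))
        rw [hBe, if_pos hxC, he] at h
        simp at h
    rw [if_pos this]

open Classical in
/-- An edge of a non-trivial small cut is counted in a round with constant probability. -/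
theorem avgs_half_pow_le (hG : 0 < G.minDegree) (hnbr : NbrEnum G nbr) (hends : IsEdgeList G ends)
    {ε : ℝ} (hε0 : 0 < ε) (hε1 : ε ≤ 1) {S : Set (Fin n)} (hS : IsNontrivialSmallCut G (2 - ε) S)
    {e : Fin m} (he : edge ends e ∈ cutEdges G S) {K : ℕ}
    (hK : 208 ≤ Real.exp (-(18 / ε)) * K) (ω : ℕ → ℕ) :
    avgs (drawBound G) (List.range (2 * n + m)) (fun ω' =>
      if (crossing ends (sampleSet ends nbr ω')).card ≤ K * n ∧
        e ∈ crossing ends (sampleSet ends nbr ω') then 1 / 2 else 1) ω ≤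
      1 - Real.exp (-(18 / ε)) / 4 := by
  have hn : (0 : ℝ) < n := by
    have : 0 < n := (Nat.zero_le _).trans_lt (ends e).1.2
    exact_mod_cast this
  have hK0 : (0 : ℝ) < K := by
    by_contra h
    have : (K : ℝ) = 0 := le_antisymm (not_lt.1 h) (Nat.cast_nonneg _)
    rw [this] at hK
    norm_num at hK
  have h1 := exp_le_avgs_avoid hG hnbr hends hε0 hε1 hS ω
  have h2 := avgs_crossing_sampleSet_le (ends := ends) hG hnbr ω
  set r := Real.exp (-(18 / ε))
  -- A linear majorant that combines the avoidance of the cut with Markov's inequality: avoiding the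
  -- cut gains `1 / 2`, and if there are more than `K * n` crossing edges, the last term pays this
  -- back.
  refine (avgs_mono (g := fun ω' => 1 + ((-1 / 2) *
    (if Disjoint (cutEdges G S) (sampleSet ends nbr ω') then 1 else 0) +
    (1 / (2 * K * n)) * ((crossing ends (sampleSet ends nbr ω')).card : ℝ))) ?_).trans ?_
  · intro ω' _ hb
    set x : ℝ := ((crossing ends (sampleSet ends nbr ω')).card : ℝ) with hx
    have hx0 : 0 ≤ 1 / (2 * K * n) * x := by positivity
    by_cases hdis : Disjoint (cutEdges G S) (sampleSet ends nbr ω')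
    · have hcr : e ∈ crossing ends (sampleSet ends nbr ω') := by
        rw [mem_crossing]
        refine not_reachable_of_disjoint G (Set.union_subset (pickSet_subset hnbr fun i hi => ?_)
          (coinSet_subset hends ω')) hdis he
        exact hb i (List.mem_range.2 (by omega))
      rw [if_pos hdis]
      by_cases hle : (crossing ends (sampleSet ends nbr ω')).card ≤ K * n
      · rw [if_pos ⟨hle, hcr⟩]
        linarith
      · rw [if_neg fun h => hle h.1]
        have : (K * n : ℝ) ≤ x := by
          rw [hx]
          exact_mod_cast (not_le.1 hle).le
        have : 1 / 2 ≤ 1 / (2 * K * n) * x := by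
          rw [div_mul_eq_mul_div, one_mul, le_div_iff₀ (by positivity)]
          linarith
        linarith
    · rw [if_neg hdis]
      split_ifs <;> linarith
  · rw [avgs_add, avgs_const (fun i _ => drawBound_pos hG i), avgs_add, avgs_const_mul,
      avgs_const_mul]
    -- The choice `K ≥ 208 / r` makes the Markov term `52 / K` at most `r / 4`, half of the gain `r
    -- / 2`.
    have h3 : 1 / (2 * (K : ℝ) * n) * avgs (drawBound G) (List.range (2 * n + m))
      (fun ω' => ((crossing ends (sampleSet ends nbr ω')).card : ℝ)) ω ≤ r / 4 := by
      calc _ ≤ 1 / (2 * (K : ℝ) * n) * (104 * n) := by gcongr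
        _ = 208 / (4 * K) := by field_simp; norm_num
        _ ≤ r / 4 := by
          rw [div_le_div_iff₀ (by positivity) (by norm_num)]
          linarith
    linarith

end sample

end MinCut

/-! ### Graph search on half-edges -/

namespace MinCut

/-- The state of a search: `lab` holds the labels (`0` for none), `queue` the labelled vertices.
The vertices below `root` are labelled, `k` is the last label used, the entries of the queue
before `qh` have been taken out, and the half-edges of the last vertex taken out
that lie before `p` are still to be scanned. -/
structure Search (n N : ℕ) (tl hd : ℕ → ℕ) (E : ℕ → ℕ → Prop) (mk : ℕ → Prop)
    (lab queue : ℕ → ℕ) (k root qh qt p : ℕ) : Prop where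
  root_le : root ≤ n
  k_le : k ≤ root
  qh_le : qh ≤ qt
  lab_le : ∀ v < n, lab v ≤ k
  lab_root : ∀ v < root, lab v ≠ 0
  sound : ∀ u < n, ∀ v < n, lab u = lab v → lab u ≠ 0 → E u v
  surj : ∀ j, 1 ≤ j → j ≤ k → ∃ v < n, lab v = j
  queue_lt : ∀ i < qt, queue i < n
  queue_lab : ∀ i < qt, lab (queue i) ≠ 0
  queue_inj : ∀ i < qt, ∀ i' < qt, queue i = queue i' → i = i'
  mem_queue : ∀ v < n, lab v ≠ 0 → ∃ i < qt, queue i = v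
  cur : p ≠ 0 → 0 < qh ∧ p ≤ N ∧ tl (p - 1) = queue (qh - 1) ∧ lab (queue (qh - 1)) = k
  pending : ∀ i, qh ≤ i → i < qt → lab (queue i) = k
  closed : ∀ i < qh, ∀ h < N, tl h = queue i → mk h → (i + 1 = qh → p ≤ h) →
    lab (hd h) = lab (queue i)

/-- `last H v` is the last half-edge before `H` with tail `v`, plus one, or `0` if there is none. -/
def last (tl : ℕ → ℕ) : ℕ → ℕ → ℕ
  | 0, _ => 0
  | H + 1, v => if tl H = v then H + 1 else last tl H v

/-- The number of half-edges before `H` with tail `v`. -/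
def count (tl : ℕ → ℕ) : ℕ → ℕ → ℕ
  | 0, _ => 0
  | H + 1, v => if tl H = v then count tl H v + 1 else count tl H v

section last

variable (tl : ℕ → ℕ)

theorem last_le (H v : ℕ) : last tl H v ≤ H := by
  induction H with
  | zero => rfl
  | succ H ih => rw [last]; split_ifs <;> omega

theorem tl_last {H v : ℕ} (h : last tl H v ≠ 0) : tl (last tl H v - 1) = v := by
  induction H with
  | zero => exact absurd rfl h
  | succ H ih =>
    rw [last] at h ⊢
    split_ifs at h ⊢ with hv
    · simpa using hv
    · exact ih h

theorem lt_last {H v h : ℕ} (hh : h < H) (hv : tl h = v) : h < last tl H v := by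
  induction H with
  | zero => omega
  | succ H ih =>
    rw [last]
    split_ifs with h'
    · exact hh
    · refine ih (lt_of_le_of_ne (Nat.le_of_lt_succ hh) ?_)
      rintro rfl
      exact h' hv

theorem count_eq_card (H v : ℕ) :
    count tl H v = ((Finset.range H).filter fun h => tl h = v).card := by
  induction H with
  | zero => rfl
  | succ H ih =>
    rw [count, Finset.range_add_one, Finset.filter_insert, ih]
    split_ifs
    · rw [Finset.card_insert_of_notMem (by simp)]
    · rfl

theorem count_mono (v : ℕ) : Monotone fun H => count tl H v := by
  refine monotone_nat_of_le_succ fun H => ?_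
  simp only [count]
  split_ifs <;> omega

theorem count_le (H v : ℕ) : count tl H v ≤ H := by
  induction H with
  | zero => rfl
  | succ H ih => rw [count]; split_ifs <;> omega

theorem count_lt_count {h H v : ℕ} (hh : h < H) (hv : tl h = v) : count tl h v < count tl H v := by
  have : count tl (h + 1) v ≤ count tl H v := count_mono tl v hh
  rw [count, if_pos hv] at this
  omega

theorem count_inj {h h' v : ℕ} (hv : tl h = v) (hv' : tl h' = v)
    (heq : count tl h v = count tl h' v) : h = h' := by
  rcases lt_trichotomy h h' with hlt | rfl | hlt
  · exact absurd heq (count_lt_count tl hlt hv).ne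
  · rfl
  · exact absurd heq (count_lt_count tl hlt hv').ne'

theorem exists_count {H v x : ℕ} (hx : x < count tl H v) :
    ∃ h < H, tl h = v ∧ count tl h v = x := by
  induction H with
  | zero => exact absurd hx (Nat.not_lt_zero _)
  | succ H ih =>
    rw [count] at hx
    by_cases hx' : x < count tl H v
    · obtain ⟨h, hh, h'⟩ := ih hx'
      exact ⟨h, by omega, h'⟩
    · split_ifs at hx with hv
      · exact ⟨H, by omega, hv, by omega⟩
      · omega

end last

section search

variable {n N : ℕ} {tl hd : ℕ → ℕ} {E : ℕ → ℕ → Prop} {mk : ℕ → Prop}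
  {lab queue : ℕ → ℕ} {k root qh qt p : ℕ}

/-- Every vertex enters the queue at most once. -/
theorem Search.qt_le (S : Search n N tl hd E mk lab queue k root qh qt p) : qt ≤ n := by
  have := Finset.card_le_card_of_injOn (s := Finset.range qt) (t := Finset.range n) queue
    (fun i hi => by simpa using S.queue_lt i (by simpa using hi))
    (fun i hi i' hi' h => S.queue_inj i (by simpa using hi) i' (by simpa using hi') h)
  simpa using this

theorem Search.init : Search n N tl hd E mk (fun _ => 0) queue 0 0 0 0 0 where
  root_le := Nat.zero_le _
  k_le := le_rfl
  qh_le := le_rfl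
  lab_le _ _ := le_rfl
  lab_root _ h := absurd h (Nat.not_lt_zero _)
  sound _ _ _ _ _ h := absurd rfl h
  surj j h1 h2 := by omega
  queue_lt _ h := absurd h (Nat.not_lt_zero _)
  queue_lab _ h := absurd h (Nat.not_lt_zero _)
  queue_inj _ h := absurd h (Nat.not_lt_zero _)
  mem_queue _ _ h := absurd rfl h
  cur h := absurd rfl h
  pending _ _ h := absurd h (Nat.not_lt_zero _)
  closed _ h := absurd h (Nat.not_lt_zero _)

theorem Search.congr {lab' queue' : ℕ → ℕ} (hhd : ∀ h < N, hd h < n)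
    (S : Search n N tl hd E mk lab queue k root qh qt p)
    (h1 : ∀ v < n, lab' v = lab v) (h2 : ∀ i < qt, queue' i = queue i) :
    Search n N tl hd E mk lab' queue' k root qh qt p where
  root_le := S.root_le
  k_le := S.k_le
  qh_le := S.qh_le
  lab_le v hv := by rw [h1 v hv]; exact S.lab_le v hv
  lab_root v hv := by rw [h1 v (hv.trans_le S.root_le)]; exact S.lab_root v hv
  sound u hu v hv := by rw [h1 u hu, h1 v hv]; exact S.sound u hu v hv
  surj j hj hjk := by
    obtain ⟨v, hv, h⟩ := S.surj j hj hjk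
    exact ⟨v, hv, by rw [h1 v hv, h]⟩
  queue_lt i hi := by rw [h2 i hi]; exact S.queue_lt i hi
  queue_lab i hi := by rw [h2 i hi, h1 _ (S.queue_lt i hi)]; exact S.queue_lab i hi
  queue_inj i hi i' hi' := by rw [h2 i hi, h2 i' hi']; exact S.queue_inj i hi i' hi'
  mem_queue v hv h := by
    rw [h1 v hv] at h
    obtain ⟨i, hi, h'⟩ := S.mem_queue v hv h
    exact ⟨i, hi, by rw [h2 i hi, h']⟩
  cur hp := by
    obtain ⟨h3, h4, h5, h6⟩ := S.cur hp
    have hlt : qh - 1 < qt := by have := S.qh_le; omega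
    rw [h2 _ hlt, h1 _ (S.queue_lt _ hlt)]
    exact ⟨h3, h4, h5, h6⟩
  pending i hi hi' := by rw [h2 i hi', h1 _ (S.queue_lt i hi')]; exact S.pending i hi hi'
  closed i hi h hh ht hm hp := by
    have hi' := hi.trans_le S.qh_le
    rw [h2 i hi'] at ht ⊢
    rw [h1 _ (hhd h hh), h1 _ (S.queue_lt i hi')]
    exact S.closed i hi h hh ht hm hp

/-- A neighbor of the current vertex receives its label. -/
theorem Search.label (hE : Equivalence E) (htl : ∀ h < N, tl h < n) (hhd : ∀ h < N, hd h < n)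
    (hmkE : ∀ h < N, mk h → E (tl h) (hd h))
    (S : Search n N tl hd E mk lab queue k root qh qt p) (hp : p ≠ 0) (hm : mk (p - 1))
    (h0 : lab (hd (p - 1)) = 0) :
    Search n N tl hd E mk (Function.update lab (hd (p - 1)) (lab (tl (p - 1))))
      (Function.update queue qt (hd (p - 1))) k root qh (qt + 1) p := by
  obtain ⟨hqh, hpN, htlp, hlabp⟩ := S.cur hp
  set y := hd (p - 1) with hy
  have hyn : y < n := hhd _ (by omega)
  have hk : lab (tl (p - 1)) = k := by rw [htlp, hlabp]
  have hqt := S.qh_le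
  have hcur_lab := S.queue_lab (qh - 1) (by omega)
  have hk0 : k ≠ 0 := by rw [← hlabp]; exact hcur_lab
  have hExy : E (tl (p - 1)) y := hmkE _ (by omega) hm
  have hne : ∀ i < qt, queue i ≠ y := fun i hi h => S.queue_lab i hi (h ▸ h0)
  have hl : ∀ v, lab v ≠ 0 → Function.update lab y (lab (tl (p - 1))) v = lab v := by
    intro v hv
    rw [Function.update_of_ne]
    rintro rfl
    exact hv h0
  have hq : ∀ i < qt, Function.update queue qt y i = queue i := fun i hi =>
    Function.update_of_ne hi.ne _ _
  rw [hk] at hl ⊢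
  refine ⟨S.root_le, S.k_le, by omega, ?_, ?_, ?_, ?_, ?_, ?_, ?_, ?_, ?_, ?_, ?_⟩
  · intro v hv
    rw [Function.update_apply]
    split_ifs
    · exact le_rfl
    · exact S.lab_le v hv
  · intro v hv
    rw [hl v (S.lab_root v hv)]
    exact S.lab_root v hv
  · have key : ∀ v < n, v ≠ y → lab v = k → E v y := fun v hv _ hvk =>
      hE.trans (S.sound v hv _ (htl (p - 1) (by omega)) (by rw [hvk, hk]) (by rw [hvk]; exact hk0))
        hExy
    intro u hu v hv huv hu0
    by_cases hu' : u = y <;> by_cases hv' : v = y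
    · rw [hu', hv']; exact hE.refl _
    · rw [hu', Function.update_self, Function.update_of_ne hv'] at huv
      rw [hu']
      exact hE.symm (key v hv hv' huv.symm)
    · rw [hv', Function.update_self, Function.update_of_ne hu'] at huv
      rw [hv']
      exact key u hu hu' huv
    · rw [Function.update_of_ne hu', Function.update_of_ne hv'] at huv
      rw [Function.update_of_ne hu'] at hu0
      exact S.sound u hu v hv huv hu0
  · intro j hj hjk
    obtain ⟨v, hv, h⟩ := S.surj j hj hjk
    exact ⟨v, hv, by rw [hl v (by omega), h]⟩
  · intro i hi
    rw [Function.update_apply]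
    split_ifs
    · exact hyn
    · exact S.queue_lt i (by omega)
  · intro i hi
    by_cases hi' : i = qt
    · rw [hi', Function.update_self, Function.update_self]; exact hk0
    · rw [hq i (by omega), hl _ (S.queue_lab i (by omega))]
      exact S.queue_lab i (by omega)
  · intro i hi i' hi' h
    by_cases h1 : i = qt <;> by_cases h2 : i' = qt
    · omega
    · rw [h1, Function.update_self, hq i' (by omega)] at h
      exact absurd h.symm (hne i' (by omega))
    · rw [h2, Function.update_self, hq i (by omega)] at h
      exact absurd h (hne i (by omega))
    · rw [hq i (by omega), hq i' (by omega)] at h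
      exact S.queue_inj i (by omega) i' (by omega) h
  · intro v hv hv0
    by_cases hvy : v = y
    · exact ⟨qt, by omega, by rw [Function.update_self, hvy]⟩
    · rw [Function.update_of_ne hvy] at hv0
      obtain ⟨i, hi, h⟩ := S.mem_queue v hv hv0
      exact ⟨i, by omega, by rw [hq i hi, h]⟩
  · intro _
    rw [hq _ (by omega), hl _ hcur_lab]
    exact ⟨hqh, hpN, htlp, hlabp⟩
  · intro i hi hi'
    by_cases h1 : i = qt
    · rw [h1, Function.update_self, Function.update_self]
    · rw [hq i (by omega), hl _ (S.queue_lab i (by omega))]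
      exact S.pending i hi (by omega)
  · intro i hi h hh ht hmh hph
    rw [hq i (by omega)] at ht ⊢
    have h1 := S.closed i hi h hh ht hmh hph
    have h2 := S.queue_lab i (by omega)
    rw [hl _ h2, hl _ (by rw [h1]; exact h2), h1]

/-- The scan of a half-edge whose head has a label is finished. -/
theorem Search.scan (hrev : ∀ h < N, mk h → ∃ h' < N, mk h' ∧ tl h' = hd h ∧ hd h' = tl h)
    (hhd : ∀ h < N, hd h < n)
    (S : Search n N tl hd E mk lab queue k root qh qt p) (hp : p ≠ 0)
    (h0 : mk (p - 1) → lab (hd (p - 1)) ≠ 0) :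
    Search n N tl hd E mk lab queue k root qh qt (last tl (p - 1) (tl (p - 1))) := by
  obtain ⟨hqh, hpN, htlp, hlabp⟩ := S.cur hp
  refine ⟨S.root_le, S.k_le, S.qh_le, S.lab_le, S.lab_root, S.sound, S.surj, S.queue_lt,
    S.queue_lab, S.queue_inj, S.mem_queue, ?_, S.pending, ?_⟩
  · intro h
    refine ⟨hqh, ?_, ?_, hlabp⟩
    · have := last_le tl (p - 1) (tl (p - 1))
      omega
    · rw [tl_last tl h, htlp]
  · intro i hi h hh ht hm hle
    by_cases hph : i + 1 = qh → p ≤ h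
    · exact S.closed i hi h hh ht hm hph
    · rw [Classical.not_imp, not_le] at hph
      obtain ⟨h1, h2⟩ := hph
      have hiq : i = qh - 1 := by omega
      -- No half-edge with the same tail lies strictly between the old and the new cursor, so `p -
      -- 1` is the only one that is newly claimed to be closed.
      have hh' : h = p - 1 := by
        by_contra hne
        have := lt_last tl (show h < p - 1 by omega) (show tl h = tl (p - 1) by rw [ht, htlp, hiq])
        have := hle h1
        omega
      subst hh'
      rw [hiq, hlabp]
      have hy0 := h0 hm
      -- The labelled head sits somewhere in the queue. If it was completely processed before, the
      -- reverse half-edge is closed and its labels agree; if it is the current vertex or still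
      -- waiting, its label is `k`.
      obtain ⟨i', hi', hqi'⟩ := S.mem_queue _ (hhd _ hh) hy0
      by_cases hi'q : i' + 1 < qh
      · obtain ⟨h', hh', hm', ht', hd'⟩ := hrev _ hh hm
        have := S.closed i' (by omega) h' hh' (by rw [ht', hqi']) hm' (by omega)
        rw [hd', htlp, hlabp, hqi'] at this
        exact this.symm
      · by_cases hi'q' : i' + 1 = qh
        · rw [← hqi', show i' = qh - 1 by omega, hlabp]
        · rw [← hqi']
          exact S.pending i' (by omega) hi'

/-- The next vertex is taken out of the queue. -/
theorem Search.pop (S : Search n N tl hd E mk lab queue k root qh qt 0) (hq : qh < qt) :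
    Search n N tl hd E mk lab queue k root (qh + 1) qt (last tl N (queue qh)) := by
  refine ⟨S.root_le, S.k_le, hq, S.lab_le, S.lab_root, S.sound, S.surj, S.queue_lt,
    S.queue_lab, S.queue_inj, S.mem_queue, ?_, fun i hi => S.pending i (by omega), ?_⟩
  · intro h
    exact ⟨by omega, last_le _ _ _, tl_last tl h, S.pending qh le_rfl hq⟩
  · intro i hi h hh ht hm hle
    by_cases hiq : i = qh
    · have := lt_last tl hh ht
      have := hle (by omega)
      rw [hiq] at *
      omega
    · exact S.closed i (by omega) h hh ht hm (fun _ => Nat.zero_le _)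

/-- A vertex without a label receives a new one. -/
theorem Search.newRoot (S : Search n N tl hd E mk lab queue k root qh qh 0) (hr : root < n)
    (hE : Equivalence E) (h0 : lab root = 0) :
    Search n N tl hd E mk (Function.update lab root (k + 1)) (Function.update queue qh root)
      (k + 1) (root + 1) qh (qh + 1) 0 := by
  have hne : ∀ i < qh, queue i ≠ root := fun i hi h => S.queue_lab i hi (h ▸ h0)
  have hl : ∀ v, lab v ≠ 0 → Function.update lab root (k + 1) v = lab v := by
    intro v hv
    rw [Function.update_of_ne]
    rintro rfl
    exact hv h0
  have hq : ∀ i < qh, Function.update queue qh root i = queue i := fun i hi =>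
    Function.update_of_ne hi.ne _ _
  refine ⟨hr, by have := S.k_le; omega, by omega, ?_, ?_, ?_, ?_, ?_, ?_, ?_, ?_,
    fun h => absurd rfl h, ?_, ?_⟩
  · intro v hv
    rw [Function.update_apply]
    split_ifs
    · exact le_rfl
    · exact (S.lab_le v hv).trans (Nat.le_succ _)
  · intro v hv
    by_cases hvr : v = root
    · rw [hvr, Function.update_self]; omega
    · have := S.lab_root v (by omega)
      rw [hl v this]
      exact this
  · intro u hu v hv huv hu0
    by_cases hu' : u = root <;> by_cases hv' : v = root
    · rw [hu', hv']; exact hE.refl _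
    · rw [hu', Function.update_self, Function.update_of_ne hv'] at huv
      have := S.lab_le v hv
      omega
    · rw [hv', Function.update_self, Function.update_of_ne hu'] at huv
      have := S.lab_le u hu
      omega
    · rw [Function.update_of_ne hu', Function.update_of_ne hv'] at huv
      rw [Function.update_of_ne hu'] at hu0
      exact S.sound u hu v hv huv hu0
  · intro j hj hjk
    by_cases hj' : j = k + 1
    · exact ⟨root, hr, by rw [Function.update_self, hj']⟩
    · obtain ⟨v, hv, h⟩ := S.surj j hj (by omega)
      exact ⟨v, hv, by rw [hl v (by omega), h]⟩
  · intro i hi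
    rw [Function.update_apply]
    split_ifs
    · exact hr
    · exact S.queue_lt i (by omega)
  · intro i hi
    by_cases hi' : i = qh
    · rw [hi', Function.update_self, Function.update_self]; omega
    · rw [hq i (by omega), hl _ (S.queue_lab i (by omega))]
      exact S.queue_lab i (by omega)
  · intro i hi i' hi' h
    by_cases h1 : i = qh <;> by_cases h2 : i' = qh
    · omega
    · rw [h1, Function.update_self, hq i' (by omega)] at h
      exact absurd h.symm (hne i' (by omega))
    · rw [h2, Function.update_self, hq i (by omega)] at h
      exact absurd h (hne i (by omega))
    · rw [hq i (by omega), hq i' (by omega)] at h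
      exact S.queue_inj i (by omega) i' (by omega) h
  · intro v hv hv0
    by_cases hvy : v = root
    · exact ⟨qh, by omega, by rw [Function.update_self, hvy]⟩
    · rw [Function.update_of_ne hvy] at hv0
      obtain ⟨i, hi, h⟩ := S.mem_queue v hv hv0
      exact ⟨i, by omega, by rw [hq i hi, h]⟩
  · intro i hi hi'
    obtain rfl : i = qh := by omega
    rw [Function.update_self, Function.update_self]
  · intro i hi h hh ht hmh hph
    rw [hq i hi] at ht ⊢
    have h1 := S.closed i hi h hh ht hmh hph
    have h2 := S.queue_lab i hi
    rw [hl _ h2, hl _ (by rw [h1]; exact h2), h1]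

/-- A vertex that has a label is no new root. -/
theorem Search.oldRoot (S : Search n N tl hd E mk lab queue k root qh qt p) (hr : root < n)
    (h0 : lab root ≠ 0) : Search n N tl hd E mk lab queue k (root + 1) qh qt p :=
  ⟨hr, by have := S.k_le; omega, S.qh_le, S.lab_le, fun v hv => by
    rcases Nat.lt_succ_iff_lt_or_eq.1 hv with h | rfl
    · exact S.lab_root v h
    · exact h0, S.sound, S.surj, S.queue_lt, S.queue_lab, S.queue_inj, S.mem_queue, S.cur,
    S.pending, S.closed⟩

/-- At the end of a search, marked half-edges join vertices with equal labels. -/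
theorem Search.eq_of_mk (S : Search n N tl hd E mk lab queue k n qh qh 0)
    (htl : ∀ h < N, tl h < n) {h : ℕ} (hh : h < N) (hm : mk h) : lab (tl h) = lab (hd h) := by
  obtain ⟨i, hi, hq⟩ := S.mem_queue _ (htl h hh) (S.lab_root _ (htl h hh))
  have := S.closed i hi h hh hq.symm hm fun _ => Nat.zero_le _
  rw [this, hq]

/-- The half-edges that are still to be scanned. -/
def unscanned (N : ℕ) (tl queue : ℕ → ℕ) (qh p : ℕ) : Finset ℕ :=
  (Finset.range N).filter fun h =>
    (∀ i < qh, queue i ≠ tl h) ∨ (h < p ∧ 0 < qh ∧ tl h = queue (qh - 1))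

/-- The number of steps that remain in a search. -/
def remaining (n N : ℕ) (tl queue : ℕ → ℕ) (root qh p : ℕ) : ℕ :=
  (n - root) + (n - qh) + (unscanned N tl queue qh p).card

theorem remaining_congr {queue' : ℕ → ℕ} (h : ∀ i < qh, queue' i = queue i) :
    remaining n N tl queue' root qh p = remaining n N tl queue root qh p := by
  unfold remaining unscanned
  congr 2
  refine Finset.filter_congr fun x _ => ?_
  refine or_congr (forall₂_congr fun i hi => by rw [h i hi]) ?_
  refine and_congr_right fun _ => and_congr_right fun h0 => ?_
  rw [h _ (by omega)]

/-- The half-edge `p - 1` is finished, and the cursor moves strictly down. -/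
theorem remaining_scan (S : Search n N tl hd E mk lab queue k root qh qt p) (hp : p ≠ 0) :
    remaining n N tl queue root qh (last tl (p - 1) (tl (p - 1))) <
      remaining n N tl queue root qh p := by
  obtain ⟨hqh, hpN, htlp, hlabp⟩ := S.cur hp
  have hl := last_le tl (p - 1) (tl (p - 1))
  unfold remaining
  refine Nat.add_lt_add_left (Finset.card_lt_card ?_) _
  rw [Finset.ssubset_iff_of_subset]
  · refine ⟨p - 1, ?_, ?_⟩
    · simp only [unscanned, Finset.mem_filter, Finset.mem_range]
      exact ⟨by omega, Or.inr ⟨by omega, hqh, htlp⟩⟩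
    · simp only [unscanned, Finset.mem_filter, Finset.mem_range, not_and, not_or]
      intro _
      exact ⟨fun h => h (qh - 1) (by omega) htlp.symm, fun h => absurd h (by omega)⟩
  · intro h
    simp only [unscanned, Finset.mem_filter, Finset.mem_range]
    rintro ⟨h1, h2 | ⟨h2, h3⟩⟩
    · exact ⟨h1, Or.inl h2⟩
    · exact ⟨h1, Or.inr ⟨by omega, h3⟩⟩

/-- The half-edges of the vertex taken out were already unscanned, because the queue has no
repetitions; so only the term `n - qh` changes for the worse or falls, and it falls by one. -/
theorem remaining_pop (S : Search n N tl hd E mk lab queue k root qh qt 0) (hq : qh < qt) :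
    remaining n N tl queue root (qh + 1) (last tl N (queue qh)) <
      remaining n N tl queue root qh 0 := by
  have := S.qt_le
  unfold remaining
  have : (unscanned N tl queue (qh + 1) (last tl N (queue qh))).card ≤
      (unscanned N tl queue qh 0).card := by
    refine Finset.card_le_card fun h => ?_
    simp only [unscanned, Finset.mem_filter, Finset.mem_range]
    rintro ⟨h1, h2 | ⟨-, -, h3⟩⟩
    · exact ⟨h1, Or.inl fun i hi => h2 i (by omega)⟩
    · refine ⟨h1, Or.inl fun i hi heq => ?_⟩
      rw [h3] at heq
      have := S.queue_inj i (by omega) qh hq heq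
      omega
  omega

theorem remaining_root (hr : root < n) :
    remaining n N tl queue (root + 1) qh p < remaining n N tl queue root qh p := by
  unfold remaining
  omega

theorem remaining_le : remaining n N tl queue root qh p ≤ 2 * n + N := by
  unfold remaining
  have : (unscanned N tl queue qh p).card ≤ N := by
    simpa [unscanned] using Finset.card_filter_le (Finset.range N) _
  omega

end search

end MinCut

/-! ### The program -/

namespace MinCut

open WordRAM

/-- The first cell after the input, and the layout of the records from there on:
fields `0` degree, `1` last half-edge of a vertex, `2` position of a half-edge at its tail,
`3` preceding half-edge with the same tail, `5` random number, `6` mark of an edge,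
`7` label of a vertex, `8` queue, `9` counter of an edge. -/
abbrev base (m : ℕ) : ℕ := 2 * m + 2

/-- Registers `4`, `5`, `6` hold `n`, `m` and the base of the records, `7` the minimum degree, `8`
the number of rounds, `9` the current round; those from `10` on are loop variables and scratch.
Registers `0` to `3` are for the output, and `0` also holds the number of labels during a search. -/
def readInput : Stmt :=
  .seq (.assign 4 (.load num[0])) (.seq (.assign 5 (.load num[1]))
    (.assign 6 (num[2] * reg[5] + num[2])))

/-- The tail of the half-edge `h` is in the input cell `h + 2`. A single pass numbers the half-edges
at each vertex and threads them into a linked list; pointers are stored plus one, so `0` ends a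
list. -/
def buildLists : Stmt :=
  forUpTo 10 (num[2] * reg[5]) (
    .seq (.assign 11 (.load (reg[10] + num[2]))) (
    .seq (.store (addr 2 reg[10]) (fld 0 reg[11])) (
    .seq (.store (addr 0 reg[11]) (fld 0 reg[11] + num[1])) (
    .seq (.store (addr 3 reg[10]) (fld 1 reg[11]))
      (.store (addr 1 reg[11]) (reg[10] + num[1]))))))

def findMinDegree : Stmt :=
  .seq (.assign 7 reg[4]) (forUpTo 10 reg[4]
    (.ite (.op .lt (fld 0 reg[10]) reg[7]) (.assign 7 (fld 0 reg[10])) .skip))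

/-- Repeated halving counts the binary digits of `n`, each of which is worth `A` rounds. -/
def countRounds (A : ℕ) : Stmt :=
  .seq (.assign 8 num[0]) (.seq (.assign 10 reg[4])
    (.loop reg[10] (.seq (.assign 10 (reg[10] / num[2])) (.assign 8 (reg[8] + num[A])))))

/-- An edge is picked if the position of one of its half-edges equals one of the two draws of the
tail, so no list has to be walked. The mark is a sum of five indicators; nonzero means sampled. -/
def markBody : Stmt :=
  .seq (.assign 11 (.load (num[2] * reg[10] + num[2]))) (
  .seq (.assign 12 (.load (num[2] * reg[10] + num[3]))) (
  .seq (.assign 13 (fld 2 (num[2] * reg[10]))) (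
  .seq (.assign 14 (fld 2 (num[2] * reg[10] + num[1]))) (
  .seq (.assign 15 (.op .eq (fld 5 (num[2] * reg[4] + reg[10])) num[0])) (
    .store (addr 6 reg[10]) (reg[15] +
      (.op .eq reg[13] (fld 5 (num[2] * reg[11])) +
        .op .eq reg[13] (fld 5 (num[2] * reg[11] + num[1]))) +
      (.op .eq reg[14] (fld 5 (num[2] * reg[12])) +
        .op .eq reg[14] (fld 5 (num[2] * reg[12] + num[1])))))))))

def markSample : Stmt := forUpTo 10 reg[5] markBody

/-- One unit of work: scan the half-edge `reg[13] - 1`, or else take a vertex from the queue between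
registers `11` and `12`, or else try the next root in register `10`. The head of `h` is the tail of
its partner, in the input cell `h + 3 - 2 * (h % 2)`. -/
def searchStep : Stmt :=
  .ite reg[13]
    (.seq (.assign 16 (reg[13] - num[1])) (
     .seq (.assign 14 (.load (reg[16] + num[2]))) (
     .seq (.assign 15 (.load (reg[16] + num[3] - num[2] * (reg[16] % num[2])))) (
     .seq (.ite (fld 6 (reg[16] / num[2]))
        (.ite (fld 7 reg[15]) .skip
          (.seq (.store (addr 7 reg[15]) (fld 7 reg[14]))
          (.seq (.store (addr 8 reg[12]) reg[15]) (.assign 12 (reg[12] + num[1])))))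
        .skip)
      (.assign 13 (fld 3 reg[16]))))))
    (.ite (.op .lt reg[11] reg[12])
      (.seq (.assign 14 (fld 8 reg[11])) (
       .seq (.assign 13 (fld 1 reg[14])) (.assign 11 (reg[11] + num[1]))))
      (.seq (.ite (fld 7 reg[10]) .skip
          (.seq (.assign 0 (reg[0] + num[1]))
          (.seq (.store (addr 7 reg[10]) reg[0])
          (.seq (.store (addr 8 reg[12]) reg[10]) (.assign 12 (reg[12] + num[1]))))))
        (.assign 10 (reg[10] + num[1]))))

def findComponents : Stmt :=
  .seq (forUpTo 10 reg[4] (.store (addr 7 reg[10]) num[0])) (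
  .seq (.seq (.assign 0 num[0]) (.seq (.assign 10 num[0]) (.seq (.assign 11 num[0])
    (.seq (.assign 12 num[0]) (.assign 13 num[0])))))
  (.loop (reg[13] + .op .lt reg[11] reg[12] + .op .lt reg[10] reg[4]) searchStep))

def countBody : Stmt :=
  .seq (.assign 12 (.load (num[2] * reg[10] + num[2]))) (
  .seq (.assign 13 (.load (num[2] * reg[10] + num[3])))
    (.assign 11 (reg[11] + (num[1] - .op .eq (fld 7 reg[12]) (fld 7 reg[13])))))

/-- Register `14` becomes the flag that at most `K * n` edges cross. It multiplies the votes of the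
round, which makes the bound on the total number of votes certain. -/
def countCrossing (K : ℕ) : Stmt :=
  .seq (.assign 11 num[0]) (.seq (forUpTo 10 reg[5] countBody)
    (.assign 14 (num[1] - .op .lt (num[K] * reg[4]) reg[11])))

def addBody : Stmt :=
  .seq (.assign 12 (.load (num[2] * reg[10] + num[2]))) (
  .seq (.assign 13 (.load (num[2] * reg[10] + num[3])))
    (.store (addr 9 reg[10]) (fld 9 reg[10] +
      (num[1] - .op .eq (fld 7 reg[12]) (fld 7 reg[13])) * reg[14])))

def addCrossing : Stmt := forUpTo 10 reg[5] addBody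

def drawStep : Stmt :=
  .seq (.seq
    (.ite (.op .lt reg[10] (num[2] * reg[4])) (.assign 11 (fld 0 (reg[10] / num[2])))
      (.assign 11 (num[2] * reg[7])))
    (.rand 12 reg[11]))
    (.seq (.store (addr 5 reg[10]) reg[12]) (.assign 10 (reg[10] + num[1])))

def drawAll : Stmt :=
  .seq (.assign 10 num[0]) (.loop (.op .lt reg[10] (num[2] * reg[4] + reg[5])) drawStep)

def round (K : ℕ) : Stmt :=
  .seq drawAll (.seq markSample (.seq findComponents (.seq (countCrossing K) addCrossing)))

def rounds (K : ℕ) : Stmt :=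
  .seq (.assign 9 num[0]) (.loop (.op .lt reg[9] reg[8])
    (.seq (round K) (.assign 9 (reg[9] + num[1]))))

/-- The marks of the rarely surviving edges reuse the field of the sampled edges, so that
`findComponents` also computes the final contraction. -/
def markRare (B : ℕ) : Stmt :=
  forUpTo 10 reg[5] (.store (addr 6 reg[10]) (.op .lt (num[B] * fld 9 reg[10]) reg[8]))

def writeBody : Stmt :=
  .seq (.assign 11 (.load (num[2] * reg[10] + num[2]))) (
  .seq (.assign 12 (.load (num[2] * reg[10] + num[3]))) (
  .seq (.assign 13 (fld 7 reg[11])) (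
  .seq (.assign 14 (fld 7 reg[12])) (
  .ite (.op .eq reg[13] reg[14]) .skip (
    .seq (.store (reg[2] + num[3] * reg[1]) reg[10]) (
    .seq (.store (reg[2] + num[3] * reg[1] + num[1]) (reg[13] - num[1])) (
    .seq (.store (reg[2] + num[3] * reg[1] + num[2]) (reg[14] - num[1]))
      (.assign 1 (reg[1] + num[1])))))))))

/-- The random numbers need `2 * n + m` records and the half-edges `2 * m`, so the output may start
after `2 * n + 2 * m + 1` records. -/
def writeInit : Stmt :=
  .seq (.assign 2 (reg[6] + num[16] * (num[2] * reg[4] + num[2] * reg[5] + num[1]))) (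
  .seq (.assign 3 (reg[2] + num[3] * reg[5])) (.assign 1 num[0]))

def writeEdges : Stmt := .seq writeInit (forUpTo 10 reg[5] writeBody)

def writeNodes : Stmt :=
  forUpTo 10 reg[4] (.store (reg[3] + reg[10]) (fld 7 reg[10] - num[1]))

/-- Random 2-out contractions with voting. -/
def contraction (A B K : ℕ) : Stmt :=
  .seq readInput (.seq buildLists (.seq findMinDegree (.seq (countRounds A) (.seq (rounds K)
    (.seq (markRare B) (.seq findComponents (.seq writeEdges writeNodes)))))))

/-! ### Deterministic parts -/

/-- The tail of a half-edge; the half-edges `2 * e` and `2 * e + 1` belong to the edge `e`. -/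
def tail {n m : ℕ} (ends : Fin m → Fin n × Fin n) (h : ℕ) : ℕ := (inputState ends).mem (h + 2)

/-- The head of a half-edge. -/
def head {n m : ℕ} (ends : Fin m → Fin n × Fin n) (h : ℕ) : ℕ := tail ends (h + 1 - 2 * (h % 2))

section tail

variable {n m : ℕ} {ends : Fin m → Fin n × Fin n}

theorem tail_even (e : Fin m) : tail ends (2 * e) = (ends e).1 := by
  have h1 : (2 * (e : ℕ) + 2 - 2) / 2 = e := by omega
  have h2 : (2 * (e : ℕ) + 2) % 2 = 0 := by omega
  simp [tail, inputState, h2]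

theorem tail_odd (e : Fin m) : tail ends (2 * e + 1) = (ends e).2 := by
  have h1 : (2 * (e : ℕ) + 1 + 2 - 2) / 2 = e := by omega
  have h2 : ¬ (2 * (e : ℕ) + 1 + 2) % 2 = 0 := by omega
  simp only [tail, inputState, h1, h2, if_false]
  rw [if_neg (by omega), if_neg (by omega), dif_pos e.2]

theorem head_even (e : Fin m) : head ends (2 * e) = (ends e).2 := by
  rw [head, show 2 * (e : ℕ) + 1 - 2 * (2 * (e : ℕ) % 2) = 2 * e + 1 by omega, tail_odd]

theorem head_odd (e : Fin m) : head ends (2 * e + 1) = (ends e).1 := by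
  rw [head, show 2 * (e : ℕ) + 1 + 1 - 2 * ((2 * (e : ℕ) + 1) % 2) = 2 * e by omega, tail_even]

theorem halfEdge_cases {h : ℕ} (hh : h < 2 * m) : ∃ e : Fin m, h = 2 * e ∨ h = 2 * e + 1 :=
  ⟨⟨h / 2, by omega⟩, by simp only; omega⟩

theorem tail_lt {h : ℕ} (hh : h < 2 * m) : tail ends h < n := by
  obtain ⟨e, rfl | rfl⟩ := halfEdge_cases hh
  · rw [tail_even]; exact Fin.is_lt _
  · rw [tail_odd]; exact Fin.is_lt _

theorem head_lt {h : ℕ} (hh : h < 2 * m) : head ends h < n := by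
  obtain ⟨e, rfl | rfl⟩ := halfEdge_cases hh
  · rw [head_even]; exact Fin.is_lt _
  · rw [head_odd]; exact Fin.is_lt _

end tail

/-- The input, and the registers with its sizes. -/
structure Ready {n m : ℕ} (ends : Fin m → Fin n × Fin n) (s : State) : Prop where
  reg4 : s.reg 4 = n
  reg5 : s.reg 5 = m
  reg6 : s.reg 6 = base m
  input : ∀ h < 2 * m, s.mem (h + 2) = tail ends h

/-- The results of the preparation. -/
structure Prepared {n m : ℕ} (ends : Fin m → Fin n × Fin n) (d q : ℕ) (s : State) : Prop
    extends Ready ends s where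
  reg7 : s.reg 7 = d
  reg8 : s.reg 8 = q
  deg : ∀ v < n, s.mem (slot (base m) 0 v) = count (tail ends) (2 * m) v
  first : ∀ v < n, s.mem (slot (base m) 1 v) = last (tail ends) (2 * m) v
  pos : ∀ h < 2 * m, s.mem (slot (base m) 2 h) = count (tail ends) h (tail ends h)
  next : ∀ h < 2 * m, s.mem (slot (base m) 3 h) = last (tail ends) h (tail ends h)

section frame

variable {n m : ℕ} {ends : Fin m → Fin n × Fin n} {s s' : State} {J : List (Fin 16)} {R : List ℕ}

theorem Ready.agree (h : Ready ends s) (ha : Agree (base m) J R s s')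
    (hR : ∀ r ∈ [4, 5, 6], r ∉ R) : Ready ends s' where
  reg4 := by rw [ha.2 4 (hR 4 (by simp)), h.reg4]
  reg5 := by rw [ha.2 5 (hR 5 (by simp)), h.reg5]
  reg6 := by rw [ha.2 6 (hR 6 (by simp)), h.reg6]
  input i hi := by rw [ha.low (by unfold base; omega), h.input i hi]

theorem Prepared.agree {d q : ℕ} (h : Prepared ends d q s) (ha : Agree (base m) J R s s')
    (hR : ∀ r ∈ [4, 5, 6, 7, 8], r ∉ R) (hJ : ∀ j ∈ ([0, 1, 2, 3] : List (Fin 16)), j ∉ J) :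
    Prepared ends d q s' where
  toReady := h.toReady.agree ha fun r hr => hR r (by simp at hr ⊢; tauto)
  reg7 := by rw [ha.2 7 (hR 7 (by simp)), h.reg7]
  reg8 := by rw [ha.2 8 (hR 8 (by simp)), h.reg8]
  deg v hv := by rw [ha.slot (hJ 0 (by simp)), h.deg v hv]
  first v hv := by rw [ha.slot (hJ 1 (by simp)), h.first v hv]
  pos v hv := by rw [ha.slot (hJ 2 (by simp)), h.pos v hv]
  next v hv := by rw [ha.slot (hJ 3 (by simp)), h.next v hv]

end frame

theorem even_input {n m : ℕ} {ends : Fin m → Fin n × Fin n} {s : State} (h : Ready ends s)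
    {e : ℕ} (he : e < m) : s.mem (2 * e + 2) = tail ends (2 * e) :=
  h.input _ (by omega)

theorem odd_input {n m : ℕ} {ends : Fin m → Fin n × Fin n} {s : State} (h : Ready ends s)
    {e : ℕ} (he : e < m) : s.mem (2 * e + 3) = tail ends (2 * e + 1) :=
  h.input _ (by omega)

section deterministic

variable {n m : ℕ} {ends : Fin m → Fin n × Fin n} {w : ℕ}

theorem wordLength_ne_zero (hw : 100 * (n + m + 1) ≤ 2 ^ w) : w ≠ 0 := by
  rintro rfl
  rw [pow_zero] at hw
  omega

theorem det_buildLists (hw : 100 * (n + m + 1) ≤ 2 ^ w) (s : State) (h : Ready ends s)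
    (h0 : ∀ j i, s.mem (slot (base m) j i) = 0) :
    ∃ s', Det w buildLists s (100 * m + 3) s' ∧
      Agree (base m) [0, 1, 2, 3] [10, 11] s s' ∧
      (∀ v < n, s'.mem (slot (base m) 0 v) = count (tail ends) (2 * m) v) ∧
      (∀ v < n, s'.mem (slot (base m) 1 v) = last (tail ends) (2 * m) v) ∧
      (∀ h < 2 * m, s'.mem (slot (base m) 2 h) = count (tail ends) h (tail ends h)) ∧
      (∀ h < 2 * m, s'.mem (slot (base m) 3 h) = last (tail ends) h (tail ends h)) := by
  obtain ⟨s', hd, -, hI⟩ := det_forUpTo (w := w) (by omega) (i := 10) (N := 2 * m)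
    (e := num[2] * reg[5]) (p := .seq (.assign 11 (.load (reg[10] + num[2]))) (
    .seq (.store (addr 2 reg[10]) (fld 0 reg[11])) (
    .seq (.store (addr 0 reg[11]) (fld 0 reg[11] + num[1])) (
    .seq (.store (addr 3 reg[10]) (fld 1 reg[11]))
      (.store (addr 1 reg[11]) (reg[10] + num[1])))))) rfl (by omega)
    (fun j t => Agree (base m) [0, 1, 2, 3] [10, 11] s t ∧
      (∀ v < n, t.mem (slot (base m) 0 v) = count (tail ends) j v) ∧
      (∀ v < n, t.mem (slot (base m) 1 v) = last (tail ends) j v) ∧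
      (∀ h < j, t.mem (slot (base m) 2 h) = count (tail ends) h (tail ends h)) ∧
      (∀ h < j, t.mem (slot (base m) 3 h) = last (tail ends) h (tail ends h))) s
    ⟨(Agree.refl _ _ _ _).setReg (by simp) _, fun v _ => h0 0 v, fun v _ => h0 1 v,
      fun h hh => absurd hh (Nat.not_lt_zero _), fun h hh => absurd hh (Nat.not_lt_zero _)⟩
    (fun j t ht => by
      have hr := h.agree ht.1 (by decide)
      simp [fits_mul, fits_const, fits_reg, exact_const, exact_reg, exact_mul, hr.reg5]
      omega)
    (by
      rintro j t hj hrj ⟨ha, h1, h2, h3, h4⟩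
      have hr := h.agree ha (by decide)
      have hin := hr.input j hj
      have htl := tail_lt (ends := ends) hj
      have hc := h1 _ htl
      have hcl := count_le (tail ends) j (tail ends j)
      have hex : (Stmt.seq (.assign 11 (.load (reg[10] + num[2]))) (
          .seq (.store (addr 2 reg[10]) (fld 0 reg[11])) (
          .seq (.store (addr 0 reg[11]) (fld 0 reg[11] + num[1])) (
          .seq (.store (addr 3 reg[10]) (fld 1 reg[11]))
            (.store (addr 1 reg[11]) (reg[10] + num[1])))))).exec t =
          ((((t.setReg 11 (tail ends j)).setMem (slot (base m) 2 j)
            (t.mem (slot (base m) 0 (tail ends j)))).setMem (slot (base m) 0 (tail ends j))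
            (t.mem (slot (base m) 0 (tail ends j)) + 1)).setMem (slot (base m) 3 j)
            (t.mem (slot (base m) 1 (tail ends j)))).setMem (slot (base m) 1 (tail ends j))
            (j + 1) := by
        simp [Stmt.exec, exact_add, exact_const, exact_reg, exact_load, exact_addr, exact_fld,
          setReg_reg, setMem_mem, slot_inj, hr.reg6, hrj, hin]
      refine ⟨?_, ?_, ?_, ?_, ?_, ?_, ?_⟩
      · simp [Stmt.Fits, Stmt.exec, exact_add, exact_const, exact_reg, exact_load, exact_addr,
          exact_fld, setReg_reg, setMem_mem, slot_inj, hr.reg6, hrj, hin, fits_add, fits_const,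
          fits_reg, fits_load, fits_addr, fits_fld, hc]
        simp [slot, base]
        have := wordLength_ne_zero hw
        omega
      · rw [hex]
        simp [setReg_reg, hrj]
      · rw [hex]
        refine Agree.setReg (Agree.setMem (Agree.setMem (Agree.setMem (Agree.setMem
          (Agree.setReg ha ?_ _) ?_ _ _) ?_ _ _) ?_ _ _) ?_ _ _) ?_ _ <;> simp
      · intro v hv
        rw [hex]
        simp [setMem_mem, slot_inj, count]
        by_cases hv' : v = tail ends j
        · simp [hv', hc]
        · rw [if_neg hv', if_neg (Ne.symm hv'), h1 v hv]
      · intro v hv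
        rw [hex]
        simp [setMem_mem, slot_inj, last]
        by_cases hv' : v = tail ends j
        · simp [hv']
        · rw [if_neg hv', if_neg (Ne.symm hv'), h2 v hv]
      · intro h hh
        rw [hex]
        simp [setMem_mem, slot_inj]
        by_cases hv' : h = j
        · rw [if_pos hv', hv', hc]
        · rw [if_neg hv', h3 h (by omega)]
      · intro h hh
        rw [hex]
        simp [setMem_mem, slot_inj]
        by_cases hv' : h = j
        · rw [if_pos hv', hv', h2 _ htl]
        · rw [if_neg hv', h4 h (by omega)])
  exact ⟨s', hd.mono (by simp only [Stmt.cost]; omega), hI⟩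

theorem det_findMinDegree (hw : 100 * (n + m + 1) ≤ 2 ^ w) (s : State) (h : Ready ends s)
    (hdeg : ∀ v < n, s.mem (slot (base m) 0 v) < n) (hn : 0 < n) :
    ∃ s', Det w findMinDegree s (10 * n + 10) s' ∧ Agree (base m) [] [7, 10] s s' ∧
      (∀ v < n, s'.reg 7 ≤ s.mem (slot (base m) 0 v)) ∧
      ∃ v < n, s'.reg 7 = s.mem (slot (base m) 0 v) := by
  have hd0 := det_exec (w := w) (by omega) (.assign 7 reg[4]) rfl s trivial
  obtain ⟨s', hd, -, hI⟩ := det_forUpTo (w := w) (by omega) (i := 10) (N := n)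
    (e := reg[4])
    (p := .ite (.op .lt (fld 0 reg[10]) reg[7]) (.assign 7 (fld 0 reg[10])) .skip) rfl (by omega)
    (fun j t => Agree (base m) [] [7, 10] s t ∧
      (∀ v < j, t.reg 7 ≤ s.mem (slot (base m) 0 v)) ∧
      -- Before the first vertex the register holds `n`, which exceeds every degree and is replaced
      -- at once.
      ((∃ v < n, t.reg 7 = s.mem (slot (base m) 0 v)) ∨ (t.reg 7 = n ∧ j = 0)))
    ((Stmt.assign 7 reg[4]).exec s)
    ⟨((Agree.refl _ _ _ _).setReg (by simp) _).setReg (by simp) _,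
      fun h hh => absurd hh (Nat.not_lt_zero _), Or.inr ⟨by
        simp [Stmt.exec, setReg_reg, exact_reg, h.reg4], rfl⟩⟩
    (fun j t ht => by
      have hr := h.agree ht.1 (by decide)
      simp [fits_reg, exact_reg, hr.reg4])
    (by
      rintro j t hj hrj ⟨ha, h1, h2⟩
      have hr := h.agree ha (by decide)
      have h0 := ha.slot (j := 0) (by simp) j
      have hlt := hdeg j hj
      have hex : (Stmt.ite (.op .lt (fld 0 reg[10]) reg[7]) (.assign 7 (fld 0 reg[10])) .skip).exec
          t = if s.mem (slot (base m) 0 j) < t.reg 7 then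
            t.setReg 7 (s.mem (slot (base m) 0 j)) else t := by
        simp [Stmt.exec, exact_reg, exact_lt, exact_fld, hr.reg6, hrj, h0]
      refine ⟨?_, ?_, ?_, ?_, ?_⟩
      · simp [Stmt.Fits, exact_reg, exact_lt, exact_fld, hr.reg6, hrj, h0, fits_lt, fits_fld,
          fits_reg]
        simp [slot, base]
        omega
      · rw [hex]
        split_ifs <;> simp [setReg_reg, hrj]
      · rw [hex]
        split_ifs
        · exact (ha.setReg (by simp) _).setReg (by simp) _
        · exact ha.setReg (by simp) _
      · intro v hv
        rw [hex]
        by_cases hvj : v = j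
        · subst hvj
          split_ifs with hc
          · simp [setReg_reg]
          · simpa [setReg_reg] using hc
        · have := h1 v (by omega)
          split_ifs with hc
          · simp [setReg_reg]
            omega
          · simpa [setReg_reg] using this
      · rw [hex]
        left
        split_ifs with hc
        · exact ⟨j, hj, by simp [setReg_reg]⟩
        · rcases h2 with ⟨v, hv, hv'⟩ | ⟨h2, h3⟩
          · exact ⟨v, hv, by simpa [setReg_reg] using hv'⟩
          · omega)
  refine ⟨s', (hd0.seq hd).mono (by simp only [Stmt.cost]; omega), hI.1, hI.2.1, ?_⟩
  rcases hI.2.2 with h | h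
  · exact h
  · omega

theorem det_countRounds (hw : 100 * (n + m + 1) ≤ 2 ^ w) (s : State) (h : Ready ends s) (A : ℕ)
    (hA : A * (Nat.size n + 1) < 2 ^ w) :
    ∃ s', Det w (countRounds A) s (10 * Nat.size n + 10) s' ∧ Agree (base m) [] [8, 10] s s' ∧
      s'.reg 8 = A * Nat.size n := by
  have hd0 := det_exec (w := w) (by omega) (.assign 8 num[0]) rfl s (by change 0 < 2 ^ w; omega)
  have hd1 := det_exec (w := w) (by omega) (.assign 10 reg[4]) rfl
    ((Stmt.assign 8 num[0]).exec s) trivial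
  obtain ⟨s', hd, ⟨ha, hle, h8⟩, hend⟩ := det_loop (w := w) (e := reg[10])
    (p := .seq (.assign 10 (reg[10] / num[2])) (.assign 8 (reg[8] + num[A]))) (c := 3)
    (fun t => Agree (base m) [] [8, 10] s t ∧ t.reg 10 ≤ n ∧
      t.reg 8 + A * Nat.size (t.reg 10) = A * Nat.size n) (fun t => Nat.size (t.reg 10)) (by
      rintro t ⟨ha, hle, h8⟩ hne
      change t.reg 10 ≠ 0 at hne
      have hsz : Nat.size (t.reg 10) = Nat.size (t.reg 10 / 2) + 1 := by
        conv_lhs => rw [← Nat.bit_testBit_zero_shiftRight_one (t.reg 10)]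
        rw [Nat.size_bit, Nat.shiftRight_one]
        rwa [Nat.bit_testBit_zero_shiftRight_one]
      have hAA : A * (Nat.size n + 1) = A * Nat.size n + A := by ring
      rw [hsz, mul_add, mul_one] at h8
      refine ⟨_, det_exec (by omega) _ rfl t ?_, ?_, ?_⟩
      · simp [Stmt.Fits, Stmt.exec, exact_const, exact_reg, exact_div, setReg_reg,
          fits_add, fits_const, fits_reg, fits_div]
        omega
      · simp [Stmt.exec, exact_add, exact_const, exact_reg, exact_div, setReg_reg]
        exact ⟨(ha.setReg (by simp) _).setReg (by simp) _, by omega, by omega⟩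
      · simp [Stmt.exec, exact_add, exact_const, exact_reg, exact_div, setReg_reg]
        omega)
    ((Stmt.assign 10 reg[4]).exec ((Stmt.assign 8 num[0]).exec s))
    ⟨((Agree.refl _ _ _ _).setReg (by simp) _).setReg (by simp) _, by
      simp [Stmt.exec, exact_const, exact_reg, setReg_reg, h.reg4], by
      simp [Stmt.exec, exact_const, exact_reg, setReg_reg, h.reg4]⟩
  refine ⟨s', (hd0.seq (hd1.seq hd)).mono ?_, ha, ?_⟩
  · simp only [Stmt.cost]
    simp [Stmt.exec, exact_const, exact_reg, setReg_reg, h.reg4]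
    omega
  · change s'.reg 10 = 0 at hend
    rw [hend] at h8
    simpa using h8

end deterministic

end MinCut

/-! ### Correctness and running time of the component search on the machine -/

namespace MinCut

open WordRAM

/-- The set of the marked edges. -/
def markSet {n m : ℕ} (ends : Fin m → Fin n × Fin n) (mk : ℕ → Prop) : Set (Sym2 (Fin n)) :=
  {x | ∃ e : Fin m, mk e ∧ x = edge ends e}

/-- The labels are `1, …, k`, with `k` in register `0`; equality of labels is connectedness by
marked edges. -/
structure Labelled {n m : ℕ} (ends : Fin m → Fin n × Fin n) (mk : ℕ → Prop) (s : State) :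
    Prop where
  pos : ∀ v < n, 1 ≤ s.mem (slot (base m) 7 v)
  le : ∀ v < n, s.mem (slot (base m) 7 v) ≤ s.reg 0
  surj : ∀ j, 1 ≤ j → j ≤ s.reg 0 → ∃ v < n, s.mem (slot (base m) 7 v) = j
  le_card : s.reg 0 ≤ n
  eq_iff : ∀ u v : Fin n, s.mem (slot (base m) 7 u) = s.mem (slot (base m) 7 v) ↔
    (SimpleGraph.fromEdgeSet (markSet ends mk)).Reachable u v

section

variable {n m : ℕ} {ends : Fin m → Fin n × Fin n} {w : ℕ}

/-- The invariant of the search loop. -/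
def SearchInv (ends : Fin m → Fin n × Fin n) (E : ℕ → ℕ → Prop) (s t : State) : Prop :=
  Agree (base m) [7, 8] [0, 10, 11, 12, 13, 14, 15, 16] s t ∧
    Search n (2 * m) (tail ends) (head ends) E (fun h => s.mem (slot (base m) 6 (h / 2)) ≠ 0)
      (fun v => t.mem (slot (base m) 7 v)) (fun i => t.mem (slot (base m) 8 i))
      (t.reg 0) (t.reg 10) (t.reg 11) (t.reg 12) (t.reg 13)

/-- The measure of the search loop. -/
noncomputable def searchMeasure (ends : Fin m → Fin n × Fin n) (t : State) : ℕ :=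
  remaining n (2 * m) (tail ends) (fun i => t.mem (slot (base m) 8 i)) (t.reg 10) (t.reg 11)
    (t.reg 13)

theorem exists_rev {s : State} {h : ℕ} (hh : h < 2 * m)
    (hm : s.mem (slot (base m) 6 (h / 2)) ≠ 0) :
    ∃ h' < 2 * m, s.mem (slot (base m) 6 (h' / 2)) ≠ 0 ∧ tail ends h' = head ends h ∧
      head ends h' = tail ends h := by
  obtain ⟨e, rfl | rfl⟩ := halfEdge_cases hh
  · refine ⟨2 * e + 1, by have := e.2; omega, ?_, ?_, ?_⟩
    · rwa [show (2 * (e : ℕ) + 1) / 2 = 2 * e / 2 by omega]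
    · rw [tail_odd, head_even]
    · rw [head_odd, tail_even]
  · refine ⟨2 * e, by have := e.2; omega, ?_, ?_, ?_⟩
    · rwa [show 2 * (e : ℕ) / 2 = (2 * e + 1) / 2 by omega]
    · rw [tail_even, head_odd]
    · rw [head_even, tail_odd]

/-- Each branch of `searchStep` realises one of the abstract moves `Search.pop`, `Search.newRoot`,
`Search.oldRoot`, `Search.scan`, or `Search.label` followed by `Search.scan`, and each of them
decreases the measure. -/
theorem det_searchStep (hw : 100 * (n + m + 1) ≤ 2 ^ w) {d q : ℕ} {s : State}
    (hs : Prepared ends d q s) {E : ℕ → ℕ → Prop} (hE : Equivalence E)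
    (hmkE : ∀ h < 2 * m, s.mem (slot (base m) 6 (h / 2)) ≠ 0 → E (tail ends h) (head ends h))
    (t : State) (ht : SearchInv ends E s t)
    (hc : t.reg 13 ≠ 0 ∨ t.reg 11 < t.reg 12 ∨ t.reg 10 < n) :
    ∃ t', Det w searchStep t searchStep.cost t' ∧ SearchInv ends E s t' ∧
      searchMeasure ends t' < searchMeasure ends t := by
  obtain ⟨ha, S⟩ := ht
  have hp := hs.agree ha (by decide) (by decide)
  have hw0 := wordLength_ne_zero hw
  have hqt := S.qt_le
  have hrev := fun h hh hm => exists_rev (ends := ends) (s := s) (h := h) hh hm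
  have hmk : ∀ i, t.mem (slot (base m) 6 i) = s.mem (slot (base m) 6 i) := ha.slot (by decide)
  have hag : ∀ t', Agree (base m) [7, 8] [0, 10, 11, 12, 13, 14, 15, 16] t t' →
      Agree (base m) [7, 8] [0, 10, 11, 12, 13, 14, 15, 16] s t' := fun t' h =>
    ha.trans h (by simp) (by simp) (by simp) (by simp)
  by_cases h13 : t.reg 13 = 0
  · rw [h13] at S
    by_cases hq : t.reg 11 < t.reg 12
    · -- a vertex is taken out of the queue
      have hu := S.queue_lt _ hq
      have hf := hp.first _ hu
      have hex : searchStep.exec t = ((t.setReg 14 (t.mem (slot (base m) 8 (t.reg 11)))).setReg 13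
          (last (tail ends) (2 * m) (t.mem (slot (base m) 8 (t.reg 11))))).setReg 11
          (t.reg 11 + 1) := by
        simp [searchStep, Stmt.exec, exact_add, exact_const, exact_reg, exact_fld, exact_lt,
          setReg_reg, hp.reg6, h13, hq, hf]
      refine ⟨_, det_exec (by omega) _ rfl t ?_, ?_⟩
      · simp [searchStep, Stmt.Fits, Stmt.exec, exact_const, exact_reg, exact_fld, exact_lt,
          setReg_reg, hp.reg6, h13, hq, fits_add, fits_const, fits_reg, fits_lt, fits_fld]
        simp [slot, base] at hu ⊢
        omega
      · rw [hex]
        refine ⟨⟨hag _ ?_, ?_⟩, ?_⟩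
        · refine Agree.setReg (Agree.setReg (Agree.setReg (Agree.refl _ _ _ _) ?_ _) ?_ _) ?_ _ <;>
            simp
        · simpa [setReg_reg] using S.pop hq
        · have := remaining_pop S hq
          simpa [searchMeasure, setReg_reg, h13] using this
    · -- the next root
      have hr : t.reg 10 < n := by
        rcases hc with h | h | h
        · exact absurd h13 h
        · exact absurd h hq
        · exact h
      have hqq : t.reg 12 = t.reg 11 := by have := S.qh_le; omega
      have hkl := S.k_le
      by_cases h0 : t.mem (slot (base m) 7 (t.reg 10)) = 0
      · have hex : searchStep.exec t = (((((t.setReg 0 (t.reg 0 + 1)).setMem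
            (slot (base m) 7 (t.reg 10)) (t.reg 0 + 1)).setMem (slot (base m) 8 (t.reg 12))
            (t.reg 10)).setReg 12 (t.reg 12 + 1))).setReg 10 (t.reg 10 + 1) := by
          simp [searchStep, Stmt.exec, exact_add, exact_const, exact_reg, exact_fld, exact_lt,
            setReg_reg, hp.reg6, h13, hq, h0, exact_addr]
        refine ⟨_, det_exec (by omega) _ rfl t ?_, ?_⟩
        · simp [searchStep, Stmt.Fits, Stmt.exec, exact_add, exact_const, exact_reg, exact_fld, exact_lt,
            setReg_reg, hp.reg6, h13, hq, h0, fits_add, fits_const, fits_reg, fits_lt, fits_fld,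
            exact_addr, fits_addr]
          simp [slot, base]
          omega
        · rw [hex]
          refine ⟨⟨hag _ ?_, ?_⟩, ?_⟩
          · refine Agree.setReg (Agree.setReg (Agree.setMem (Agree.setMem (Agree.setReg
              (Agree.refl _ _ _ _) ?_ _) ?_ _ _) ?_ _ _) ?_ _) ?_ _ <;> simp
          · rw [hqq] at S
            have h1 := S.newRoot hr hE h0
            simp only [setReg_reg, setReg_mem, setMem_reg, setMem_mem, slot_inj]
            convert h1 using 1
            all_goals first
              | (funext v; simp [Function.update_apply, hqq])
              | simp [hqq, h13]
          · have h1 := remaining_root (n := n) (N := 2 * m) (tl := tail ends)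
              (queue := fun i => t.mem (slot (base m) 8 i)) (qh := t.reg 11) (p := 0) hr
            unfold searchMeasure
            rw [h13]
            refine lt_of_eq_of_lt ?_ h1
            simp only [setReg_reg, setReg_mem, setMem_reg, setMem_mem, slot_inj]
            simp only [h13]
            refine remaining_congr fun i hi => ?_
            simp at hi
            rw [if_neg (by omega)]
            simp
      · have hex : searchStep.exec t = t.setReg 10 (t.reg 10 + 1) := by
          simp [searchStep, Stmt.exec, exact_add, exact_const, exact_reg, exact_fld, exact_lt,
            hp.reg6, h13, hq, h0]
        refine ⟨_, det_exec (by omega) _ rfl t ?_, ?_⟩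
        · simp [searchStep, Stmt.Fits, Stmt.exec, exact_reg, exact_fld, exact_lt,
            hp.reg6, h13, hq, h0, fits_add, fits_const, fits_reg, fits_lt, fits_fld, exact_const]
          simp [slot, base]
          omega
        · rw [hex]
          refine ⟨⟨hag _ ?_, ?_⟩, ?_⟩
          · exact (Agree.refl _ _ _ _).setReg (by simp) _
          · simpa [setReg_reg, h13] using S.oldRoot hr h0
          · have h1 := remaining_root (n := n) (N := 2 * m) (tl := tail ends)
              (queue := fun i => t.mem (slot (base m) 8 i)) (qh := t.reg 11) (p := 0) hr
            simpa [searchMeasure, setReg_reg, h13] using h1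
  · -- a half-edge is scanned
    obtain ⟨hqh, hpN, htlp, hlabp⟩ := S.cur h13
    have hpl : t.reg 13 - 1 < 2 * m := by omega
    set h := t.reg 13 - 1 with hh
    have htl := tail_lt (ends := ends) hpl
    have hhd := head_lt (ends := ends) hpl
    have hin1 := hp.input h hpl
    have hin2 : t.mem (h + 3 - 2 * (h % 2)) = head ends h := by
      rw [head, ← hp.input (h + 1 - 2 * (h % 2)) (by omega)]
      congr 1
      omega
    have hnext := hp.next h hpl
    have hmh := hmk (h / 2)
    have hqh' := S.qh_le
    have hms := remaining_scan S h13
    by_cases hcase : s.mem (slot (base m) 6 (h / 2)) ≠ 0 ∧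
        t.mem (slot (base m) 7 (head ends h)) = 0
    · obtain ⟨hmark, h0⟩ := hcase
      have hex : searchStep.exec t = ((((((t.setReg 16 h).setReg 14 (tail ends h)).setReg 15
          (head ends h)).setMem (slot (base m) 7 (head ends h))
          (t.mem (slot (base m) 7 (tail ends h)))).setMem (slot (base m) 8 (t.reg 12))
          (head ends h)).setReg 12 (t.reg 12 + 1)).setReg 13
          (last (tail ends) h (tail ends h)) := by
        simp [searchStep, Stmt.exec, exact_add, exact_const, exact_reg, exact_fld,
          setReg_reg, hp.reg6, h13, h0, exact_addr, exact_sub, exact_mul, exact_mod, exact_div,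
          exact_load, ← hh, hin1, hin2, hmh, hmark, setMem_mem, slot_inj, hnext]
      refine ⟨_, det_exec (by omega) _ rfl t ?_, ?_⟩
      · simp [searchStep, Stmt.Fits, Stmt.exec, exact_add, exact_const, exact_reg, exact_fld,
          setReg_reg, hp.reg6, h13, h0, exact_addr, exact_sub, exact_mul, exact_mod, exact_div,
          exact_load, ← hh, hin1, hin2, hmh, hmark, fits_add, fits_const,
          fits_reg, fits_fld, fits_addr, fits_sub, fits_mul, fits_mod, fits_div, fits_load]
        simp [slot, base]
        omega
      · rw [hex]
        have S1 := S.label hE (fun h hh => tail_lt hh) (fun h hh => head_lt hh) hmkE h13 hmark h0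
        rw [← hh] at S1
        have S2 := S1.scan hrev (fun h hh => head_lt hh) h13 (fun _ => by
          rw [← hh, Function.update_self, htlp, hlabp]
          have := S.queue_lab (t.reg 11 - 1) (by omega)
          rwa [hlabp] at this)
        rw [← hh] at S2
        refine ⟨⟨hag _ ?_, ?_⟩, ?_⟩
        · refine Agree.setReg (Agree.setReg (Agree.setMem (Agree.setMem (Agree.setReg (Agree.setReg
            (Agree.setReg (Agree.refl _ _ _ _) ?_ _) ?_ _) ?_ _) ?_ _ _) ?_ _ _) ?_ _) ?_ _ <;> simp
        · simp only [setReg_reg, setReg_mem, setMem_reg, setMem_mem, slot_inj]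
          convert S2 using 1
          all_goals first
            | (funext v; simp [Function.update_apply])
            | simp
        · refine lt_of_eq_of_lt ?_ hms
          unfold searchMeasure
          simp only [setReg_reg, setReg_mem, setMem_reg, setMem_mem, slot_inj]
          refine remaining_congr fun i hi => ?_
          simp at hi
          rw [if_neg (by omega)]
          simp
    · have hex : searchStep.exec t = (((t.setReg 16 h).setReg 14 (tail ends h)).setReg 15
          (head ends h)).setReg 13 (last (tail ends) h (tail ends h)) := by
        by_cases hmark : s.mem (slot (base m) 6 (h / 2)) = 0
        · simp [searchStep, Stmt.exec, exact_add, exact_const, exact_reg, exact_fld,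
            setReg_reg, hp.reg6, h13, exact_sub, exact_mul, exact_mod, exact_div,
            exact_load, ← hh, hin1, hin2, hmh, hmark, hnext]
        · have h0 : t.mem (slot (base m) 7 (head ends h)) ≠ 0 := fun h' => hcase ⟨hmark, h'⟩
          simp [searchStep, Stmt.exec, exact_add, exact_const, exact_reg, exact_fld,
            setReg_reg, hp.reg6, h13, h0, exact_sub, exact_mul, exact_mod, exact_div,
            exact_load, ← hh, hin1, hin2, hmh, hmark, hnext]
      refine ⟨_, det_exec (by omega) _ rfl t ?_, ?_⟩
      · by_cases hmark : s.mem (slot (base m) 6 (h / 2)) = 0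
        · simp [searchStep, Stmt.Fits, Stmt.exec, exact_add, exact_const, exact_reg, exact_fld,
            setReg_reg, hp.reg6, h13, exact_sub, exact_mul, exact_mod, exact_div,
            exact_load, ← hh, hmh, hmark, fits_add, fits_const,
            fits_reg, fits_fld, fits_sub, fits_mul, fits_mod, fits_div, fits_load]
          simp [slot, base]
          omega
        · have h0 : t.mem (slot (base m) 7 (head ends h)) ≠ 0 := fun h' => hcase ⟨hmark, h'⟩
          simp [searchStep, Stmt.Fits, Stmt.exec, exact_add, exact_const, exact_reg, exact_fld,
            setReg_reg, hp.reg6, h13, h0, exact_sub, exact_mul, exact_mod, exact_div,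
            exact_load, ← hh, hin1, hin2, hmh, hmark, fits_add, fits_const,
            fits_reg, fits_fld, fits_sub, fits_mul, fits_mod, fits_div, fits_load]
          simp [slot, base]
          omega
      · rw [hex]
        have S2 := S.scan hrev (fun h hh => head_lt hh) h13 (fun hmark h0 => hcase ⟨hmark, h0⟩)
        rw [← hh] at S2
        refine ⟨⟨hag _ ?_, ?_⟩, ?_⟩
        · refine Agree.setReg (Agree.setReg (Agree.setReg (Agree.setReg
            (Agree.refl _ _ _ _) ?_ _) ?_ _) ?_ _) ?_ _ <;> simp
        · simpa [setReg_reg] using S2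
        · refine lt_of_eq_of_lt ?_ hms
          simp [searchMeasure, setReg_reg, ← hh]

theorem det_findComponents (hw : 100 * (n + m + 1) ≤ 2 ^ w) {d q : ℕ} {s : State}
    (hs : Prepared ends d q s) :
    ∃ s', Det w findComponents s (200 * (n + m + 1)) s' ∧
      Agree (base m) [7, 8] [0, 10, 11, 12, 13, 14, 15, 16] s s' ∧
      Labelled ends (fun e => s.mem (slot (base m) 6 e) ≠ 0) s' := by
  have hw0 := wordLength_ne_zero hw
  obtain ⟨s₁, hd₁, -, ha₁, hz⟩ := det_forUpTo (w := w) (by omega) (i := 10) (N := n)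
    (e := reg[4]) (p := .store (addr 7 reg[10]) num[0]) rfl (by omega)
    (fun j t => Agree (base m) [7, 8] [0, 10, 11, 12, 13, 14, 15, 16] s t ∧
      ∀ v < j, t.mem (slot (base m) 7 v) = 0) s
    ⟨(Agree.refl _ _ _ _).setReg (by simp) _, fun v hv => absurd hv (Nat.not_lt_zero _)⟩
    (fun j t ht => by
      have hr := hs.agree ht.1 (by decide) (by decide)
      simp [fits_reg, exact_reg, hr.reg4])
    (by
      rintro j t hj hrj ⟨ha, hz⟩
      have hr := hs.agree ha (by decide) (by decide)
      have hex : (Stmt.store (addr 7 reg[10]) num[0]).exec t =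
          t.setMem (slot (base m) 7 j) 0 := by
        simp [Stmt.exec, exact_addr, exact_reg, exact_const, hr.reg6, hrj]
      refine ⟨?_, ?_, ?_, ?_⟩
      · simp [Stmt.Fits, fits_addr, fits_const, fits_reg, exact_reg, hr.reg6, hrj]
        simp [slot, base]
        omega
      · rw [hex]
        simpa using hrj
      · rw [hex]
        exact (ha.setMem (by simp) _ _).setReg (by simp) _
      · intro v hv
        rw [hex]
        simp only [setReg_mem, setMem_mem, slot_inj, true_and]
        split_ifs with hvj
        · rfl
        · exact hz v (by omega))
  set p₂ : Stmt := .seq (.assign 0 num[0]) (.seq (.assign 10 num[0]) (.seq (.assign 11 num[0])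
    (.seq (.assign 12 num[0]) (.assign 13 num[0])))) with hp₂
  have hex₂ : p₂.exec s₁ = ((((s₁.setReg 0 0).setReg 10 0).setReg 11 0).setReg 12 0).setReg 13 0 :=
    rfl
  have hd₂ := det_exec (w := w) (by omega) p₂ rfl s₁
    (by simp [hp₂, Stmt.Fits, fits_const])
  rw [hex₂] at hd₂
  set s₂ := ((((s₁.setReg 0 0).setReg 10 0).setReg 11 0).setReg 12 0).setReg 13 0 with hs₂
  have ha₂ : Agree (base m) [7, 8] [0, 10, 11, 12, 13, 14, 15, 16] s s₂ := by
    refine Agree.setReg (Agree.setReg (Agree.setReg (Agree.setReg (Agree.setReg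
      ha₁ ?_ _) ?_ _) ?_ _) ?_ _) ?_ _ <;> simp
  set mk : ℕ → Prop := fun e => s.mem (slot (base m) 6 e) ≠ 0 with hmkdef
  -- The equivalence for the search is the kernel of the map to the nodes. The value `none` at
  -- numbers that are no vertices makes it an equivalence on all of `ℕ` without side conditions.
  set f : ℕ → Option (Node (markSet ends mk)) := fun v =>
    if h : v < n then some (node (markSet ends mk) ⟨v, h⟩) else none with hf
  set E : ℕ → ℕ → Prop := fun u v => f u = f v with hEdef
  have hE : Equivalence E := ⟨fun _ => rfl, fun h => h.symm, fun h h' => h.trans h'⟩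
  have hfin : ∀ v : Fin n, f v = some (node (markSet ends mk) v) := fun v => by
    simp [hf]
  have hmkE : ∀ h < 2 * m, s.mem (slot (base m) 6 (h / 2)) ≠ 0 → E (tail ends h) (head ends h) := by
    intro h hh hm
    have key : ∀ e : Fin m, mk e → f (ends e).1 = f (ends e).2 := by
      intro e he
      rw [hfin, hfin, Option.some_inj, node_eq_iff]
      exact reachable_of_mem _ ⟨e, he, rfl⟩
    obtain ⟨e, rfl | rfl⟩ := halfEdge_cases hh
    · rw [show 2 * (e : ℕ) / 2 = e by omega] at hm
      change f _ = f _
      rw [tail_even, head_even]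
      exact key e hm
    · rw [show (2 * (e : ℕ) + 1) / 2 = e by omega] at hm
      change f _ = f _
      rw [tail_odd, head_odd]
      exact (key e hm).symm
  -- The sum vanishes only if no half-edge, no queued vertex and no root is left. It cannot overflow
  -- because the cursor is at most `2 * m`.
  have hcond : ∀ t, SearchInv ends E s t →
      (reg[13] + .op .lt reg[11] reg[12] + .op .lt reg[10] reg[4] : Expr).eval w t =
        t.reg 13 + (if t.reg 11 < t.reg 12 then 1 else 0) + (if t.reg 10 < n then 1 else 0) := by
    rintro t ⟨ha, S⟩
    have hr := hs.agree ha (by decide) (by decide)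
    have hp13 : t.reg 13 ≤ 2 * m := by
      by_cases h : t.reg 13 = 0
      · omega
      · exact (S.cur h).2.1
    rw [Expr.eval_eq (by omega)]
    · change t.reg 13 + (if t.reg 11 < t.reg 12 then 1 else 0) +
        (if t.reg 10 < t.reg 4 then 1 else 0) = _
      rw [hr.reg4]
    · have h1 : t.reg 13 + (if t.reg 11 < t.reg 12 then 1 else 0) < 2 ^ w := by
        split_ifs <;> omega
      have h2 : t.reg 13 + (if t.reg 11 < t.reg 12 then 1 else 0) +
          (if t.reg 10 < t.reg 4 then 1 else 0) < 2 ^ w := by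
        split_ifs <;> omega
      exact ⟨⟨trivial, ⟨trivial, trivial, trivial⟩, h1⟩, ⟨trivial, trivial, trivial⟩, h2⟩
  obtain ⟨s₃, hd₃, ⟨ha₃, S⟩, hend⟩ := det_loop (w := w)
    (e := reg[13] + .op .lt reg[11] reg[12] + .op .lt reg[10] reg[4]) (p := searchStep)
    (c := searchStep.cost) (SearchInv ends E s) (searchMeasure ends) (by
      intro t ht hne
      rw [hcond t ht] at hne
      refine det_searchStep hw hs hE hmkE t ht ?_
      by_contra hcon
      rw [not_or, not_or] at hcon
      rw [if_neg hcon.2.1, if_neg hcon.2.2, not_not.1 hcon.1] at hne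
      exact hne rfl) s₂ ⟨ha₂, by
        have := Search.init (n := n) (N := 2 * m) (tl := tail ends) (hd := head ends) (E := E)
          (mk := fun h => s.mem (slot (base m) 6 (h / 2)) ≠ 0)
          (queue := fun i => s₂.mem (slot (base m) 8 i))
        exact this.congr (fun h hh => head_lt hh) hz (fun i hi => rfl)⟩
  have hlast := hcond s₃ ⟨ha₃, S⟩
  rw [hend] at hlast
  have h13 : s₃.reg 13 = 0 := by omega
  have h12 : s₃.reg 12 = s₃.reg 11 := by
    have := S.qh_le
    split_ifs at hlast
    omega
  have h10 : s₃.reg 10 = n := by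
    have := S.root_le
    split_ifs at hlast
    omega
  rw [h13, h12, h10] at S
  refine ⟨s₃, ((hd₁.seq (hd₂.seq hd₃)).mono ?_), ha₃, ?_, S.lab_le, S.surj, S.k_le, ?_⟩
  · have h1 : searchMeasure ends s₂ ≤ 2 * n + 2 * m := remaining_le
    have h2 : (searchStep.cost + 1) * searchMeasure ends s₂ ≤
        (searchStep.cost + 1) * (2 * n + 2 * m) := Nat.mul_le_mul_left _ h1
    have h3 : searchStep.cost = 35 := rfl
    have h4 : p₂.cost = 9 := rfl
    have h5 : (Stmt.store (addr 7 reg[10]) num[0]).cost = 1 := rfl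
    rw [h4, h5]
    rw [h3] at h2 ⊢
    omega
  · intro v hv
    exact Nat.one_le_iff_ne_zero.2 (S.lab_root v hv)
  · intro u v
    constructor
    · intro h
      have := S.sound u u.2 v v.2 h (S.lab_root u u.2)
      change f u = f v at this
      rw [hfin, hfin, Option.some_inj, node_eq_iff] at this
      exact this
    · intro h
      -- The vertices with the label of `u` are closed under marked edges, since all half-edges have
      -- been scanned.
      refine mem_of_reachable (S := {x : Fin n | s₃.mem (slot (base m) 7 u) =
        s₃.mem (slot (base m) 7 x)}) ?_ h rfl
      intro a b hab hau
      rw [SimpleGraph.fromEdgeSet_adj] at hab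
      obtain ⟨⟨e, he, hab⟩, -⟩ := hab
      have h1 := S.eq_of_mk (fun h hh => tail_lt hh) (h := 2 * e) (by have := e.2; omega)
        (by rwa [show 2 * (e : ℕ) / 2 = e by omega])
      rw [tail_even, head_even] at h1
      refine Eq.trans hau ?_
      rcases Sym2.eq_iff.1 hab with ⟨rfl, rfl⟩ | ⟨rfl, rfl⟩
      · exact h1
      · exact h1.symm

end

end MinCut

/-! ### Marking the sample, counting the crossing edges, and voting on the machine -/

namespace MinCut

open WordRAM

section

variable {n m : ℕ} {ends : Fin m → Fin n × Fin n} {w : ℕ}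

/-- The edge `e` is sampled in a round with the random numbers `ω`. -/
def Sampled (ends : Fin m → Fin n × Fin n) (ω : ℕ → ℕ) (e : ℕ) : Prop :=
  ω (2 * n + e) = 0 ∨ ∃ h, (h = 2 * e ∨ h = 2 * e + 1) ∧ ∃ i, i / 2 = tail ends h ∧
    count (tail ends) h (tail ends h) = ω i

theorem exists_half {a : ℕ} {P : ℕ → Prop} : (∃ i, i / 2 = a ∧ P i) ↔ P (2 * a) ∨ P (2 * a + 1) := by
  constructor
  · rintro ⟨i, rfl, h⟩
    rcases Nat.even_or_odd' i with ⟨k, rfl | rfl⟩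
    · left; rwa [show 2 * k / 2 = k by omega]
    · right; rwa [show (2 * k + 1) / 2 = k by omega]
  · rintro (h | h)
    · exact ⟨_, by omega, h⟩
    · exact ⟨_, by omega, h⟩

theorem det_markSample (hw : 100 * (n + m + 1) ≤ 2 ^ w) {d q : ℕ} {s : State}
    (hs : Prepared ends d q s) :
    ∃ s', Det w markSample s (100 * m + 3) s' ∧
      Agree (base m) [6] [10, 11, 12, 13, 14, 15] s s' ∧
      ∀ e < m, s'.mem (slot (base m) 6 e) ≠ 0 ↔
        Sampled ends (fun i => s.mem (slot (base m) 5 i)) e := by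
  have hw0 := wordLength_ne_zero hw
  obtain ⟨s', hd, -, hI⟩ := det_forUpTo (w := w) (by omega) (i := 10) (N := m)
    (e := reg[5]) (p := markBody) rfl (by omega)
    (fun j t => Agree (base m) [6] [10, 11, 12, 13, 14, 15] s t ∧
      ∀ e < j, t.mem (slot (base m) 6 e) ≠ 0 ↔
        Sampled ends (fun i => s.mem (slot (base m) 5 i)) e) s
    ⟨(Agree.refl _ _ _ _).setReg (by simp) _, fun h hh => absurd hh (Nat.not_lt_zero _)⟩
    (fun j t ht => by
      have hr := hs.agree ht.1 (by decide) (by decide)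
      exact ⟨trivial, hr.reg5⟩)
    (by
      rintro j t hj hrj ⟨ha, h1⟩
      have hr := hs.agree ha (by decide) (by decide)
      have hin1 := even_input hr.toReady hj
      have hin2 := odd_input hr.toReady hj
      have htl1 := tail_lt (ends := ends) (h := 2 * j) (by omega)
      have htl2 := tail_lt (ends := ends) (h := 2 * j + 1) (by omega)
      have hp1 := hr.pos (2 * j) (by omega)
      have hp2 := hr.pos (2 * j + 1) (by omega)
      have hω : ∀ i, t.mem (slot (base m) 5 i) = s.mem (slot (base m) 5 i) := ha.slot (by decide)
      set ω := fun i => s.mem (slot (base m) 5 i) with hωdef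
      set t' := ((((t.setReg 11 (tail ends (2 * j))).setReg 12 (tail ends (2 * j + 1))).setReg 13
        (count (tail ends) (2 * j) (tail ends (2 * j)))).setReg 14
        (count (tail ends) (2 * j + 1) (tail ends (2 * j + 1)))).setReg 15
        (if ω (2 * n + j) = 0 then 1 else 0) with ht'
      set x := (if ω (2 * n + j) = 0 then 1 else 0) +
        ((if count (tail ends) (2 * j) (tail ends (2 * j)) = ω (2 * tail ends (2 * j))
          then 1 else 0) +
        (if count (tail ends) (2 * j) (tail ends (2 * j)) = ω (2 * tail ends (2 * j) + 1)
          then 1 else 0)) +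
        ((if count (tail ends) (2 * j + 1) (tail ends (2 * j + 1)) = ω (2 * tail ends (2 * j + 1))
          then 1 else 0) +
        (if count (tail ends) (2 * j + 1) (tail ends (2 * j + 1)) =
          ω (2 * tail ends (2 * j + 1) + 1) then 1 else 0)) with hxdef
      have hex : markBody.exec t = t'.setMem (slot (base m) 6 j) x := by
        simp [markBody, Stmt.exec, exact_add, exact_const, exact_reg, exact_load, exact_addr,
          exact_fld, exact_mul, exact_eq, setReg_reg, hr.reg6, hr.reg4, hrj, hin1, hin2, hp1, hp2,
          hω, hωdef, t', x]
      have hx : x ≠ 0 ↔ Sampled ends ω j := by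
        simp only [Sampled, exists_eq_left, exists_half, or_and_right, exists_or,
          x]
        split_ifs <;> simp_all
      refine ⟨?_, ?_, ?_, ?_⟩
      · simp [markBody, Stmt.Fits, Stmt.exec, exact_add, exact_const, exact_reg, exact_load,
          exact_fld, exact_mul, setReg_reg, hr.reg6, hr.reg4, hrj, hin1, hin2, hp1, hp2, fits_add,
          fits_const, fits_reg, fits_load, fits_addr, fits_fld, fits_mul, fits_eq, exact_eq, hω]
        simp [slot, base]
        refine ⟨by omega, by omega, by omega, by omega, by omega, by omega, ?_⟩
        clear hx hex hxdef
        clear_value x t'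
        have hi : ∀ (p : Prop) [Decidable p], (if p then 1 else 0) ≤ 1 := fun p _ => by
          split_ifs <;> omega
        repeat' apply And.intro
        all_goals first
          | omega
          | exact (add_le_add (hi _) (hi _)).trans_lt (by omega)
          | exact (add_le_add (hi _) (add_le_add (hi _) (hi _))).trans_lt (by omega)
          | exact (add_le_add (add_le_add (hi _) (add_le_add (hi _) (hi _)))
              (add_le_add (hi _) (hi _))).trans_lt (by omega)
      · rw [hex]
        simp [t', setReg_reg, hrj]
      · rw [hex]
        refine Agree.setReg (Agree.setMem (Agree.setReg (Agree.setReg (Agree.setReg (Agree.setReg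
          (Agree.setReg ha ?_ _) ?_ _) ?_ _) ?_ _) ?_ _) ?_ _ _) ?_ _ <;> simp
      · intro e he
        rw [hex]
        by_cases hej : e = j
        · subst hej
          simpa [setMem_mem] using hx
        · simp only [setReg_mem, setMem_mem, slot_inj]
          rw [if_neg (by tauto)]
          exact h1 e (by omega))
  exact ⟨s', hd.mono (by simp only [markBody, Stmt.cost]; omega), hI⟩

/-- `1` if the labels of the ends of the edge `e` differ, else `0`. -/
def apart (ends : Fin m → Fin n × Fin n) (s : State) (e : ℕ) : ℕ :=
  1 - if s.mem (slot (base m) 7 (tail ends (2 * e))) =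
    s.mem (slot (base m) 7 (tail ends (2 * e + 1))) then 1 else 0

theorem apart_le (s : State) (e : ℕ) : apart ends s e ≤ 1 := Nat.sub_le _ _

theorem apart_agree {s s' : State} {J : List (Fin 16)} {R : List ℕ}
    (ha : Agree (base m) J R s s') (hJ : (7 : Fin 16) ∉ J) : apart ends s' = apart ends s := by
  funext e
  simp only [apart, ha.slot hJ]

theorem apart_eq {mk : ℕ → Prop} {s : State} (h : Labelled ends mk s) (e : Fin m)
    [Decidable (e ∈ crossing ends (markSet ends mk))] :
    apart ends s e = if e ∈ crossing ends (markSet ends mk) then 1 else 0 := by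
  rw [apart, tail_even, tail_odd]
  by_cases hc : e ∈ crossing ends (markSet ends mk)
  · rw [if_pos hc, if_neg (mt (h.eq_iff _ _).1 (mem_crossing.1 hc))]
  · rw [if_neg hc, if_pos]
    rw [mem_crossing, not_not] at hc
    exact (h.eq_iff _ _).2 hc

theorem sum_apart {mk : ℕ → Prop} {s : State} (h : Labelled ends mk s) :
    ∑ e ∈ Finset.range m, apart ends s e = (crossing ends (markSet ends mk)).card := by
  classical
  rw [Finset.sum_range]
  simp only [apart_eq h, Finset.sum_boole, Finset.filter_univ_mem, Nat.cast_id]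

theorem det_countCrossing (hw : 100 * (n + m + 1) ≤ 2 ^ w) {K : ℕ} (hK : K < 2 ^ w)
    (hKn : K * n < 2 ^ w) {s : State} (hs : Ready ends s) :
    ∃ s', Det w (countCrossing K) s (100 * m + 10) s' ∧
      Agree (base m) [] [10, 11, 12, 13, 14] s s' ∧
      s'.reg 14 = if ∑ e ∈ Finset.range m, apart ends s e ≤ K * n then 1 else 0 := by
  have hw0 := wordLength_ne_zero hw
  have hd0 := det_exec (w := w) (by omega) (.assign 11 num[0]) rfl s (by
    simp [Stmt.Fits, fits_const])
  obtain ⟨s₁, hd₁, -, ha₁, hs₁⟩ := det_forUpTo (w := w) (by omega) (i := 10) (N := m)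
    (e := reg[5]) (p := countBody) rfl (by omega)
    (fun j t => Agree (base m) [] [10, 11, 12, 13, 14] s t ∧
      t.reg 11 = ∑ e ∈ Finset.range j, apart ends s e) (Stmt.exec (.assign 11 num[0]) s)
    ⟨((Agree.refl _ _ _ _).setReg (by simp) _).setReg (by simp) _, by
      simp [Stmt.exec, setReg_reg, exact_const]⟩
    (fun j t ht => by
      have hr := hs.agree ht.1 (by decide)
      exact ⟨trivial, hr.reg5⟩)
    (by
      rintro j t hj hrj ⟨ha, h1⟩
      have hr := hs.agree ha (by decide)
      have hin1 := even_input hr hj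
      have hin2 := odd_input hr hj
      have htl1 := tail_lt (ends := ends) (h := 2 * j) (by omega)
      have htl2 := tail_lt (ends := ends) (h := 2 * j + 1) (by omega)
      have hap := apart_le (ends := ends) s j
      have hsum : ∑ e ∈ Finset.range j, apart ends s e ≤ j := by
        simpa using Finset.sum_le_card_nsmul (Finset.range j) _ 1 fun e _ => apart_le (ends := ends) s e
      have hlab : ∀ i, t.mem (slot (base m) 7 i) = s.mem (slot (base m) 7 i) := ha.slot (by simp)
      have hex : countBody.exec t = ((t.setReg 12 (tail ends (2 * j))).setReg 13
          (tail ends (2 * j + 1))).setReg 11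
          (∑ e ∈ Finset.range j, apart ends s e + apart ends s j) := by
        simp [countBody, Stmt.exec, exact_add, exact_sub, exact_const, exact_reg, exact_load,
          exact_fld, exact_mul, exact_eq, setReg_reg, hr.reg6, hrj, hin1, hin2, h1, hlab, apart]
      refine ⟨?_, ?_, ?_, ?_⟩
      · simp [countBody, Stmt.Fits, Stmt.exec, exact_add, exact_sub, exact_const, exact_reg,
          exact_load, exact_fld, exact_mul, exact_eq, setReg_reg, hr.reg6, hrj, hin1, hin2, h1,
          fits_add, fits_sub, fits_const, fits_reg, fits_load, fits_fld, fits_mul, fits_eq, hlab]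
        rw [← apart]
        simp [slot, base]
        omega
      · rw [hex]
        simp [setReg_reg, hrj]
      · rw [hex]
        refine Agree.setReg (Agree.setReg (Agree.setReg (Agree.setReg ha ?_ _) ?_ _) ?_ _) ?_ _ <;>
          simp
      · rw [hex, Finset.sum_range_succ]
        simp [setReg_reg])
  have hr := hs.agree ha₁ (by decide)
  have hd₂ := det_exec (w := w) (by omega)
    (.assign 14 (num[1] - .op .lt (num[K] * reg[4]) reg[11])) rfl s₁ (by
      simp [Stmt.Fits, fits_sub, fits_const, fits_lt, fits_mul, fits_reg, exact_const, exact_reg,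
        hr.reg4, hK, hKn]
      omega)
  refine ⟨_, (hd0.seq (hd₁.seq hd₂)).mono ?_, ha₁.setReg (by simp) _, ?_⟩
  · simp only [countBody, Stmt.cost]
    omega
  · simp [Stmt.exec, setReg_reg, exact_sub, exact_const, exact_lt, exact_mul, exact_reg, hr.reg4,
      hs₁]
    split_ifs <;> omega

theorem det_addCrossing (hw : 100 * (n + m + 1) ≤ 2 ^ w) {s : State} (hs : Ready ends s)
    (hc : ∀ e < m, s.mem (slot (base m) 9 e) + 1 < 2 ^ w) (h14 : s.reg 14 ≤ 1) :
    ∃ s', Det w addCrossing s (100 * m + 10) s' ∧ Agree (base m) [9] [10, 12, 13] s s' ∧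
      ∀ e < m, s'.mem (slot (base m) 9 e) =
        s.mem (slot (base m) 9 e) + apart ends s e * s.reg 14 := by
  have hw0 := wordLength_ne_zero hw
  obtain ⟨s', hd, -, hI⟩ := det_forUpTo (w := w) (by omega) (i := 10) (N := m)
    (e := reg[5]) (p := addBody) rfl (by omega)
    (fun j t => Agree (base m) [9] [10, 12, 13] s t ∧
      ∀ e < m, t.mem (slot (base m) 9 e) = s.mem (slot (base m) 9 e) +
        if e < j then apart ends s e * s.reg 14 else 0) s
    ⟨(Agree.refl _ _ _ _).setReg (by simp) _, fun e _ => by simp⟩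
    (fun j t ht => by
      have hr := hs.agree ht.1 (by decide)
      exact ⟨trivial, hr.reg5⟩)
    (by
      rintro j t hj hrj ⟨ha, h1⟩
      have hr := hs.agree ha (by decide)
      have hin1 := even_input hr hj
      have hin2 := odd_input hr hj
      have htl1 := tail_lt (ends := ends) (h := 2 * j) (by omega)
      have htl2 := tail_lt (ends := ends) (h := 2 * j + 1) (by omega)
      have hap : apart ends s j * s.reg 14 ≤ 1 :=
        Nat.mul_le_mul (apart_le (ends := ends) s j) h14
      have hlab : ∀ i, t.mem (slot (base m) 7 i) = s.mem (slot (base m) 7 i) := ha.slot (by simp)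
      have h14' : t.reg 14 = s.reg 14 := ha.2 14 (by simp)
      have hj1 : t.mem (slot (base m) 9 j) = s.mem (slot (base m) 9 j) := by
        simpa using h1 j hj
      have hcj := hc j hj
      have hex : addBody.exec t = ((t.setReg 12 (tail ends (2 * j))).setReg 13
          (tail ends (2 * j + 1))).setMem (slot (base m) 9 j)
          (s.mem (slot (base m) 9 j) + apart ends s j * s.reg 14) := by
        simp [addBody, Stmt.exec, exact_add, exact_sub, exact_const, exact_reg, exact_load,
          exact_fld, exact_mul, exact_eq, exact_addr, setReg_reg, hr.reg6, hrj, hin1, hin2, hlab,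
          hj1, h14', apart]
      refine ⟨?_, ?_, ?_, ?_⟩
      · simp [addBody, Stmt.Fits, Stmt.exec, exact_add, exact_sub, exact_const, exact_reg,
          exact_load, exact_fld, exact_mul, exact_eq, setReg_reg, hr.reg6, hrj, hin1, hin2,
          h14', fits_add, fits_sub, fits_const, fits_reg, fits_load, fits_fld, fits_mul,
          fits_eq, fits_addr, hlab, hj1]
        rw [← apart]
        simp [slot, base] at hcj ⊢
        have := apart_le (ends := ends) s j
        omega
      · rw [hex]
        simp [setReg_reg, hrj]
      · rw [hex]
        refine Agree.setReg (Agree.setMem (Agree.setReg (Agree.setReg ha ?_ _) ?_ _) ?_ _ _)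
          ?_ _ <;> simp
      · intro e he
        rw [hex]
        simp only [setReg_mem, setMem_mem, slot_inj, true_and]
        by_cases hej : e = j
        · subst hej
          simp
        · rw [if_neg hej, h1 e he]
          congr 2
          simp; omega)
  obtain ⟨ha, hI⟩ := hI
  exact ⟨s', hd.mono (by simp only [addBody, Stmt.cost]; omega), ha, fun e he => by
    rw [hI e he, if_pos he]⟩

/-! ### Half-edges as an enumeration of the neighbors -/

variable {G : SimpleGraph (Fin n)}

theorem adj_of_halfEdge (hends : IsEdgeList G ends) {h : ℕ} (hh : h < 2 * m) :
    G.Adj ⟨tail ends h, tail_lt hh⟩ ⟨head ends h, head_lt hh⟩ := by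
  obtain ⟨e, he⟩ := halfEdge_cases hh
  have hadj : G.Adj (ends e).1 (ends e).2 := by
    have : s((ends e).1, (ends e).2) ∈ G.edgeSet := hends.2 ▸ Set.mem_range_self e
    exact this
  rcases he with rfl | rfl
  · convert hadj using 1 <;> ext
    · exact tail_even e
    · exact head_even e
  · convert hadj.symm using 1 <;> ext
    · exact tail_odd e
    · exact head_odd e

theorem halfEdge_edge {h : ℕ} (hh : h < 2 * m) : ∃ e : Fin m, (h = 2 * e ∨ h = 2 * e + 1) ∧
    edge ends e = s(⟨tail ends h, tail_lt hh⟩, ⟨head ends h, head_lt hh⟩) := by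
  obtain ⟨e, he⟩ := halfEdge_cases hh
  refine ⟨e, he, ?_⟩
  rcases he with rfl | rfl
  · rw [edge, Sym2.eq_iff]
    exact Or.inl ⟨Fin.ext (tail_even e).symm, Fin.ext (head_even e).symm⟩
  · rw [edge, Sym2.eq_iff]
    exact Or.inr ⟨Fin.ext (head_odd e).symm, Fin.ext (tail_odd e).symm⟩

/-- The two ends determine the edge because the list has no repetitions, and its orientation because
there are no loops. -/
theorem halfEdge_inj (hends : IsEdgeList G ends) {h h' : ℕ} (hh : h < 2 * m) (hh' : h' < 2 * m)
    (ht : tail ends h = tail ends h') (hd : head ends h = head ends h') : h = h' := by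
  obtain ⟨e, he, he1⟩ := halfEdge_edge (ends := ends) hh
  obtain ⟨e', he', he1'⟩ := halfEdge_edge (ends := ends) hh'
  simp only [← ht, ← hd, ← he1] at he1'
  obtain rfl : e' = e := hends.1 he1'
  have hne : tail ends h ≠ head ends h := fun hc =>
    (adj_of_halfEdge hends hh).ne (Fin.ext hc)
  rcases he with rfl | rfl <;> rcases he' with rfl | rfl
  · rfl
  · rw [tail_even, head_even] at hne
    rw [tail_even, tail_odd] at ht
    exact absurd ht hne
  · rw [tail_odd, head_odd] at hne
    rw [tail_even, tail_odd] at ht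
    exact absurd ht hne
  · rfl

theorem exists_halfEdge (hends : IsEdgeList G ends) {u v : Fin n} (h : G.Adj u v) :
    ∃ h < 2 * m, tail ends h = u ∧ head ends h = v := by
  have : s(u, v) ∈ G.edgeSet := h
  rw [← hends.2] at this
  obtain ⟨e, he⟩ := this
  rcases Sym2.eq_iff.1 he with ⟨rfl, rfl⟩ | ⟨rfl, rfl⟩
  · exact ⟨2 * e, by omega, tail_even e, head_even e⟩
  · exact ⟨2 * e + 1, by omega, tail_odd e, head_odd e⟩

theorem count_eq_degree [DecidableRel G.Adj] (hends : IsEdgeList G ends) (u : Fin n) :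
    count (tail ends) (2 * m) u = G.degree u := by
  rw [count_eq_card, ← G.card_neighborFinset_eq_degree]
  refine Finset.card_bij (fun h hh => ⟨head ends h, head_lt (by simp at hh; exact hh.1)⟩) ?_ ?_ ?_
  · intro h hh
    have h1 : h < 2 * m ∧ tail ends h = u := by simpa using hh
    rw [SimpleGraph.mem_neighborFinset]
    convert adj_of_halfEdge hends h1.1
    exact h1.2.symm
  · intro h hh h' hh' heq
    have h1 : h < 2 * m ∧ tail ends h = u := by simpa using hh
    have h1' : h' < 2 * m ∧ tail ends h' = u := by simpa using hh'
    exact halfEdge_inj hends h1.1 h1'.1 (h1.2.trans h1'.2.symm) (by simpa using heq)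
  · intro v hv
    rw [SimpleGraph.mem_neighborFinset] at hv
    obtain ⟨h, hh, h1, h2⟩ := exists_halfEdge hends hv
    exact ⟨h, by simp [hh, h1], Fin.ext h2⟩

open Classical in
/-- The head of the half-edge at position `x` at the tail `u`. -/
noncomputable def nbr (ends : Fin m → Fin n × Fin n) (u : Fin n) (x : ℕ) : Fin n :=
  if h : ∃ h : Fin (2 * m), tail ends h = u ∧ count (tail ends) h u = x then
    ⟨head ends h.choose, head_lt h.choose.2⟩ else u

theorem nbr_eq {h : ℕ} (hh : h < 2 * m) :
    nbr ends ⟨tail ends h, tail_lt hh⟩ (count (tail ends) h (tail ends h)) =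
      ⟨head ends h, head_lt hh⟩ := by
  have hex : ∃ h' : Fin (2 * m), tail ends h' = tail ends h ∧
      count (tail ends) h' (tail ends h) = count (tail ends) h (tail ends h) :=
    ⟨⟨h, hh⟩, rfl, rfl⟩
  rw [nbr, dif_pos hex]
  have := hex.choose_spec
  ext
  simp only
  rw [count_inj _ this.1 rfl this.2]

theorem exists_nbr [DecidableRel G.Adj] (hends : IsEdgeList G ends) (u : Fin n) {x : ℕ}
    (hx : x < G.degree u) : ∃ h, ∃ hh : h < 2 * m, u = ⟨tail ends h, tail_lt hh⟩ ∧
      count (tail ends) h (tail ends h) = x ∧ nbr ends u x = ⟨head ends h, head_lt hh⟩ := by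
  rw [← count_eq_degree hends] at hx
  obtain ⟨h, hh, h1, h2⟩ := exists_count _ hx
  obtain rfl : (⟨tail ends h, tail_lt hh⟩ : Fin n) = u := Fin.ext h1
  refine ⟨h, hh, rfl, h2, ?_⟩
  rw [← h2]
  exact nbr_eq hh

/-- The positions below the degree of `u` correspond to its half-edges and these to its neighbors.
So a uniform position is a uniform incident edge, as the probabilistic analysis assumes. -/
theorem nbrEnum [DecidableRel G.Adj] (hends : IsEdgeList G ends) : NbrEnum G (nbr ends) where
  adj u x hx := by
    obtain ⟨h, hh, rfl, -, h2⟩ := exists_nbr hends u hx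
    rw [h2]
    exact adj_of_halfEdge hends hh
  inj u x hx y hy hxy := by
    obtain ⟨h, hh, rfl, rfl, h2⟩ := exists_nbr hends u hx
    obtain ⟨h', hh', h3, rfl, h4⟩ := exists_nbr hends _ hy
    rw [h2, h4] at hxy
    rw [halfEdge_inj hends hh hh' (congrArg Fin.val h3) (congrArg Fin.val hxy)]

/-- The bridge between machine and analysis. A draw below the degree is the position of an actual
half-edge, so comparing positions with draws marks exactly the picked edges. -/
theorem markSet_sampled [DecidableRel G.Adj] (hends : IsEdgeList G ends) {ω : ℕ → ℕ}
    (hω : ∀ i < 2 * n, ω i < drawBound G i) :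
    markSet ends (Sampled ends ω) = sampleSet ends (nbr ends) ω := by
  ext z
  constructor
  · rintro ⟨e, h0 | ⟨h, hh, i, hi, hc⟩, rfl⟩
    · exact Or.inr ⟨e, h0, rfl⟩
    · left
      have hh2 : h < 2 * m := by omega
      obtain ⟨e', he', h1⟩ := halfEdge_edge (ends := ends) hh2
      obtain rfl : e = e' := Fin.ext (by omega)
      refine ⟨⟨tail ends h, tail_lt hh2⟩, i, hi, ?_⟩
      rw [← hc, nbr_eq hh2, h1]
  · rintro (⟨u, i, hi, rfl⟩ | ⟨e, he, rfl⟩)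
    · have hx := hω i (by omega)
      rw [drawBound_pick u i hi] at hx
      obtain ⟨h, hh, rfl, h1, h2⟩ := exists_nbr hends u hx
      obtain ⟨e, he, h3⟩ := halfEdge_edge (ends := ends) hh
      exact ⟨e, Or.inr ⟨h, he, i, hi, h1⟩, by rw [h2, h3]⟩
    · exact ⟨e, Or.inl he, rfl⟩

theorem markSet_congr {mk mk' : ℕ → Prop} (h : ∀ e < m, mk e ↔ mk' e) :
    markSet ends mk = markSet ends mk' := by
  ext z
  simp only [markSet, Set.mem_ofPred_eq]
  exact exists_congr fun e => by rw [h e e.2]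

end

end MinCut


/-! ### The rounds -/

namespace MinCut

open WordRAM

section

variable {n m : ℕ} {G : SimpleGraph (Fin n)} [DecidableRel G.Adj]
  {ends : Fin m → Fin n × Fin n} {w : ℕ}

open Classical in
/-- If `p` holds, `x` as an extended nonnegative real, else `∞`. -/
noncomputable def provided (p : Prop) (x : ℝ) : ℝ≥0∞ := if p then ENNReal.ofReal x else ∞

theorem provided_pos {p : Prop} (h : p) (x : ℝ) : provided p x = ENNReal.ofReal x := if_pos h

theorem of_provided {p : Prop} {x : ℝ} (h : provided p x ≠ ∞) : p := by
  by_contra hp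
  exact h (if_neg hp)

theorem avgs_range'_succ (b : ℕ → ℕ) (f : (ℕ → ℕ) → ℝ) {j N : ℕ} (hj : j < N) :
    avgs b (List.range' j (N - j)) f =
      avg b j (avgs b (List.range' (j + 1) (N - (j + 1))) f) := by
  rw [show N - j = (N - (j + 1)) + 1 by omega, List.range'_succ, avgs_cons]

theorem ofReal_avg {b : ℕ → ℕ} {i : ℕ} (hb : 0 < b i) {f : (ℕ → ℕ) → ℝ} (hf : ∀ ω, 0 ≤ f ω)
    (ω : ℕ → ℕ) : ENNReal.ofReal (avg b i f ω) =
      (∑ x ∈ Finset.range (b i), ENNReal.ofReal (f (Function.update ω i x))) / b i := by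
  rw [avg, ENNReal.ofReal_div_of_pos (by exact_mod_cast hb),
    ENNReal.ofReal_sum_of_nonneg fun x _ => hf _, ENNReal.ofReal_natCast]

/-- The random numbers in the memory. -/
def draws (m : ℕ) (s : State) (i : ℕ) : ℕ := s.mem (slot (base m) 5 i)

theorem draws_setMem (s : State) (i x : ℕ) :
    draws m (s.setMem (slot (base m) 5 i) x) = Function.update (draws m s) i x := by
  funext k
  simp [draws, setMem_mem, slot_inj, Function.update_apply]

/-- The state `t` during the drawing of random numbers. -/
def DrawInv (G : SimpleGraph (Fin n)) [DecidableRel G.Adj] (m j : ℕ) (s t : State) : Prop :=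
  Agree (base m) [5] [10, 11, 12] s t ∧ ∀ i < j, draws m t i < drawBound G i

theorem minDegree_lt (hG : 0 < G.minDegree) : G.minDegree < n ∧ 0 < n := by
  have hn : 0 < n := by
    by_contra h
    obtain rfl : n = 0 := by omega
    simp [SimpleGraph.minDegree] at hG
  have : Nonempty (Fin n) := ⟨⟨0, hn⟩⟩
  exact ⟨by simpa using G.minDegree_lt_card, hn⟩

/-- Field `5` of the memory plays the role of `ω`, and the expectation attached to a state is the
average over the coordinates not yet drawn. Drawing coordinate `j` peels off one averaging; values
left from an earlier round do no harm, because every coordinate is redrawn before it is used. -/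
theorem wp_drawStep (hw : 100 * (n + m + 1) ≤ 2 ^ w) (hG : 0 < G.minDegree)
    (hends : IsEdgeList G ends) {q : ℕ} {s : State} (hs : Prepared ends G.minDegree q s)
    {g : (ℕ → ℕ) → ℝ} (hg : ∀ ω, 0 ≤ g ω) {j : ℕ} (hj : j < 2 * n + m) {t : State}
    (ht : DrawInv G m j s t) (htj : t.reg 10 = j) :
    WP w drawStep t 20 (fun t => provided (DrawInv G m (j + 1) s t ∧ t.reg 10 = j + 1)
      (avgs (drawBound G) (List.range' (j + 1) (2 * n + m - (j + 1))) g (draws m t)))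
      (ENNReal.ofReal (avgs (drawBound G) (List.range' j (2 * n + m - j)) g (draws m t))) := by
  have hw0 := wordLength_ne_zero hw
  obtain ⟨ha, hlt⟩ := ht
  have hr := hs.agree ha (by decide) (by decide)
  obtain ⟨hδ, hn⟩ := minDegree_lt hG
  set p₁ : Stmt := .ite (.op .lt reg[10] (num[2] * reg[4])) (.assign 11 (fld 0 (reg[10] / num[2])))
      (.assign 11 (num[2] * reg[7])) with hp₁
  set p₂ : Stmt := .seq (.store (addr 5 reg[10]) reg[12]) (.assign 10 (reg[10] + num[1])) with hp₂
  have hex : p₁.exec t = t.setReg 11 (drawBound G j) := by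
    simp only [p₁, Stmt.exec, exact_lt, exact_reg, exact_mul, exact_const, exact_fld, exact_div,
      hr.reg4, hr.reg6, hr.reg7, htj]
    rw [drawBound]
    by_cases h : j < 2 * n
    · have h' : j / 2 < n := by omega
      rw [if_pos h, dif_pos h', ← count_eq_degree hends, if_pos one_ne_zero, hr.deg _ h']
    · have h' : ¬ j / 2 < n := by omega
      rw [if_neg h, dif_neg h', if_neg (by simp)]
  have hfit : p₁.Fits (2 ^ w) t := by
    simp only [p₁, Stmt.Fits, exact_lt, exact_reg, exact_mul, exact_const, exact_div,
      hr.reg4, hr.reg6, hr.reg7, htj, fits_lt, fits_reg, fits_mul, fits_const, fits_fld, fits_div]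
    refine ⟨by simp; omega, ?_⟩
    by_cases h : j < 2 * n
    · rw [if_pos h, if_pos one_ne_zero]
      unfold slot base
      simp
      omega
    · rw [if_neg h, if_neg (by simp)]
      simp
      omega
  have hd₁ := det_exec (w := w) (by omega) p₁ rfl t hfit
  rw [hex] at hd₁
  have key := hd₁.seq_wp (q := .rand 12 reg[11]) (WP.rand (f := fun t' =>
    provided (DrawInv G m (j + 1) s (p₂.exec t') ∧ (p₂.exec t').reg 10 = j + 1 ∧
        p₂.Fits (2 ^ w) t')
      (avgs (drawBound G) (List.range' (j + 1) (2 * n + m - (j + 1))) g (draws m (p₂.exec t')))))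
  refine (key.seq (q := p₂) (T₂ := 3)
    (g := fun t => provided (DrawInv G m (j + 1) s t ∧ t.reg 10 = j + 1)
      (avgs (drawBound G) (List.range' (j + 1) (2 * n + m - (j + 1))) g (draws m t)))
    fun t' ht' => ?_).mono ?_ (fun _ => le_rfl) ?_
  · have h := of_provided ht'
    refine (det_exec (w := w) (by omega) p₂ rfl t' h.2.2).wp ?_
    rw [provided_pos h, provided_pos ⟨h.1, h.2.1⟩]
  · simp [p₁, Stmt.cost]
  · change (∑' x, uniformBelow (((t.setReg 11 (drawBound G j))).reg 11) x * _) ≤ _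
    rw [setReg_reg, if_pos rfl, tsum_uniformBelow (drawBound_pos hG j), avgs_range'_succ _ _ hj,
      ofReal_avg (drawBound_pos hG j) fun ω => avgs_nonneg hg]
    gcongr with x hx
    rw [Finset.mem_range] at hx
    set t' := (t.setReg 11 (drawBound G j)).setReg 12 x with ht'
    have hex₂ : p₂.exec t' = (t'.setMem (slot (base m) 5 j) x).setReg 10 (j + 1) := by
      simp [p₂, Stmt.exec, exact_addr, exact_add, exact_const, exact_reg, t', setReg_reg, hr.reg6,
        htj]
    have hdr : draws m (p₂.exec t') = Function.update (draws m t) j x := by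
      rw [hex₂]
      exact draws_setMem _ _ _
    rw [provided_pos, hdr]
    refine ⟨⟨?_, ?_⟩, ?_, ?_⟩
    · rw [hex₂]
      refine Agree.setReg (Agree.setMem (Agree.setReg (Agree.setReg ha ?_ _) ?_ _) ?_ _ _) ?_ _ <;>
        simp
    · intro i hi
      rw [hdr, Function.update_apply]
      split_ifs with h
      · rwa [h]
      · exact hlt i (by omega)
    · rw [hex₂]
      simp [setReg_reg]
    · simp [p₂, Stmt.Fits, Stmt.exec, fits_addr, fits_add, fits_const, fits_reg, exact_reg,
        exact_const, t', setReg_reg, hr.reg6, htj]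
      simp [slot, base]
      omega

theorem wp_drawAll (hw : 100 * (n + m + 1) ≤ 2 ^ w) (hG : 0 < G.minDegree)
    (hends : IsEdgeList G ends) {q : ℕ} {s : State} (hs : Prepared ends G.minDegree q s)
    {g : (ℕ → ℕ) → ℝ} (hg : ∀ ω, 0 ≤ g ω) :
    WP w drawAll s (100 * (n + m + 1))
      (fun t => provided (DrawInv G m (2 * n + m) s t) (g (draws m t)))
      (ENNReal.ofReal (avgs (drawBound G) (List.range (2 * n + m)) g (draws m s))) := by
  have hw0 := wordLength_ne_zero hw
  have hcond : ∀ j t, DrawInv G m j s t →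
      (Expr.op .lt reg[10] (num[2] * reg[4] + reg[5])).eval w t =
        if t.reg 10 < 2 * n + m then 1 else 0 := by
    intro j t ht
    have hr := hs.agree ht.1 (by decide) (by decide)
    rw [Expr.eval_eq (by omega)]
    · simp [exact_lt, exact_add, exact_mul, exact_reg, exact_const, hr.reg4, hr.reg5]
    · simp [fits_lt, fits_add, fits_mul, fits_reg, fits_const, exact_mul, exact_reg, exact_const,
        hr.reg4, hr.reg5]
      omega
  have hloop := wp_loop (w := w) (e := .op .lt reg[10] (num[2] * reg[4] + reg[5])) (p := drawStep)
    (c := 20) (N := 2 * n + m)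
    (fun j t => provided (DrawInv G m j s t ∧ t.reg 10 = j)
      (avgs (drawBound G) (List.range' j (2 * n + m - j)) g (draws m t)))
    (fun j t hj ht => by
      have h := of_provided ht
      rw [hcond j t h.1, h.2, if_pos hj]
      exact one_ne_zero)
    (fun t ht => by
      have h := of_provided ht
      rw [hcond _ t h.1, h.2, if_neg (lt_irrefl _)])
    (fun j t hj ht => by
      have h := of_provided ht
      rw [provided_pos h]
      exact wp_drawStep hw hG hends hs hg hj h.1 h.2)
    0 (Nat.zero_le _) (s.setReg 10 0)
  have hd0 := det_exec (w := w) (by omega) (.assign 10 num[0]) rfl s (by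
    simp [Stmt.Fits, fits_const])
  refine (hd0.seq_wp hloop).mono ?_ (fun t => ?_) ?_
  · simp only [Stmt.cost]; omega
  · by_cases h : DrawInv G m (2 * n + m) s t ∧ t.reg 10 = 2 * n + m
    · rw [provided_pos h, provided_pos h.1]
      simp
    · refine le_top.trans_eq ?_
      rw [provided, if_neg h]
  · rw [provided_pos]
    · rw [List.range_eq_range', Nat.sub_zero]
      exact le_rfl
    · exact ⟨⟨(Agree.refl _ _ _ _).setReg (by simp) _, fun i hi => absurd hi (Nat.not_lt_zero _)⟩,
        by simp [setReg_reg]⟩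

open Classical in
/-- Whether a round with the random numbers `ω` counts the edge `e`. -/
noncomputable def hit (ends : Fin m → Fin n × Fin n) (K : ℕ) (ω : ℕ → ℕ) (e : Fin m) : ℕ :=
  if (crossing ends (sampleSet ends (nbr ends) ω)).card ≤ K * n ∧
    e ∈ crossing ends (sampleSet ends (nbr ends) ω) then 1 else 0

theorem hit_le (K : ℕ) (ω : ℕ → ℕ) (e : Fin m) : hit ends K ω e ≤ 1 := by
  rw [hit]; split_ifs <;> omega

/-- A round with more than `K * n` crossing edges counts none of them. -/
theorem sum_hit_le (K : ℕ) (ω : ℕ → ℕ) : ∑ e, hit ends K ω e ≤ K * n := by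
  by_cases h : (crossing ends (sampleSet ends (nbr ends) ω)).card ≤ K * n
  · simp [hit, h]
  · simp [hit, h]

/-- The counters of the edges. -/
def votes (m : ℕ) (s : State) (e : Fin m) : ℕ := s.mem (slot (base m) 9 e)

/-- After the drawing, the round is deterministic, and the new votes are a function of the draws
alone. The arbitrary potential `Φ` allows rounds to be chained, and the facts that hold for every
outcome travel inside `provided`. -/
theorem wp_round (hw : 100 * (n + m + 1) ≤ 2 ^ w) (hG : 0 < G.minDegree)
    (hends : IsEdgeList G ends) {q K : ℕ} (hK : K < 2 ^ w) (hKn : K * n < 2 ^ w) {s : State}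
    (hs : Prepared ends G.minDegree q s) (hc : ∀ e, votes m s e + 1 < 2 ^ w)
    {Φ : (Fin m → ℕ) → ℝ} (hΦ : ∀ c, 0 ≤ Φ c) :
    WP w (round K) s (700 * (n + m + 1))
      (fun t => provided (Agree (base m) [5, 6, 7, 8, 9] [0, 10, 11, 12, 13, 14, 15, 16] s t ∧
        ∃ ω, votes m t = votes m s + hit ends K ω) (Φ (votes m t)))
      (ENNReal.ofReal (avgs (drawBound G) (List.range (2 * n + m))
        (fun ω => Φ (votes m s + hit ends K ω)) (draws m s))) := by
  classical
  refine (WP.seq (T₂ := 500 * (n + m + 1)) (wp_drawAll hw hG hends hs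
    (g := fun ω => Φ (votes m s + hit ends K ω)) fun ω => hΦ _) fun s₁ h₁ => ?_).mono ?_
    (fun _ => le_rfl) le_rfl
  swap
  · omega
  obtain ⟨ha₁, hlt⟩ := of_provided h₁
  rw [provided_pos ⟨ha₁, hlt⟩]
  have hr₁ := hs.agree ha₁ (by decide) (by decide)
  obtain ⟨s₂, hd₂, ha₂, hm₂⟩ := det_markSample hw hr₁
  have hr₂ := hr₁.agree ha₂ (by decide) (by decide)
  obtain ⟨s₃, hd₃, ha₃, hl₃⟩ := det_findComponents hw hr₂
  have hr₃ := hr₂.agree ha₃ (by decide) (by decide)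
  obtain ⟨s₄, hd₄, ha₄, h14⟩ := det_countCrossing hw hK hKn hr₃.toReady
  have hr₄ := hr₃.agree ha₄ (by decide) (by decide)
  have hc₄ : ∀ e, s₄.mem (slot (base m) 9 e) = s.mem (slot (base m) 9 e) := fun e => by
    rw [ha₄.slot (by simp), ha₃.slot (by simp), ha₂.slot (by simp), ha₁.slot (by simp)]
  obtain ⟨s₅, hd₅, ha₅, hc₅⟩ := det_addCrossing hw hr₄.toReady
    (fun e he => by rw [hc₄]; exact hc ⟨e, he⟩) (by rw [h14]; split_ifs <;> omega)
  refine ((hd₂.seq (hd₃.seq (hd₄.seq hd₅))).mono (by omega)).wp ?_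
  have hset : markSet ends (fun e => s₂.mem (slot (base m) 6 e) ≠ 0) =
      sampleSet ends (nbr ends) (draws m s₁) :=
    (markSet_congr hm₂).trans (markSet_sampled hends fun i hi => hlt i (by omega))
  have hv : votes m s₅ = votes m s + hit ends K (draws m s₁) := by
    funext e
    have := hc₅ e e.2
    rw [hc₄, apart_agree ha₄ (by simp), apart_eq hl₃ e, h14, sum_apart hl₃, hset] at this
    rw [Pi.add_apply, votes, votes, this, hit]
    congr 1
    split_ifs <;> simp_all
  rw [provided_pos, hv]
  refine ⟨?_, _, hv⟩
  have h12 := ha₁.trans ha₂ (J'' := [5, 6, 7, 8, 9])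
    (R'' := [0, 10, 11, 12, 13, 14, 15, 16]) (by simp) (by simp) (by simp) (by simp)
  have h13 := h12.trans ha₃ (J'' := [5, 6, 7, 8, 9])
    (R'' := [0, 10, 11, 12, 13, 14, 15, 16]) (by simp) (by simp) (by simp) (by simp)
  have h14' := h13.trans ha₄ (J'' := [5, 6, 7, 8, 9])
    (R'' := [0, 10, 11, 12, 13, 14, 15, 16]) (by simp) (by simp) (by simp) (by simp)
  exact h14'.trans ha₅ (by simp) (by simp) (by simp) (by simp)

/-- The state `t` after `j` rounds. -/
def RoundsInv (n m K j : ℕ) (s t : State) : Prop :=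
  Agree (base m) [5, 6, 7, 8, 9] [0, 9, 10, 11, 12, 13, 14, 15, 16] s t ∧
    (∀ e, votes m t e ≤ j) ∧ ∑ e, votes m t e ≤ j * (K * n)

/-- The expectation after `j` rounds is `ρ ^ (q - j)` times the sum of `(1 / 2) ^ votes` over the
critical edges. Whatever happened before, a round multiplies the expected sum by at most `ρ`
(`avgs_half_pow_le`), so independence of the rounds is used only in this form. The bounds on the
votes hold with certainty. -/
theorem wp_rounds (hw : 100 * (n + m + 1) ≤ 2 ^ w) (hG : 0 < G.minDegree)
    (hends : IsEdgeList G ends) {q K : ℕ} (hK : K < 2 ^ w) (hKn : K * n < 2 ^ w)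
    (hq : q < 2 ^ w) {s : State} (hs : Prepared ends G.minDegree q s) (hc : votes m s = 0)
    {ε : ℝ} (hε0 : 0 < ε) (hε1 : ε ≤ 1) (hεK : 208 ≤ Real.exp (-(18 / ε)) * K)
    (crit : Finset (Fin m))
    (hcrit : ∀ e ∈ crit, ∃ S, IsNontrivialSmallCut G (2 - ε) S ∧ edge ends e ∈ cutEdges G S) :
    WP w (rounds K) s ((700 * (n + m + 1) + 10) * q + 10)
      (fun t => provided (RoundsInv n m K q s t) (∑ e ∈ crit, (1 / 2) ^ votes m t e))
      (ENNReal.ofReal ((1 - Real.exp (-(18 / ε)) / 4) ^ q * crit.card)) := by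
  have hw0 := wordLength_ne_zero hw
  set ρ : ℝ := 1 - Real.exp (-(18 / ε)) / 4 with hρ
  have hρ0 : 0 ≤ ρ := by
    have : Real.exp (-(18 / ε)) ≤ 1 := Real.exp_le_one_iff.2 (by rw [neg_nonpos]; positivity)
    rw [hρ]; linarith
  have hcond : ∀ j t, RoundsInv n m K j s t → (Expr.op .lt reg[9] reg[8]).eval w t =
      if t.reg 9 < q then 1 else 0 := by
    intro j t ht
    have hr := hs.agree ht.1 (by decide) (by decide)
    rw [Expr.eval_eq (by omega)]
    · simp [exact_lt, exact_reg, hr.reg8]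
    · simp [fits_lt, fits_reg]
  have hloop := wp_loop (w := w) (e := .op .lt reg[9] reg[8])
    (p := .seq (round K) (.assign 9 (reg[9] + num[1])))
    (c := 700 * (n + m + 1) + 2) (N := q)
    (fun j t => provided (RoundsInv n m K j s t ∧ t.reg 9 = j)
      (ρ ^ (q - j) * ∑ e ∈ crit, (1 / 2) ^ votes m t e))
    (fun j t hj ht => by
      have h := of_provided ht
      rw [hcond j t h.1, h.2, if_pos hj]
      exact one_ne_zero)
    (fun t ht => by
      have h := of_provided ht
      rw [hcond _ t h.1, h.2, if_neg (lt_irrefl _)])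
    (fun j t hj ht => by
      have h := of_provided ht
      rw [provided_pos h]
      obtain ⟨⟨ha, hle, hsum⟩, hrj⟩ := h
      have hr := hs.agree ha (by decide) (by decide)
      refine (WP.seq (T₂ := 1) (wp_round hw hG hends hK hKn hr
        (fun e => by have := hle e; omega)
        (Φ := fun c => ρ ^ (q - (j + 1)) * ∑ e ∈ crit, (1 / 2) ^ c e)
        fun c => by positivity) fun t₁ h₁ => ?_).mono (by omega) (fun _ => le_rfl) ?_
      · obtain ⟨ha₁, ω, hω⟩ := of_provided h₁
        have hr9 : t₁.reg 9 = j := by rw [ha₁.2 9 (by simp), hrj]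
        refine (det_exec (w := w) (by omega) (.assign 9 (reg[9] + num[1])) rfl t₁ (by
          simp [Stmt.Fits, fits_add, fits_reg, fits_const, exact_reg, exact_const, hr9]
          omega)).wp ?_
        have hvotes : votes m (Stmt.exec (.assign 9 (reg[9] + num[1])) t₁) = votes m t₁ := rfl
        rw [provided_pos, provided_pos ⟨ha₁, ω, hω⟩, hvotes]
        refine ⟨⟨(ha.trans ha₁ (by simp) (by simp) (by simp) (by simp)).setReg (by simp) _,
          fun e => ?_, ?_⟩, ?_⟩
        · rw [hvotes, hω, Pi.add_apply]
          exact add_le_add (hle e) (hit_le _ _ _)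
        · rw [hvotes, hω]
          simp only [Pi.add_apply, Finset.sum_add_distrib]
          rw [add_mul, one_mul]
          exact add_le_add hsum (sum_hit_le _ _)
        · simp [Stmt.exec, setReg_reg, exact_add, exact_reg, exact_const, hr9]
      · refine ENNReal.ofReal_le_ofReal ?_
        rw [avgs_const_mul, avgs_sum, show q - j = (q - (j + 1)) + 1 by omega, pow_succ, mul_assoc]
        gcongr
        rw [Finset.mul_sum]
        refine Finset.sum_le_sum fun e he => ?_
        obtain ⟨S, hS, heS⟩ := hcrit e he
        simp only [Pi.add_apply, pow_add]
        rw [avgs_const_mul, mul_comm]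
        gcongr
        refine le_trans (avgs_mono fun ω' _ _ => ?_)
          (avgs_half_pow_le hG (nbrEnum hends) hends hε0 hε1 hS heS hεK _)
        rw [hit]
        split_ifs <;> simp)
    0 (Nat.zero_le _) (s.setReg 9 0)
  have hd0 := det_exec (w := w) (by omega) (.assign 9 num[0]) rfl s (by
    simp [Stmt.Fits, fits_const])
  refine (hd0.seq_wp hloop).mono ?_ (fun t => ?_) ?_
  · simp only [Stmt.cost]
    have : 700 * (n + m + 1) + 2 + 1 ≤ 700 * (n + m + 1) + 10 := by omega
    have := Nat.mul_le_mul_right q this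
    simp only [Nat.sub_zero]
    omega
  · by_cases h : RoundsInv n m K q s t ∧ t.reg 9 = q
    · rw [provided_pos h, provided_pos h.1]
      simp
    · refine le_top.trans_eq ?_
      rw [provided, if_neg h]
  · have hv : votes m (s.setReg 9 0) = 0 := hc
    rw [provided_pos]
    · simp [hv]
    · refine ⟨⟨(Agree.refl _ _ _ _).setReg (by simp) _, ?_, ?_⟩, by simp [setReg_reg]⟩ <;>
        simp [hv]

end

end MinCut

/-! ### Writing the contraction -/

namespace MinCut

open WordRAM

section

variable {n m : ℕ} {G : SimpleGraph (Fin n)} {ends : Fin m → Fin n × Fin n} {w : ℕ}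

theorem det_markRare (hw : 100 * (n + m + 1) ≤ 2 ^ w) {d q B : ℕ} (hB : B < 2 ^ w)
    (hBq : B * q < 2 ^ w) {s : State} (hs : Prepared ends d q s)
    (hc : ∀ e < m, s.mem (slot (base m) 9 e) ≤ q) :
    ∃ s', Det w (markRare B) s (100 * m + 3) s' ∧ Agree (base m) [6] [10] s s' ∧
      ∀ e < m, s'.mem (slot (base m) 6 e) ≠ 0 ↔ B * s.mem (slot (base m) 9 e) < q := by
  have hw0 := wordLength_ne_zero hw
  obtain ⟨s', hd, -, hI⟩ := det_forUpTo (w := w) (by omega) (i := 10) (N := m)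
    (e := reg[5]) (p := .store (addr 6 reg[10]) (.op .lt (num[B] * fld 9 reg[10]) reg[8])) rfl
    (by omega)
    (fun j t => Agree (base m) [6] [10] s t ∧
      ∀ e < j, t.mem (slot (base m) 6 e) ≠ 0 ↔ B * s.mem (slot (base m) 9 e) < q) s
    ⟨(Agree.refl _ _ _ _).setReg (by simp) _, fun e he => absurd he (Nat.not_lt_zero _)⟩
    (fun j t ht => by
      have hr := hs.agree ht.1 (by decide) (by decide)
      exact ⟨trivial, hr.reg5⟩)
    (by
      rintro j t hj hrj ⟨ha, h1⟩
      have hr := hs.agree ha (by decide) (by decide)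
      have hc9 : t.mem (slot (base m) 9 j) = s.mem (slot (base m) 9 j) := ha.slot (by simp) _
      have hBc : B * s.mem (slot (base m) 9 j) < 2 ^ w :=
        (Nat.mul_le_mul_left B (hc j hj)).trans_lt hBq
      have hex : (Stmt.store (addr 6 reg[10]) (.op .lt (num[B] * fld 9 reg[10]) reg[8])).exec t =
          t.setMem (slot (base m) 6 j) (if B * s.mem (slot (base m) 9 j) < q then 1 else 0) := by
        simp [Stmt.exec, exact_addr, exact_fld, exact_mul, exact_const, exact_reg, exact_lt,
          hr.reg6, hr.reg8, hrj, hc9]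
      refine ⟨?_, ?_, ?_, ?_⟩
      · simp [Stmt.Fits, fits_addr, fits_fld, fits_mul, fits_const, fits_reg, fits_lt,
          exact_reg, exact_const, exact_fld, hr.reg6, hrj, hc9, hB, hBc]
        simp [slot, base]
        omega
      · rw [hex]
        exact hrj
      · rw [hex]
        exact (ha.setMem (by simp) _ _).setReg (by simp) _
      · intro e he
        rw [hex]
        simp only [setReg_mem, setMem_mem, slot_inj, true_and]
        by_cases hej : e = j
        · subst hej
          simp
        · rw [if_neg hej]
          exact h1 e (by omega))
  exact ⟨s', hd.mono (by simp only [Stmt.cost]; omega), hI⟩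

/-- The first cell after the records. -/
abbrev outBase (n m : ℕ) : ℕ := base m + 16 * (2 * n + 2 * m + 1)

theorem slot_lt_outBase {i : ℕ} (hi : i < 2 * n + 2 * m + 1) (j : Fin 16) :
    slot (base m) j i < outBase n m := by
  unfold slot outBase
  omega

/-- The states differ only in the cells from `Y` on and in the registers `R`. -/
def AgreeBelow (Y : ℕ) (R : List ℕ) (s t : State) : Prop :=
  (∀ a < Y, t.mem a = s.mem a) ∧ ∀ r ∉ R, t.reg r = s.reg r

theorem AgreeBelow.setReg {Y : ℕ} {R : List ℕ} {s t : State} (h : AgreeBelow Y R s t) {i : ℕ}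
    (hi : i ∈ R) (x : ℕ) : AgreeBelow Y R s (t.setReg i x) := by
  refine ⟨h.1, fun r hr => ?_⟩
  rw [setReg_reg, if_neg (by rintro rfl; exact hr hi), h.2 r hr]

theorem AgreeBelow.setMem {Y : ℕ} {R : List ℕ} {s t : State} (h : AgreeBelow Y R s t) {a : ℕ}
    (ha : Y ≤ a) (x : ℕ) : AgreeBelow Y R s (t.setMem a x) := by
  refine ⟨fun b hb => ?_, h.2⟩
  rw [setMem_mem, if_neg (by omega), h.1 b hb]

theorem Ready.agreeBelow {Y : ℕ} {R : List ℕ} {s t : State} (hs : Ready ends s)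
    (h : AgreeBelow Y R s t) (hY : base m ≤ Y) (hR : ∀ r ∈ [4, 5, 6], r ∉ R) : Ready ends t where
  reg4 := by rw [h.2 4 (hR 4 (by simp)), hs.reg4]
  reg5 := by rw [h.2 5 (hR 5 (by simp)), hs.reg5]
  reg6 := by rw [h.2 6 (hR 6 (by simp)), hs.reg6]
  input i hi := by rw [h.1 _ (by unfold base at hY; omega), hs.input i hi]

/-- The label of the vertex `v`. -/
def label (m : ℕ) (s : State) (v : ℕ) : ℕ := s.mem (slot (base m) 7 v)

theorem label_agreeBelow {R : List ℕ} {s t : State} (h : AgreeBelow (outBase n m) R s t) {v : ℕ}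
    (hv : v < n) : label m t v = label m s v :=
  h.1 _ (slot_lt_outBase (by omega) _)

/-- The records of the surviving edges among the first `j` edges. -/
structure Listed (ends : Fin m → Fin n × Fin n) (lab : ℕ → ℕ) (Y j : ℕ) (t : State) : Prop where
  le : t.reg 1 ≤ j
  lt : ∀ k < t.reg 1, t.mem (Y + 3 * k) < j
  ne : ∀ k < t.reg 1, lab (tail ends (2 * t.mem (Y + 3 * k))) ≠
    lab (tail ends (2 * t.mem (Y + 3 * k) + 1))
  fst : ∀ k < t.reg 1, t.mem (Y + 3 * k + 1) = lab (tail ends (2 * t.mem (Y + 3 * k))) - 1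
  snd : ∀ k < t.reg 1, t.mem (Y + 3 * k + 2) = lab (tail ends (2 * t.mem (Y + 3 * k) + 1)) - 1
  inj : ∀ k < t.reg 1, ∀ l < t.reg 1, t.mem (Y + 3 * k) = t.mem (Y + 3 * l) → k = l
  surj : ∀ e < j, lab (tail ends (2 * e)) ≠ lab (tail ends (2 * e + 1)) →
    ∃ k < t.reg 1, t.mem (Y + 3 * k) = e

theorem Listed.skip {lab : ℕ → ℕ} {Y j : ℕ} {t t' : State} (h : Listed ends lab Y j t)
    (he : lab (tail ends (2 * j)) = lab (tail ends (2 * j + 1))) (hr : t'.reg 1 = t.reg 1)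
    (hm : t'.mem = t.mem) : Listed ends lab Y (j + 1) t' := by
  refine ⟨?_, ?_, ?_, ?_, ?_, ?_, ?_⟩ <;> simp only [hr, hm]
  · exact h.le.trans (Nat.le_succ _)
  · exact fun k hk => (h.lt k hk).trans (Nat.lt_succ_self _)
  · exact h.ne
  · exact h.fst
  · exact h.snd
  · exact h.inj
  · intro e hej hne
    refine h.surj e ?_ hne
    rcases Nat.lt_succ_iff_lt_or_eq.1 hej with h' | rfl
    · exact h'
    · exact absurd he hne

theorem Listed.push {lab : ℕ → ℕ} {Y j : ℕ} {t t' : State} (h : Listed ends lab Y j t)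
    (he : lab (tail ends (2 * j)) ≠ lab (tail ends (2 * j + 1))) (hr : t'.reg 1 = t.reg 1 + 1)
    (hm : ∀ a < Y + 3 * t.reg 1, t'.mem a = t.mem a) (h0 : t'.mem (Y + 3 * t.reg 1) = j)
    (h1 : t'.mem (Y + 3 * t.reg 1 + 1) = lab (tail ends (2 * j)) - 1)
    (h2 : t'.mem (Y + 3 * t.reg 1 + 2) = lab (tail ends (2 * j + 1)) - 1) :
    Listed ends lab Y (j + 1) t' := by
  have hm0 : ∀ k < t.reg 1, t'.mem (Y + 3 * k) = t.mem (Y + 3 * k) := fun k hk => hm _ (by omega)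
  have hm1 : ∀ k < t.reg 1, t'.mem (Y + 3 * k + 1) = t.mem (Y + 3 * k + 1) :=
    fun k hk => hm _ (by omega)
  have hm2 : ∀ k < t.reg 1, t'.mem (Y + 3 * k + 2) = t.mem (Y + 3 * k + 2) :=
    fun k hk => hm _ (by omega)
  refine ⟨?_, ?_, ?_, ?_, ?_, ?_, ?_⟩ <;> simp only [hr]
  · exact Nat.succ_le_succ h.le
  · intro k hk
    rcases Nat.lt_succ_iff_lt_or_eq.1 hk with hk | rfl
    · rw [hm0 k hk]; exact (h.lt k hk).trans (Nat.lt_succ_self _)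
    · rw [h0]; exact Nat.lt_succ_self _
  · intro k hk
    rcases Nat.lt_succ_iff_lt_or_eq.1 hk with hk | rfl
    · rw [hm0 k hk]; exact h.ne k hk
    · rw [h0]; exact he
  · intro k hk
    rcases Nat.lt_succ_iff_lt_or_eq.1 hk with hk | rfl
    · rw [hm0 k hk, hm1 k hk]; exact h.fst k hk
    · rw [h0, h1]
  · intro k hk
    rcases Nat.lt_succ_iff_lt_or_eq.1 hk with hk | rfl
    · rw [hm0 k hk, hm2 k hk]; exact h.snd k hk
    · rw [h0, h2]
  · intro k hk l hl
    rcases Nat.lt_succ_iff_lt_or_eq.1 hk with hk | rfl <;>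
      rcases Nat.lt_succ_iff_lt_or_eq.1 hl with hl | rfl
    · rw [hm0 k hk, hm0 l hl]; exact h.inj k hk l hl
    · rw [hm0 k hk, h0]; exact fun heq => absurd heq (h.lt k hk).ne
    · rw [hm0 l hl, h0]; exact fun heq => absurd heq.symm (h.lt l hl).ne
    · exact fun _ => rfl
  · intro e hej hne
    rcases Nat.lt_succ_iff_lt_or_eq.1 hej with hej | rfl
    · obtain ⟨k, hk, hke⟩ := h.surj e hej hne
      exact ⟨k, by omega, by rw [hm0 k hk, hke]⟩
    · exact ⟨_, Nat.lt_succ_self _, h0⟩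

theorem det_writeEdges (hw : 100 * (n + m + 1) ≤ 2 ^ w) {s : State} (hs : Ready ends s)
    (hlab : ∀ v < n, label m s v ≤ n) :
    ∃ s', Det w writeEdges s (100 * m + 10) s' ∧
      AgreeBelow (outBase n m) [1, 2, 3, 10, 11, 12, 13, 14] s s' ∧
      s'.reg 2 = outBase n m ∧ s'.reg 3 = outBase n m + 3 * m ∧
      Listed ends (label m s) (outBase n m) m s' := by
  have hw0 := wordLength_ne_zero hw
  have hd0 := det_exec (w := w) (by omega) writeInit rfl s (by
    simp [writeInit, Stmt.Fits, Stmt.exec, fits_add, fits_mul, fits_reg, fits_const, exact_add,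
      exact_mul, exact_reg, exact_const, setReg_reg, hs.reg4, hs.reg5, hs.reg6, base]
    omega)
  have hex0 : writeInit.exec s = ((s.setReg 2 (outBase n m)).setReg 3
      (outBase n m + 3 * m)).setReg 1 0 := by
    simp [writeInit, Stmt.exec, exact_add, exact_mul, exact_reg, exact_const, setReg_reg, hs.reg4,
      hs.reg5, hs.reg6]
  rw [hex0] at hd0
  obtain ⟨s', hd, -, hI⟩ := det_forUpTo (w := w) (by omega) (i := 10) (N := m)
    (e := reg[5]) (p := writeBody) rfl (by omega)
    (fun j t => AgreeBelow (outBase n m) [1, 2, 3, 10, 11, 12, 13, 14] s t ∧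
      t.reg 2 = outBase n m ∧ t.reg 3 = outBase n m + 3 * m ∧
      Listed ends (label m s) (outBase n m) j t)
    (((s.setReg 2 (outBase n m)).setReg 3 (outBase n m + 3 * m)).setReg 1 0)
    (by
      refine ⟨?_, by simp [setReg_reg], by simp [setReg_reg], ?_⟩
      · have : AgreeBelow (outBase n m) [1, 2, 3, 10, 11, 12, 13, 14] s s :=
          ⟨fun _ _ => rfl, fun _ _ => rfl⟩
        refine (((this.setReg ?_ _).setReg ?_ _).setReg ?_ _).setReg ?_ _ <;> simp
      · constructor <;> simp [setReg_reg])
    (fun j t ht => by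
      have hr := hs.agreeBelow ht.1 (Nat.le_add_right _ _) (by decide)
      exact ⟨trivial, hr.reg5⟩)
    (by
      rintro j t hj hrj ⟨ha, h2, h3, hL⟩
      have hr := hs.agreeBelow ha (Nat.le_add_right _ _) (by decide)
      have hin1 := even_input hr hj
      have hin2 := odd_input hr hj
      have htl1 := tail_lt (ends := ends) (h := 2 * j) (by omega)
      have htl2 := tail_lt (ends := ends) (h := 2 * j + 1) (by omega)
      have hl1 : t.mem (slot (base m) 7 (tail ends (2 * j))) = label m s (tail ends (2 * j)) :=
        label_agreeBelow ha htl1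
      have hl2 : t.mem (slot (base m) 7 (tail ends (2 * j + 1))) =
          label m s (tail ends (2 * j + 1)) := label_agreeBelow ha htl2
      have hn1 := hlab _ htl1
      have hn2 := hlab _ htl2
      have hle := hL.le
      set t₀ := (((t.setReg 11 (tail ends (2 * j))).setReg 12 (tail ends (2 * j + 1))).setReg 13
        (label m s (tail ends (2 * j)))).setReg 14 (label m s (tail ends (2 * j + 1))) with ht₀
      have ha₀ : AgreeBelow (outBase n m) [1, 2, 3, 10, 11, 12, 13, 14] s t₀ := by
        refine (((ha.setReg ?_ _).setReg ?_ _).setReg ?_ _).setReg ?_ _ <;> simp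
      set Z := outBase n m + 3 * t.reg 1 with hZ
      have hex : writeBody.exec t =
          if label m s (tail ends (2 * j)) = label m s (tail ends (2 * j + 1)) then t₀ else
            (((t₀.setMem Z j).setMem (Z + 1) (label m s (tail ends (2 * j)) - 1)).setMem (Z + 2)
              (label m s (tail ends (2 * j + 1)) - 1)).setReg 1 (t.reg 1 + 1) := by
        simp [writeBody, Stmt.exec, exact_add, exact_sub, exact_mul, exact_reg, exact_const,
          exact_load, exact_fld, exact_eq, setReg_reg, hr.reg6, hrj, hin1, hin2, hl1, hl2, h2, t₀,
          Z]
      have hfit : writeBody.Fits (2 ^ w) t := by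
        simp [writeBody, Stmt.Fits, Stmt.exec, exact_add, exact_sub, exact_mul, exact_reg,
          exact_const, exact_load, exact_fld, exact_eq, setReg_reg, hr.reg6, hrj, hin1, hin2, hl1,
          hl2, h2, fits_add, fits_sub, fits_mul, fits_reg, fits_const, fits_load, fits_fld, fits_eq]
        simp [slot, base]
        refine ⟨by omega, by omega, by omega, by omega, fun _ => ?_⟩
        unfold outBase base
        omega
      refine ⟨hfit, ?_⟩
      rw [hex]
      by_cases heq : label m s (tail ends (2 * j)) = label m s (tail ends (2 * j + 1))
      · rw [if_pos heq]
        refine ⟨by simp [t₀, setReg_reg, hrj], ha₀.setReg (by simp) _, by simp [t₀, setReg_reg, h2],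
          by simp [t₀, setReg_reg, h3], hL.skip heq (by simp [t₀, setReg_reg]) rfl⟩
      · rw [if_neg heq]
        refine ⟨by simp [t₀, setReg_reg, hrj], ?_, by simp [t₀, setReg_reg, h2],
          by simp [t₀, setReg_reg, h3], hL.push heq (by simp [setReg_reg]) ?_ ?_ ?_ ?_⟩
        · refine ((((ha₀.setMem ?_ _).setMem ?_ _).setMem ?_ _).setReg (by simp) _).setReg
            (by simp) _ <;> omega
        · intro a haZ
          simp only [setReg_mem, setMem_mem]
          rw [if_neg (by omega), if_neg (by omega), if_neg (by omega)]
          rfl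
        · simp only [setReg_mem, setMem_mem]
          rw [if_neg (by omega), if_neg (by omega), if_pos hZ.symm]
        · simp only [setReg_mem, setMem_mem]
          rw [if_neg (by omega), if_pos (by omega)]
        · simp only [setReg_mem, setMem_mem]
          rw [if_pos (by omega)])
  refine ⟨s', (hd0.seq hd).mono ?_, hI⟩
  simp only [writeInit, writeBody, Stmt.cost]
  omega

theorem det_writeNodes (hw : 100 * (n + m + 1) ≤ 2 ^ w) {s : State} (hs : Ready ends s)
    (hlab : ∀ v < n, label m s v ≤ n) (h3 : s.reg 3 = outBase n m + 3 * m) :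
    ∃ s', Det w writeNodes s (100 * n + 10) s' ∧
      AgreeBelow (outBase n m + 3 * m) [10] s s' ∧
      ∀ v < n, s'.mem (outBase n m + 3 * m + v) = label m s v - 1 := by
  have hw0 := wordLength_ne_zero hw
  obtain ⟨s', hd, -, hI⟩ := det_forUpTo (w := w) (by omega) (i := 10) (N := n)
    (e := reg[4]) (p := .store (reg[3] + reg[10]) (fld 7 reg[10] - num[1])) rfl (by omega)
    (fun j t => AgreeBelow (outBase n m + 3 * m) [10] s t ∧
      ∀ v < j, t.mem (outBase n m + 3 * m + v) = label m s v - 1) s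
    ⟨AgreeBelow.setReg ⟨fun _ _ => rfl, fun _ _ => rfl⟩ (by simp) _,
      fun v hv => absurd hv (Nat.not_lt_zero _)⟩
    (fun j t ht => by
      have hr := hs.agreeBelow ht.1 (by unfold outBase; omega) (by decide)
      exact ⟨trivial, hr.reg4⟩)
    (by
      rintro j t hj hrj ⟨ha, h1⟩
      have hr := hs.agreeBelow ha (by unfold outBase; omega) (by decide)
      have h3' : t.reg 3 = outBase n m + 3 * m := by rw [ha.2 3 (by simp), h3]
      have hl : t.mem (slot (base m) 7 j) = label m s j :=
        ha.1 _ ((slot_lt_outBase (n := n) (by omega) _).trans_le (Nat.le_add_right _ _))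
      have hn := hlab j hj
      have hex : (Stmt.store (reg[3] + reg[10]) (fld 7 reg[10] - num[1])).exec t =
          t.setMem (outBase n m + 3 * m + j) (label m s j - 1) := by
        simp [Stmt.exec, exact_add, exact_sub, exact_reg, exact_const, exact_fld, hr.reg6, hrj, h3',
          hl]
      refine ⟨?_, ?_, ?_, ?_⟩
      · simp [Stmt.Fits, fits_add, fits_sub, fits_reg, fits_const, fits_fld, exact_reg, exact_fld,
          hr.reg6, hrj, h3', hl]
        simp [slot, outBase, base]
        omega
      · rw [hex]
        exact hrj
      · rw [hex]
        exact (ha.setMem (by omega) _).setReg (by simp) _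
      · intro v hv
        rw [hex]
        simp only [setReg_mem, setMem_mem]
        by_cases hvj : v = j
        · rw [if_pos (by omega), hvj]
        · rw [if_neg (by omega), h1 v (by omega)])
  exact ⟨s', hd.mono (by simp only [Stmt.cost]; omega), hI⟩

theorem mem_edgeSet_contract (hends : IsEdgeList G ends) (D : Set (Sym2 (Fin n))) (e : Fin m) :
    edge ends e ∈ (contract G D).edgeSet ↔ e ∈ crossing ends D := by
  rw [mem_crossing, Graph.edge_mem_iff_exists_isLink]
  have he : edge ends e ∈ G.edgeSet := hends.2 ▸ Set.mem_range_self e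
  constructor
  · rintro ⟨x, y, -, hne, u, v, huv, rfl, rfl⟩ hr
    refine hne ((node_eq_iff D).2 ?_)
    rcases Sym2.eq_iff.1 huv with ⟨h1, h2⟩ | ⟨h1, h2⟩
    · rwa [← h1, ← h2]
    · rw [← h1, ← h2]; exact hr.symm
  · intro h
    exact ⟨_, _, he, mt (node_eq_iff D).1 h, _, _, rfl, rfl, rfl⟩

/-- Labels start at `1`, because `0` means unlabelled, while nodes are numbered from `0`. -/
theorem exists_numbering {mk : ℕ → Prop} {s : State} (h : Labelled ends mk s) :
    ∃ num : Node (markSet ends mk) ≃ Fin (s.reg 0),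
      ∀ v : Fin n, (num (node (markSet ends mk) v) : ℕ) = label m s v - 1 := by
  set f : Node (markSet ends mk) → Fin (s.reg 0) := SimpleGraph.ConnectedComponent.lift
    (fun v : Fin n => ⟨label m s v - 1, by
      have h1 := h.pos v v.2
      have h2 := h.le v v.2
      unfold label
      omega⟩)
    (fun u v p _ => by
      have := (h.eq_iff u v).2 ⟨p⟩
      simp only [label, this]) with hf
  refine ⟨Equiv.ofBijective f ⟨?_, ?_⟩, fun v => rfl⟩
  · intro x y
    refine x.ind fun u => y.ind fun v => ?_
    intro hxy
    have hxy' : label m s u - 1 = label m s v - 1 := congrArg Fin.val hxy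
    have h1 := h.pos u u.2
    have h2 := h.pos v v.2
    unfold label at hxy'
    exact (node_eq_iff _).2 ((h.eq_iff u v).1 (by omega))
  · intro k
    obtain ⟨v, hv, hk⟩ := h.surj (k + 1) (by omega) (by omega)
    refine ⟨node _ ⟨v, hv⟩, Fin.ext ?_⟩
    change label m s v - 1 = k
    rw [label, hk]
    rfl

theorem holdsContraction (hends : IsEdgeList G ends) {mk : ℕ → Prop} {s : State}
    (h : Labelled ends mk s) (hL : Listed ends (label m s) (s.reg 2) m s)
    (hN : ∀ v < n, s.mem (s.reg 3 + v) = label m s v - 1) :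
    HoldsContraction G ends (markSet ends mk) s := by
  obtain ⟨num, hnum⟩ := exists_numbering h
  have hsurv : ∀ e : Fin m, edge ends e ∈ (contract G (markSet ends mk)).edgeSet ↔
      label m s (tail ends (2 * e)) ≠ label m s (tail ends (2 * e + 1)) := by
    intro e
    rw [mem_edgeSet_contract hends, mem_crossing, tail_even, tail_odd]
    exact (not_congr (h.eq_iff _ _)).symm
  refine ⟨num, fun k => ⟨s.mem (s.reg 2 + 3 * k), hL.lt k k.2⟩, ?_, ?_, ?_, ?_⟩
  · intro k l hkl
    exact Fin.ext (hL.inj k k.2 l l.2 (congrArg Fin.val hkl))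
  · ext e
    constructor
    · rintro ⟨k, rfl⟩
      exact (hsurv _).2 (hL.ne k k.2)
    · intro he
      obtain ⟨k, hk, hke⟩ := hL.surj e e.2 ((hsurv e).1 he)
      exact ⟨⟨k, hk⟩, Fin.ext hke⟩
  · intro k
    refine ⟨rfl, ?_, ?_⟩
    · rw [hL.fst k k.2, hnum, ← tail_even]
    · rw [hL.snd k k.2, hnum, ← tail_odd]
  · intro v
    rw [hN v v.2, hnum]

end

end MinCut


/-! ### The algorithm -/

namespace MinCut

open WordRAM

section

variable {n m : ℕ} {G : SimpleGraph (Fin n)} {ends : Fin m → Fin n × Fin n} {w : ℕ}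

/-- The edges that are contracted in the end. -/
def rareSet (ends : Fin m → Fin n × Fin n) (B q : ℕ) (s : State) : Set (Sym2 (Fin n)) :=
  markSet ends fun e => B * s.mem (slot (base m) 9 e) < q

theorem det_finish (hw : 100 * (n + m + 1) ≤ 2 ^ w) (hends : IsEdgeList G ends) {d q B : ℕ}
    (hB : B < 2 ^ w) (hBq : B * q < 2 ^ w) {s : State} (hs : Prepared ends d q s)
    (hc : ∀ e, votes m s e ≤ q) :
    ∃ s', Det w (.seq (markRare B) (.seq findComponents (.seq writeEdges writeNodes))) s
      (500 * (n + m + 1)) s' ∧ HoldsContraction G ends (rareSet ends B q s) s' := by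
  obtain ⟨s₁, hd₁, ha₁, hm₁⟩ := det_markRare hw hB hBq hs fun e he => hc ⟨e, he⟩
  have hr₁ := hs.agree ha₁ (by decide) (by decide)
  obtain ⟨s₂, hd₂, ha₂, hl₂⟩ := det_findComponents hw hr₁
  have hr₂ := hr₁.agree ha₂ (by decide) (by decide)
  have hlab : ∀ v < n, label m s₂ v ≤ n := fun v hv => (hl₂.le v hv).trans hl₂.le_card
  obtain ⟨s₃, hd₃, ha₃, h2, h3, hL⟩ := det_writeEdges hw hr₂.toReady hlab
  have hr₃ := hr₂.toReady.agreeBelow ha₃ (Nat.le_add_right _ _) (by decide)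
  have hlab₃ : ∀ v < n, label m s₃ v = label m s₂ v := fun v hv => label_agreeBelow ha₃ hv
  obtain ⟨s₄, hd₄, ha₄, hN⟩ := det_writeNodes hw hr₃
    (fun v hv => by rw [hlab₃ v hv]; exact hlab v hv) h3
  refine ⟨s₄, (hd₁.seq (hd₂.seq (hd₃.seq hd₄))).mono (by omega), ?_⟩
  have hlab₄ : ∀ v < n, label m s₄ v = label m s₂ v := fun v hv => by
    rw [← hlab₃ v hv]
    exact ha₄.1 _ ((slot_lt_outBase (n := n) (by omega) _).trans_le (Nat.le_add_right _ _))
  have h0 : s₄.reg 0 = s₂.reg 0 := by rw [ha₄.2 0 (by simp), ha₃.2 0 (by simp)]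
  have h1 : s₄.reg 1 = s₃.reg 1 := ha₄.2 1 (by simp)
  have h2' : s₄.reg 2 = outBase n m := by rw [ha₄.2 2 (by simp), h2]
  have h3' : s₄.reg 3 = outBase n m + 3 * m := by rw [ha₄.2 3 (by simp), h3]
  have hset : rareSet ends B q s = markSet ends fun e => s₁.mem (slot (base m) 6 e) ≠ 0 :=
    markSet_congr fun e he => (hm₁ e he).symm
  rw [hset]
  refine holdsContraction hends ⟨?_, ?_, ?_, ?_, ?_⟩ ?_ ?_
  · intro v hv
    exact (hl₂.pos v hv).trans_eq (hlab₄ v hv).symm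
  · intro v hv
    rw [h0]
    exact (hlab₄ v hv).trans_le (hl₂.le v hv)
  · intro j hj hj'
    obtain ⟨v, hv, h⟩ := hl₂.surj j hj (h0 ▸ hj')
    exact ⟨v, hv, (hlab₄ v hv).trans h⟩
  · rw [h0]
    exact hl₂.le_card
  · intro u v
    rw [← hl₂.eq_iff u v]
    exact Eq.congr (hlab₄ u u.2) (hlab₄ v v.2)
  · rw [h2']
    have hm : ∀ k < s₃.reg 1, ∀ r < 3,
        s₄.mem (outBase n m + 3 * k + r) = s₃.mem (outBase n m + 3 * k + r) := fun k hk r hr =>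
      ha₄.1 _ (by have := hL.le; omega)
    have hm0 : ∀ k < s₃.reg 1, s₄.mem (outBase n m + 3 * k) = s₃.mem (outBase n m + 3 * k) :=
      fun k hk => hm k hk 0 (by omega)
    refine ⟨?_, ?_, ?_, ?_, ?_, ?_, ?_⟩ <;> simp only [h1]
    · exact hL.le
    · intro k hk
      rw [hm0 k hk]
      exact hL.lt k hk
    · intro k hk
      have hlt := hL.lt k hk
      rw [hm0 k hk, hlab₄ _ (tail_lt (by omega)), hlab₄ _ (tail_lt (by omega))]
      exact hL.ne k hk
    · intro k hk
      have hlt := hL.lt k hk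
      rw [hm0 k hk, hm k hk 1 (by omega), hlab₄ _ (tail_lt (by omega))]
      exact hL.fst k hk
    · intro k hk
      have hlt := hL.lt k hk
      rw [hm0 k hk, hm k hk 2 (by omega), hlab₄ _ (tail_lt (by omega))]
      exact hL.snd k hk
    · intro k hk l hl
      rw [hm0 k hk, hm0 l hl]
      exact hL.inj k hk l hl
    · intro e he hne
      rw [hlab₄ _ (tail_lt (by omega)), hlab₄ _ (tail_lt (by omega))] at hne
      obtain ⟨k, hk, h⟩ := hL.surj e he hne
      exact ⟨k, hk, by rw [hm0 k hk, h]⟩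
  · intro v hv
    rw [h3', hN v hv, hlab₃ v hv, hlab₄ v hv]

theorem det_readInput (hw : 100 * (n + m + 1) ≤ 2 ^ w) (ends : Fin m → Fin n × Fin n) :
    ∃ s, Det w readInput (inputState ends) 5 s ∧ Ready ends s ∧
      ∀ j i, s.mem (slot (base m) j i) = 0 := by
  have hw0 := wordLength_ne_zero hw
  have h0 : (inputState ends).mem 0 = n := rfl
  have h1 : (inputState ends).mem 1 = m := rfl
  have hd := det_exec (w := w) (by omega) readInput rfl (inputState ends) (by
    simp [readInput, Stmt.Fits, Stmt.exec, fits_load, fits_const, fits_add, fits_mul, fits_reg,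
      exact_load, exact_const, exact_mul, exact_reg, setReg_reg, h1]
    omega)
  have hex : readInput.exec (inputState ends) =
      (((inputState ends).setReg 4 n).setReg 5 m).setReg 6 (base m) := by
    simp [readInput, Stmt.exec, exact_load, exact_const, exact_mul, exact_add, exact_reg,
      setReg_reg, h0, h1]
  rw [hex] at hd
  refine ⟨_, hd.mono (by simp [readInput, Stmt.cost]), ⟨?_, ?_, ?_, fun _ _ => rfl⟩, ?_⟩
  · simp [setReg_reg]
  · simp [setReg_reg]
  · simp [setReg_reg]
  · intro j i
    have : slot (base m) j i = 2 * m + 2 + (16 * i + j) := by unfold slot base; omega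
    simp only [setReg_mem, inputState, this]
    rw [if_neg (by omega), if_neg (by omega), dif_neg (by omega)]

variable [DecidableRel G.Adj]

theorem det_prepare (hw : 100 * (n + m + 1) ≤ 2 ^ w) (hG : 0 < G.minDegree)
    (hends : IsEdgeList G ends) {A : ℕ} (hA : A * (Nat.size n + 1) < 2 ^ w) :
    ∃ s₁ s₂ s₃ s₄ T₁ T₂ T₃ T₄, Det w readInput (inputState ends) T₁ s₁ ∧ Det w buildLists s₁ T₂ s₂ ∧
      Det w findMinDegree s₂ T₃ s₃ ∧ Det w (countRounds A) s₃ T₄ s₄ ∧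
      T₁ + T₂ + T₃ + T₄ ≤ 200 * (n + m + 1) ∧
      Prepared ends G.minDegree (A * Nat.size n) s₄ ∧ votes m s₄ = 0 := by
  obtain ⟨s₁, hd₁, hr₁, hz⟩ := det_readInput hw ends
  obtain ⟨s₂, hd₂, ha₂, hdeg, hfst, hpos, hnext⟩ := det_buildLists hw s₁ hr₁ hz
  have hr₂ := hr₁.agree ha₂ (by decide)
  obtain ⟨-, hn⟩ := minDegree_lt hG
  have : Nonempty (Fin n) := ⟨⟨0, hn⟩⟩
  have hdeg' : ∀ v : Fin n, s₂.mem (slot (base m) 0 v) = G.degree v := fun v => by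
    rw [hdeg v v.2, count_eq_degree hends]
  obtain ⟨s₃, hd₃, ha₃, hle, v, hv, hmin⟩ := det_findMinDegree hw s₂ hr₂
    (fun v hv => by
      rw [hdeg' ⟨v, hv⟩]
      simpa using G.degree_lt_card_verts ⟨v, hv⟩) hn
  have h7 : s₃.reg 7 = G.minDegree := by
    refine le_antisymm ?_ ?_
    · obtain ⟨u, hu⟩ := G.exists_minimal_degree_vertex
      rw [hu, ← hdeg' u]
      exact hle u u.2
    · rw [hmin, hdeg' ⟨v, hv⟩]
      exact G.minDegree_le_degree _
  have hr₃ := hr₂.agree ha₃ (by decide)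
  obtain ⟨s₄, hd₄, ha₄, h8⟩ := det_countRounds hw s₃ hr₃ A hA
  have hr₄ := hr₃.agree ha₄ (by decide)
  have hsize : Nat.size n ≤ n := Nat.size_le.2 Nat.lt_two_pow_self
  have hm : ∀ j i, s₄.mem (slot (base m) j i) = s₂.mem (slot (base m) j i) := fun j i => by
    rw [ha₄.slot (by simp), ha₃.slot (by simp)]
  refine ⟨s₁, s₂, s₃, s₄, _, _, _, _, hd₁, hd₂, hd₃, hd₄, by omega, ⟨hr₄, ?_, h8, ?_, ?_, ?_, ?_⟩,
    ?_⟩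
  · rw [ha₄.2 7 (by simp), h7]
  · exact fun v hv => (hm _ _).trans (hdeg v hv)
  · exact fun v hv => (hm _ _).trans (hfst v hv)
  · exact fun v hv => (hm _ _).trans (hpos v hv)
  · exact fun v hv => (hm _ _).trans (hnext v hv)
  · funext e
    rw [votes, hm, ha₂.slot (by simp), hz]
    rfl

/-- What the algorithm achieves: it outputs the contraction of some set of edges,
all edges but `b` at most, and if this set contains an edge of `crit`, then the value is at least
`(1 / 2) ^ k`. -/
theorem wp_contraction (hw : 100 * (n + m + 1) ≤ 2 ^ w) (hG : 0 < G.minDegree)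
    (hends : IsEdgeList G ends) {A B K : ℕ} (hA : A * (Nat.size n + 1) < 2 ^ w) (hA0 : 0 < A)
    (hB : B < 2 ^ w) (hB0 : 0 < B) (hBA : B * (A * Nat.size n) < 2 ^ w)
    (hK : K < 2 ^ w) (hKn : K * n < 2 ^ w) {ε : ℝ} (hε0 : 0 < ε) (hε1 : ε ≤ 1)
    (hεK : 208 ≤ Real.exp (-(18 / ε)) * K) (crit : Finset (Fin m))
    (hcrit : ∀ e ∈ crit, ∃ S, IsNontrivialSmallCut G (2 - ε) S ∧ edge ends e ∈ cutEdges G S)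
    (f : State → ℝ≥0∞)
    (hf : ∀ (s : State) (F : Finset (Fin m)), F.card ≤ B * (K * n) →
      HoldsContraction G ends (edge ends '' (F : Set (Fin m))ᶜ) s →
      f s ≤ if ∃ e ∈ crit, e ∉ F then ENNReal.ofReal ((1 / 2) ^ (A * Nat.size n / B)) else 0) :
    WP w (contraction A B K) (inputState ends)
      (2000 * (n + m + 1) * (A * Nat.size n + 1)) f
      (ENNReal.ofReal ((1 - Real.exp (-(18 / ε)) / 4) ^ (A * Nat.size n) * crit.card)) := by
  classical
  have hw0 := wordLength_ne_zero hw
  obtain ⟨s₁, s₂, s₃, s₄, T₁, T₂, T₃, T₄, hd₁, hd₂, hd₃, hd₄, hT, hr₄, hv₄⟩ :=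
    det_prepare hw hG hends hA
  set q := A * Nat.size n with hq
  have hqpos : 0 < q := Nat.mul_pos hA0 (Nat.size_pos.2 (minDegree_lt hG).2)
  have hqlt : q < 2 ^ w := by
    have : A * Nat.size n ≤ A * (Nat.size n + 1) := Nat.mul_le_mul_left _ (Nat.le_succ _)
    omega
  have hrounds := wp_rounds hw hG hends hK hKn hqlt hr₄ hv₄ hε0 hε1 hεK crit hcrit
  refine (hd₁.seq_wp (hd₂.seq_wp (hd₃.seq_wp (hd₄.seq_wp (WP.seq (T₂ := 500 * (n + m + 1))
    (g := f) hrounds fun t ht => ?_))))).mono ?_ (fun _ => le_rfl) le_rfl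
  · obtain ⟨ha, hle, hsum⟩ := of_provided ht
    have hr := hr₄.agree ha (by decide) (by decide)
    obtain ⟨t', hd, hH⟩ := det_finish hw hends hB hBA hr hle
    refine hd.wp ?_
    rw [provided_pos ⟨ha, hle, hsum⟩]
    set F : Finset (Fin m) := Finset.univ.filter fun e => ¬ B * votes m t e < q with hF
    have hFc : rareSet ends B q t = edge ends '' (F : Set (Fin m))ᶜ := by
      ext z
      simp only [rareSet, markSet, Set.mem_image, Set.mem_compl_iff, Finset.mem_coe, hF,
        Finset.mem_filter, Finset.mem_univ, true_and, not_not, Set.mem_ofPred_eq]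
      exact exists_congr fun e => and_congr Iff.rfl eq_comm
    rw [hFc] at hH
    -- Double counting: every edge of `F` has at least `q / B` votes, and there are at most `q * (K
    -- * n)` votes in all.
    have hFcard : F.card ≤ B * (K * n) := by
      refine Nat.le_of_mul_le_mul_left (c := q) ?_ hqpos
      calc q * F.card = ∑ e ∈ F, q := by rw [Finset.sum_const, smul_eq_mul, mul_comm]
        _ ≤ ∑ e ∈ F, B * votes m t e := Finset.sum_le_sum fun e he => by
            have := (Finset.mem_filter.1 he).2
            omega
        _ ≤ ∑ e, B * votes m t e := Finset.sum_le_sum_of_subset (Finset.subset_univ _)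
        _ ≤ B * (q * (K * n)) := by
            rw [← Finset.mul_sum]
            exact Nat.mul_le_mul_left _ hsum
        _ = q * (B * (K * n)) := by ring
    refine (hf t' F hFcard hH).trans ?_
    split_ifs with h
    · obtain ⟨e, he, heF⟩ := h
      refine ENNReal.ofReal_le_ofReal ?_
      have hlt : B * votes m t e < q := by
        by_contra h
        exact heF (Finset.mem_filter.2 ⟨Finset.mem_univ _, h⟩)
      -- A contracted critical edge has at most `q / B` votes, so its term alone makes the potential
      -- this large.
      calc ((1 : ℝ) / 2) ^ (q / B) ≤ (1 / 2) ^ votes m t e := by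
            refine pow_le_pow_of_le_one (by norm_num) (by norm_num) ?_
            rw [Nat.le_div_iff_mul_le hB0]
            linarith [mul_comm B (votes m t e)]
        _ ≤ ∑ e ∈ crit, (1 / 2) ^ votes m t e :=
            Finset.single_le_sum (f := fun e => ((1 : ℝ) / 2) ^ votes m t e)
              (fun _ _ => by positivity) he
    · exact zero_le
  · obtain ⟨N, hN, hN0⟩ : ∃ N, N = n + m + 1 ∧ 0 < N := ⟨_, rfl, by omega⟩
    rw [← hN] at hT ⊢
    have h1 : (700 * N + 10) * q ≤ 710 * N * q := Nat.mul_le_mul_right q (by omega)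
    have h2 : 2000 * N * (q + 1) = 2000 * N * q + 2000 * N := by ring
    have h3 : 2000 * N * q = 710 * N * q + 1290 * N * q := by ring
    omega

end

end MinCut


/-! ### From expectations to sure statements and probabilities; numerical bounds -/

namespace WordRAM

/-- A finite expectation leaves no outcome of positive probability with value `∞`. All assertions
that hold in every run come from here. -/
theorem haltExp_support {w T : ℕ} {c C : Config} {f : State → ℝ≥0∞} (h : haltExp w T c f ≠ ∞)
    (hC : C ∈ (run w T c).support) : C.1 = [] ∧ f C.2 ≠ ∞ := by
  have h1 : run w T c C * (if C.1 = [] then f C.2 else ∞) ≠ ∞ := ENNReal.ne_top_of_tsum_ne_top h C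
  have h0 : run w T c C ≠ 0 := (PMF.mem_support_iff _ _).1 hC
  have h2 : (if C.1 = [] then f C.2 else ∞) ≠ ∞ := fun h => h1 (by rw [h, ENNReal.mul_top h0])
  split_ifs at h2 with h3
  · exact ⟨h3, h2⟩
  · exact absurd rfl h2

/-- Markov's inequality for the value of `f` at the end of the run. -/
theorem one_sub_le_toOuterMeasure {w T : ℕ} {c : Config} {f : State → ℝ≥0∞} {S : Set Config}
    {x : ℝ≥0∞} (hx0 : x ≠ 0) (hx : x ≠ ∞) (hf : ∀ C ∉ S, C.1 = [] → x ≤ f C.2) :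
    1 - haltExp w T c f / x ≤ (run w T c).toOuterMeasure S := by
  have h1 : (run w T c).toOuterMeasure Sᶜ * x ≤ haltExp w T c f := by
    rw [PMF.toOuterMeasure_apply, ← ENNReal.tsum_mul_right, haltExp]
    refine ENNReal.tsum_le_tsum fun C => ?_
    by_cases hC : C ∈ S
    · rw [Set.indicator_of_notMem (by simpa using hC), zero_mul]
      exact zero_le
    · rw [Set.indicator_of_mem (by simpa using hC)]
      gcongr
      split_ifs with h
      · exact hf C hC h
      · exact le_top
  have h2 : 1 ≤ (run w T c).toOuterMeasure S + (run w T c).toOuterMeasure Sᶜ := by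
    have : (run w T c).toOuterMeasure Set.univ = 1 := by
      rw [PMF.toOuterMeasure_apply, Set.indicator_univ, PMF.tsum_coe]
    rw [← this, ← Set.union_compl_self S]
    exact MeasureTheory.measure_union_le S Sᶜ
  rw [tsub_le_iff_right]
  refine h2.trans ?_
  gcongr
  rwa [ENNReal.le_div_iff_mul_le (Or.inl hx0) (Or.inl hx)]

end WordRAM

namespace MinCut

open WordRAM

section

variable {n m : ℕ} {G : SimpleGraph (Fin n)} {ends : Fin m → Fin n × Fin n} {w : ℕ}

theorem ncard_diff_le (hends : IsEdgeList G ends) (F : Finset (Fin m)) :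
    (G.edgeSet \ edge ends '' (F : Set (Fin m))ᶜ).ncard ≤ F.card := by
  rw [← Set.ncard_coe_finset]
  refine (Set.ncard_le_ncard ?_ (Set.toFinite _)).trans
    (Set.ncard_image_le (f := edge ends) (F.finite_toSet))
  rintro z ⟨hz, hzF⟩
  rw [← hends.2] at hz
  obtain ⟨e, rfl⟩ := hz
  refine ⟨e, ?_, rfl⟩
  by_contra he
  exact hzF ⟨e, he, rfl⟩

theorem edgeSet_contract_subset (D : Set (Sym2 (Fin n))) :
    (contract G D).edgeSet ⊆ G.edgeSet \ D := by
  intro z hz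
  rw [Graph.edge_mem_iff_exists_isLink] at hz
  obtain ⟨x, y, hz, hne, u, v, rfl, rfl, rfl⟩ := hz
  exact ⟨hz, fun hD => hne ((node_eq_iff D).2 (reachable_of_mem D hD))⟩

variable [DecidableRel G.Adj]

/-- A neighbor of `v` outside the component of `v` is joined to it by an edge that is not in `D`;
the other neighbors lie in the component. -/
theorem minDegree_le_ncard_inter_incidenceSet (D : Set (Sym2 (Fin n))) (v : Fin n) :
    G.minDegree ≤ ((G.edgeSet \ D) ∩ G.incidenceSet v).ncard + (comp D v).card := by
  classical
  refine (G.minDegree_le_degree v).trans ?_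
  rw [← G.card_neighborFinset_eq_degree]
  have h1 : (G.neighborFinset v).card ≤ (G.neighborFinset v \ comp D v).card + (comp D v).card := by
    rw [add_comm]
    exact Finset.card_le_card_sdiff_add_card.trans_eq (add_comm _ _)
  refine h1.trans (Nat.add_le_add_right ?_ _)
  rw [← Set.ncard_coe_finset]
  refine Set.ncard_le_ncard_of_injOn (fun u => s(v, u)) ?_ ?_ (Set.toFinite _)
  · intro u hu
    simp only [Finset.coe_sdiff, Set.mem_sdiff, Finset.mem_coe, SimpleGraph.mem_neighborFinset,
      mem_comp] at hu
    exact ⟨⟨hu.1, fun h => hu.2 (reachable_of_mem D h)⟩, hu.1, Sym2.mem_mk_left _ _⟩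
  · intro u _ u' _ h
    exact Sym2.congr_right.1 h

/-- Components with at least `δ / 2` vertices number at most `2 * n / δ`. A vertex in a smaller one
has more than `δ / 2` edges outside `D`; as each edge has two ends, there are at most `4 * C * n /
δ` such vertices. -/
theorem card_node_le_of_ncard_le (hG : 0 < G.minDegree) {D : Set (Sym2 (Fin n))} {C : ℝ}
    (hC : ((G.edgeSet \ D).ncard : ℝ) ≤ C * n) :
    (Nat.card (Node D) : ℝ) ≤ (2 + 4 * C) * (n / G.minDegree) := by
  classical
  have hδ : (0 : ℝ) < G.minDegree := by exact_mod_cast hG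
  have h1 := card_node_le D (half_pos hδ)
  have h2 : ∀ v : Fin n, (if ((comp D v).card : ℝ) < G.minDegree / 2 then (1 : ℝ) else 0) ≤
      2 / G.minDegree * ((G.edgeSet \ D) ∩ G.incidenceSet v).ncard := by
    intro v
    split_ifs with h
    · have h3 : (G.minDegree : ℝ) ≤ ((G.edgeSet \ D) ∩ G.incidenceSet v).ncard +
          (comp D v).card := by
        exact_mod_cast minDegree_le_ncard_inter_incidenceSet D v
      rw [div_mul_eq_mul_div, le_div_iff₀ hδ]
      linarith
    · positivity
  have h3 : (∑ v, (((G.edgeSet \ D) ∩ G.incidenceSet v).ncard : ℝ)) ≤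
      2 * (G.edgeSet \ D).ncard := by
    exact_mod_cast sum_ncard_inter_le G (G.edgeSet \ D)
  calc (Nat.card (Node D) : ℝ) ≤ n / (G.minDegree / 2) +
        ∑ v, 2 / G.minDegree * (((G.edgeSet \ D) ∩ G.incidenceSet v).ncard : ℝ) :=
        h1.trans (add_le_add le_rfl (Finset.sum_le_sum fun v _ => h2 v))
    _ ≤ n / (G.minDegree / 2) + 2 / G.minDegree * (2 * (C * n)) := by
        rw [← Finset.mul_sum]
        gcongr
        linarith
    _ = (2 + 4 * C) * (n / G.minDegree) := by
        field_simp
        ring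

theorem le_two_mul_edges (hG : 0 < G.minDegree) (hends : IsEdgeList G ends) : n ≤ 2 * m := by
  have h : ∀ u : Fin n, ∃ h : Fin (2 * m), tail ends h = u := fun u => by
    obtain ⟨v, hv⟩ := (G.degree_pos_iff_exists_adj u).1 (hG.trans_le (G.minDegree_le_degree u))
    obtain ⟨h, hh, h1, -⟩ := exists_halfEdge hends hv
    exact ⟨⟨h, hh⟩, h1⟩
  choose f hf using h
  simpa using Fintype.card_le_of_injective f fun u v huv => Fin.ext (by rw [← hf u, ← hf v, huv])

omit [DecidableRel G.Adj] in
theorem edges_le_sq (hends : IsEdgeList G ends) : m ≤ n * n := by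
  have : Function.Injective ends := fun e e' h => hends.1 (by simp only [h])
  simpa using Fintype.card_le_of_injective ends this

theorem size_le_log (hn : 2 ≤ n) : (Nat.size n : ℝ) ≤ 4 * Real.log n := by
  have h0 : n ≠ 0 := by omega
  have h1 : 2 ^ (Nat.size n - 1) ≤ n := by
    by_contra h
    have := Nat.size_le.2 (not_le.1 h)
    have := Nat.size_pos.2 (Nat.pos_of_ne_zero h0)
    omega
  have h2 : ((Nat.size n - 1 : ℕ) : ℝ) * Real.log 2 ≤ Real.log n := by
    rw [← Real.log_pow]
    exact Real.log_le_log (by positivity) (by exact_mod_cast h1)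
  have h3 : Real.log 2 ≤ Real.log n := Real.log_le_log (by norm_num) (by exact_mod_cast hn)
  have h4 := Real.log_two_gt_d9
  have h5 : (Nat.size n : ℝ) = ((Nat.size n - 1 : ℕ) : ℝ) + 1 := by
    have := Nat.size_pos.2 (Nat.pos_of_ne_zero h0)
    rw [Nat.cast_sub this]
    simp
  have h6 : (0 : ℝ) ≤ ((Nat.size n - 1 : ℕ) : ℝ) := Nat.cast_nonneg _
  rw [h5]
  nlinarith

theorem log_le_size (hn : 2 ≤ n) : Real.log n ≤ Nat.size n := by
  have h1 : (n : ℝ) ≤ 2 ^ Nat.size n := by exact_mod_cast (Nat.lt_size_self n).le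
  have h2 : Real.log n ≤ Nat.size n * Real.log 2 := by
    rw [← Real.log_pow]
    exact Real.log_le_log (by positivity) h1
  have h3 : Real.log 2 ≤ 1 := by
    have := Real.log_two_lt_d9
    linarith
  exact h2.trans (mul_le_of_le_one_right (Nat.cast_nonneg _) h3)

/-- In exponents: the rounds give `-(r / 4) * q`, the union bound over at most `n * n` edges adds `2
* log n`, and the Markov threshold adds at most `(r / 8) * q` because `B ≥ 8 / r`. The remaining `(r
/ 8) * q` is at least `(γ + 2) * log n`. -/
theorem failure_le {r γ : ℝ} (hr0 : 0 < r) (hr1 : r ≤ 1) {A B : ℕ} (hB : 8 / r ≤ B)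
    (hA : γ + 2 ≤ A * r / 8) (hn : 2 ≤ n) (hm : m ≤ n * n) :
    (1 - r / 4) ^ (A * Nat.size n) * m / (1 / 2) ^ (A * Nat.size n / B) ≤ (n : ℝ) ^ (-γ) := by
  set q := A * Nat.size n with hq
  have hn0 : (0 : ℝ) < n := by exact_mod_cast (by omega : 0 < n)
  have hB0 : (0 : ℝ) < B := lt_of_lt_of_le (by positivity) hB
  have h1 : (1 - r / 4) ^ q ≤ Real.exp (-(r / 4) * q) := by
    have : 1 - r / 4 ≤ Real.exp (-(r / 4)) := by
      have := Real.add_one_le_exp (-(r / 4))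
      linarith
    calc (1 - r / 4) ^ q ≤ Real.exp (-(r / 4)) ^ q := by
          refine pow_le_pow_left₀ (by linarith) this q
      _ = _ := by rw [← Real.exp_nat_mul, mul_comm]
  have h2 : (2 : ℝ) ^ (q / B) ≤ Real.exp (r / 8 * q) := by
    have h3 : (2 : ℝ) ≤ Real.exp 1 := by
      have := Real.add_one_le_exp (1 : ℝ)
      linarith
    calc (2 : ℝ) ^ (q / B) ≤ Real.exp 1 ^ (q / B) := pow_le_pow_left₀ (by norm_num) h3 _
      _ = Real.exp ((q / B : ℕ) : ℝ) := by rw [← Real.exp_nat_mul, mul_one]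
      _ ≤ Real.exp (r / 8 * q) := by
        rw [Real.exp_le_exp]
        refine Nat.cast_div_le.trans ?_
        rw [div_le_iff₀ hB0]
        rw [div_le_iff₀ hr0] at hB
        nlinarith [Nat.cast_nonneg (α := ℝ) q]
  have h3 : (m : ℝ) ≤ Real.exp (2 * Real.log n) := by
    rw [two_mul, Real.exp_add, Real.exp_log hn0]
    exact_mod_cast hm
  have hlog : 0 ≤ Real.log n := Real.log_nonneg (by exact_mod_cast (by omega : 1 ≤ n))
  have h4 : (γ + 2) * Real.log n ≤ r / 8 * q := by
    have h5 := log_le_size hn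
    have h6 : (γ + 2) * Real.log n ≤ A * r / 8 * Real.log n := by gcongr
    have h7 : A * r / 8 * Real.log n ≤ A * r / 8 * Nat.size n := by gcongr
    have h8 : r / 8 * (q : ℝ) = A * r / 8 * Nat.size n := by
      rw [hq]
      push_cast
      ring
    linarith
  have h9 : (1 - r / 4) ^ q * m / (1 / 2) ^ (q / B) = (1 - r / 4) ^ q * m * 2 ^ (q / B) := by
    rw [one_div, inv_pow, div_inv_eq_mul]
  rw [h9, Real.rpow_def_of_pos hn0]
  calc (1 - r / 4) ^ q * m * 2 ^ (q / B) ≤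
        Real.exp (-(r / 4) * q) * Real.exp (2 * Real.log n) * Real.exp (r / 8 * q) := by
        gcongr
    _ = Real.exp (-(r / 4) * q + 2 * Real.log n + r / 8 * q) := by
        rw [Real.exp_add, Real.exp_add]
    _ ≤ _ := by
        rw [Real.exp_le_exp]
        nlinarith

theorem lt_two_pow_of_le {x y c L w : ℕ} (hx : x < 2 ^ (y * L)) (hy : y ≤ c) (hw : c * L ≤ w) :
    x < 2 ^ w :=
  hx.trans_le (Nat.pow_le_pow_right (by norm_num) ((Nat.mul_le_mul_right L hy).trans hw))

theorem mul_lt_two_pow {a b x y L : ℕ} (ha : a < 2 ^ (x * L)) (hb : b < 2 ^ (y * L)) :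
    a * b < 2 ^ ((x + y) * L) := by
  rw [add_mul, pow_add]
  exact Nat.mul_lt_mul_of_lt_of_le ha hb.le (by positivity)

theorem const_lt_two_pow (a : ℕ) {L : ℕ} (hL : 0 < L) : a < 2 ^ (a * L) :=
  Nat.lt_two_pow_self.trans_le
    (Nat.pow_le_pow_right (by norm_num) (Nat.le_mul_of_pos_right a hL))

/-- Every quantity is below `2 ^ (y * Nat.size n)` for a constant `y`, a constant `a` itself with `y
= a`; exponents add under multiplication, and the word length covers the largest sum. -/
theorem word_bounds {A B K : ℕ} (hn : 2 ≤ n) (hm : m ≤ n * n)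
    (hw : (20 + A + B + K) * Nat.size n ≤ w) :
    100 * (n + m + 1) ≤ 2 ^ w ∧ A * (Nat.size n + 1) < 2 ^ w ∧ B < 2 ^ w ∧
      B * (A * Nat.size n) < 2 ^ w ∧ K < 2 ^ w ∧ K * n < 2 ^ w := by
  set L := Nat.size n with hL
  have hL0 : 0 < L := Nat.size_pos.2 (by omega)
  have hn1 : n < 2 ^ (1 * L) := by rw [one_mul]; exact Nat.lt_size_self n
  have hLL : L < 2 ^ (1 * L) := by rw [one_mul]; exact Nat.lt_two_pow_self
  have h2 : L + 1 < 2 ^ (2 * L) := by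
    have h : L + 1 < 2 ^ (L + 1) := Nat.lt_two_pow_self
    exact h.trans_le (Nat.pow_le_pow_right (by norm_num) (by omega))
  have h100 : 300 < 2 ^ (10 * L) :=
    lt_of_lt_of_le (by norm_num : 300 < 2 ^ 10) (Nat.pow_le_pow_right (by norm_num) (by omega))
  refine ⟨?_, ?_, ?_, ?_, ?_, ?_⟩
  · refine le_trans ?_ (lt_two_pow_of_le (mul_lt_two_pow h100 (mul_lt_two_pow hn1 hn1))
      (by omega) hw).le
    have h1 : n * 2 ≤ n * n := Nat.mul_le_mul_left n hn
    nlinarith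
  · exact lt_two_pow_of_le (mul_lt_two_pow (const_lt_two_pow A hL0) h2) (by omega) hw
  · exact lt_two_pow_of_le (const_lt_two_pow B hL0) (by omega) hw
  · exact lt_two_pow_of_le (mul_lt_two_pow (const_lt_two_pow B hL0)
      (mul_lt_two_pow (const_lt_two_pow A hL0) hLL)) (by omega) hw
  · exact lt_two_pow_of_le (const_lt_two_pow K hL0) (by omega) hw
  · exact lt_two_pow_of_le (mul_lt_two_pow (const_lt_two_pow K hL0) hn1) (by omega) hw

end

end MinCut

/-! ### The main theorem -/

theorem theorem2p1 (ε : ℝ) (hε0 : 0 < ε) (hε1 : ε ≤ 1) (γ : ℝ) (hγ : 0 < γ) :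
    ∃ (P : WordRAM.Stmt) (c : ℕ) (K : ℝ),
      ∀ (n m : ℕ) (G : SimpleGraph (Fin n)) [DecidableRel G.Adj]
        (ends : Fin m → Fin n × Fin n) (w : ℕ),
        0 < G.minDegree → MinCut.IsEdgeList G ends → c * Nat.size n ≤ w →
        ∃ T : ℕ, (T : ℝ) ≤ K * (m * Real.log n) ∧
          (∀ C ∈ (WordRAM.run w T ([P], MinCut.inputState ends)).support,
            C.1 = [] ∧ ∃ D : Set (Sym2 (Fin n)), D ⊆ G.edgeSet ∧
              MinCut.HoldsContraction G ends D C.2 ∧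
              ((MinCut.contract G D).vertexSet.ncard : ℝ) ≤ K * (n / G.minDegree) ∧
              ((MinCut.contract G D).edgeSet.ncard : ℝ) ≤ K * n) ∧
          ENNReal.ofReal (1 - (n : ℝ) ^ (-γ)) ≤
            (WordRAM.run w T ([P], MinCut.inputState ends)).toOuterMeasure
              {C | ∃ D : Set (Sym2 (Fin n)), D ⊆ G.edgeSet ∧
                MinCut.HoldsContraction G ends D C.2 ∧
                ∀ S : Set (Fin n), MinCut.IsNontrivialSmallCut G (2 - ε) S →
                  Disjoint (MinCut.cutEdges G S) D} := by
  classical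
  set r := Real.exp (-(18 / ε)) with hr
  have hr0 : 0 < r := Real.exp_pos _
  have hr1 : r ≤ 1 := Real.exp_le_one_iff.2 (by rw [neg_nonpos]; positivity)
  -- `K` makes rounds with too many crossing edges rare, `B` sets the share `1 / B` of votes below
  -- which an edge is contracted, and `A` gives enough rounds for the exponent `γ`.
  obtain ⟨K, hK⟩ := exists_nat_ge (208 / r)
  obtain ⟨B, hB⟩ := exists_nat_ge (8 / r)
  obtain ⟨A, hA⟩ := exists_nat_ge ((γ + 2) * 8 / r)
  have hA0 : 0 < A := by
    have : (0 : ℝ) < A := lt_of_lt_of_le (by positivity) hA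
    exact_mod_cast this
  have hB0 : 0 < B := by
    have : (0 : ℝ) < B := lt_of_lt_of_le (by positivity) hB
    exact_mod_cast this
  have hK' : 208 ≤ r * K := by
    rw [div_le_iff₀ hr0] at hK
    linarith
  have hA' : γ + 2 ≤ A * r / 8 := by
    rw [div_le_iff₀ hr0] at hA
    linarith
  refine ⟨MinCut.contraction A B K, 20 + A + B + K, 64000 * A + 2 + 4 * (B * K), ?_⟩
  intro n m G _ ends w hG hends hw
  obtain ⟨hδ, -⟩ := MinCut.minDegree_lt hG
  have hn : 2 ≤ n := by omega
  have hnm := MinCut.le_two_mul_edges hG hends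
  have hm := MinCut.edges_le_sq hends
  obtain ⟨hw1, hw2, hw3, hw4, hw5, hw6⟩ := MinCut.word_bounds hn hm hw
  set q := A * Nat.size n with hq
  have hsize : 0 < Nat.size n := Nat.size_pos.2 (by omega)
  have hsub : ∀ F : Set (Fin m), MinCut.edge ends '' F ⊆ G.edgeSet := by
    rintro F _ ⟨e, -, rfl⟩
    exact hends.2 ▸ Set.mem_range_self e
  set crit : Finset (Fin m) := Finset.univ.filter fun e =>
    ∃ S, MinCut.IsNontrivialSmallCut G (2 - ε) S ∧
      MinCut.edge ends e ∈ MinCut.cutEdges G S with hcrit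
  set Good : WordRAM.State → Prop := fun s => ∃ D : Set (Sym2 (Fin n)), D ⊆ G.edgeSet ∧
    MinCut.HoldsContraction G ends D s ∧
    ∀ S : Set (Fin n), MinCut.IsNontrivialSmallCut G (2 - ε) S →
      Disjoint (MinCut.cutEdges G S) D with hGood
  set Sound : WordRAM.State → Prop := fun s => ∃ F : Finset (Fin m), F.card ≤ B * (K * n) ∧
    MinCut.HoldsContraction G ends (MinCut.edge ends '' (F : Set (Fin m))ᶜ) s with hSound
  set x : ℝ := (1 / 2) ^ (q / B) with hx
  have hx0 : 0 < x := by positivity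
  have hwp := MinCut.wp_contraction hw1 hG hends hw2 hA0 hw3 hB0 hw4 hw5 hw6 hε0 hε1 hK' crit
    (fun e he => (Finset.mem_filter.1 he).2)
    -- The value `⊤` enforces the size bounds in every run, while `x` is the least potential of a
    -- run that contracts a critical edge.
    (fun s => if Sound s then (if Good s then 0 else ENNReal.ofReal x) else ⊤)
    (fun s F hF hH => by
      rw [if_pos (show Sound s from ⟨F, hF, hH⟩)]
      split_ifs with h1 h2 h2
      · exact zero_le
      · exact le_rfl
      · exact le_rfl
      · refine absurd ⟨_, hsub _, hH, fun S hS => ?_⟩ h1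
        rw [Set.disjoint_left]
        rintro _ hz ⟨e, he, rfl⟩
        exact h2 ⟨e, Finset.mem_filter.2 ⟨Finset.mem_univ _, S, hS, hz⟩, he⟩)
  have hle := hwp.haltExp_le
  refine ⟨2000 * (n + m + 1) * (q + 1), ?_, fun C hC => ?_, ?_⟩
  · have h1 : (2000 * (n + m + 1) * (q + 1) : ℕ) ≤ 2000 * (4 * m) * (2 * (A * Nat.size n)) := by
      have : 0 < A * Nat.size n := Nat.mul_pos hA0 hsize
      refine Nat.mul_le_mul (Nat.mul_le_mul_left _ ?_) ?_ <;> omega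
    have h2 := MinCut.size_le_log hn
    calc ((2000 * (n + m + 1) * (q + 1) : ℕ) : ℝ) ≤
          ((2000 * (4 * m) * (2 * (A * Nat.size n)) : ℕ) : ℝ) := by exact_mod_cast h1
      _ = 16000 * A * m * Nat.size n := by push_cast; ring
      _ ≤ 16000 * A * m * (4 * Real.log n) := by gcongr
      _ = 64000 * A * (m * Real.log n) := by ring
      _ ≤ _ := by
        have : 0 ≤ Real.log n := Real.log_natCast_nonneg n
        gcongr
        have : (0 : ℝ) ≤ B * K := by positivity
        linarith
  · obtain ⟨h1, h2⟩ := WordRAM.haltExp_support (ne_top_of_le_ne_top ENNReal.ofReal_ne_top hle) hC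
    refine ⟨h1, ?_⟩
    have h3 : Sound C.2 := by
      by_contra h
      exact h2 (if_neg h)
    obtain ⟨F, hF, hH⟩ := h3
    have hcard : ((G.edgeSet \ MinCut.edge ends '' (F : Set (Fin m))ᶜ).ncard : ℝ) ≤
        (B * K) * n := by
      have := (MinCut.ncard_diff_le hends F).trans hF
      rw [mul_assoc]
      exact_mod_cast this
    refine ⟨_, hsub _, hH, ?_, ?_⟩
    · have h4 := MinCut.card_node_le_of_ncard_le hG hcard
      change ((Set.univ : Set (MinCut.Node _)).ncard : ℝ) ≤ _
      rw [Set.ncard_univ]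
      refine h4.trans ?_
      gcongr
      have : (0 : ℝ) ≤ A := Nat.cast_nonneg A
      linarith
    · have h4 := Set.ncard_le_ncard (MinCut.edgeSet_contract_subset (G := G)
        (MinCut.edge ends '' (F : Set (Fin m))ᶜ)) (Set.toFinite _)
      refine le_trans (by exact_mod_cast h4) (hcard.trans ?_)
      gcongr
      have : (0 : ℝ) ≤ A := Nat.cast_nonneg A
      have : (0 : ℝ) ≤ B * K := by positivity
      linarith
  · have h1 := WordRAM.one_sub_le_toOuterMeasure (w := w) (T := 2000 * (n + m + 1) * (q + 1))
      (c := ([MinCut.contraction A B K], MinCut.inputState ends)) (S := {C | Good C.2})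
      (f := fun s => if Sound s then (if Good s then 0 else ENNReal.ofReal x) else ⊤)
      (x := ENNReal.ofReal x) (by simpa using hx0) ENNReal.ofReal_ne_top (fun C hC _ => by
        have hC' : ¬ Good C.2 := hC
        simp only [if_neg hC']
        split_ifs
        · exact le_rfl
        · exact le_top)
    refine le_trans ?_ h1
    rw [ENNReal.ofReal_sub _ (by positivity), ENNReal.ofReal_one]
    gcongr
    refine (ENNReal.div_le_div_right hle _).trans ?_
    rw [← ENNReal.ofReal_div_of_pos hx0]
    refine ENNReal.ofReal_le_ofReal (le_trans ?_
      (MinCut.failure_le (m := m) hr0 hr1 hB hA' hn hm))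
    have hcard : crit.card ≤ m := (Finset.card_le_univ _).trans_eq (Fintype.card_fin m)
    have : 0 ≤ 1 - r / 4 := by linarith
    gcongr
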